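/- Let $\mathbb{E}\subset\mathbb{R}^3$ be a compact convex set with non-empty interior whose boundary is a smooth surface with positive Gaussian curvature, and suppose that $\mathbb{E}$ is a body of revolution, $$\mathbb{E}=\{(x,y,z): f_2(r)\le z\le f_1(r),\ 0\le r\le r_\infty\},\qquad r=\sqrt{x^2+y^2},$$ where $f_2\le f_1$ on $[0,r_\infty]$. Write $f=f_1$ (derivatives at $0$ are one-sided), and assume that every zero of $f'''$ in $[0,r_\infty)$ is of finite order, i.e. $f'''(r)=0$ implies $f^{(n)}(r)\ne 0$ for some $n>3$; this holds in particular when $f$ is real analytic on $[0,r_\infty)$. Let $0=r_0<r_1<\dots<r_{j_0-1}$ be the zeros of $f'''$ in $[0,r_\infty)$, fix any $r_{j_0}$ with $r_{j_0-1}<r_{j_0}<r_\infty$, and put $u_j=(f'(r_j))^2$ for $0\le j\le j_0$. Let $g(\vec n)=\sup\{\vec x\cdot\vec n:\vec x\in\mathbb{E}\}$ be the support function of $\mathbb{E}$, let $h(n,m)=g(\sqrt n,0,m)$, let $r_2(n)$ be the number of representations of $n$ as a sum of two integer squares, let $e(t)=e^{2\pi i t}$, and define $$S(U_1,U_2,M)=\sum_{\substack{U_1\le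 n/m^2<U_2\\ M\le m<2M}} r_2(n)\,e(Rh(n,m)),$$ the sum being over integers $n\geq 0$ and $m$. Theorem 2. For every $\epsilon>0$ and $0\le j<j_0$ there is a constant $C$, depending only on $\mathbb{E}$, the chosen $r_{j_0}$, $\epsilon$ and $j$, such that for all real $R>1$, $M>0$ with $2M\le R^{5/8}$, and $0<U\le (u_{j+1}-u_j)/4$, $$|S(u_{j+1}-2U,u_{j+1}-U,M)|+|S(u_j+U,u_j+2U,M)|\le C\,M^2R^{3/8+\epsilon}.$$ -/

import Mathlib

open scoped ContDiff

noncomputable section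

namespace RevolutionBody

/-- Euclidean three-space. -/
abbrev E3 : Type := EuclideanSpace ℝ (Fin 3)

/-- The second fundamental form, at `p`, of the level surface of `Φ` through `p`
(up to the sign given by the choice of the unit normal), on tangent vectors `v`, `w`. -/
def secondForm (Φ : E3 → ℝ) (p v w : E3) : ℝ :=
  fderiv ℝ (fderiv ℝ Φ) p v w / ‖fderiv ℝ Φ p‖

/-- The Gaussian curvature, at `p`, of the level surface of `Φ` through `p`: the determinant of the
second fundamental form divided by that of the first one, both in the basis `v`, `w` of the
tangent plane. The value does not depend on the basis, nor on the choice of the unit normal. -/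
def gaussianCurvature (Φ : E3 → ℝ) (p v w : E3) : ℝ :=
  (secondForm Φ p v v * secondForm Φ p w w - secondForm Φ p v w ^ 2) /
    (inner ℝ v v * inner ℝ w w - inner ℝ v w ^ 2)

/-- A smooth convex body in three-space: compact and convex, with non-empty interior, whose boundary
is a smooth surface (locally a regular level set) of positive Gaussian curvature. -/
structure IsSmoothConvexBody (E : Set E3) : Prop where
  isCompact : IsCompact E
  convex : Convex ℝ E
  interior_nonempty : (interior E).Nonempty
  boundary : ∀ p ∈ frontier E, ∃ V : Set E3, IsOpen V ∧ p ∈ V ∧ ∃ Φ : E3 → ℝ,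
    ContDiffOn ℝ ∞ Φ V ∧ frontier E ∩ V = {x ∈ V | Φ x = 0} ∧ fderiv ℝ Φ p ≠ 0 ∧
    ∀ v w : E3, LinearIndependent ℝ ![v, w] → fderiv ℝ Φ p v = 0 → fderiv ℝ Φ p w = 0 →
      0 < gaussianCurvature Φ p v w

/-- `E` is the solid of revolution `f₂ r ≤ z ≤ f₁ r`, `0 ≤ r ≤ rInf`, with `r = √(x² + y²)`. -/
structure IsBodyOfRevolution (E : Set E3) (f₁ f₂ : ℝ → ℝ) (rInf : ℝ) : Prop where
  le : ∀ r ∈ Set.Icc 0 rInf, f₂ r ≤ f₁ r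
  eq : E = {p : E3 | √(p 0 ^ 2 + p 1 ^ 2) ≤ rInf ∧
    f₂ √(p 0 ^ 2 + p 1 ^ 2) ≤ p 2 ∧ p 2 ≤ f₁ √(p 0 ^ 2 + p 1 ^ 2)}

/-- The zeros of `f'''` in `[0, rInf)`; derivatives at `0` are one-sided. -/
def thirdDerivZeros (f : ℝ → ℝ) (rInf : ℝ) : Set ℝ :=
  {r ∈ Set.Ico 0 rInf | iteratedDerivWithin 3 f (Set.Ico 0 rInf) r = 0}

/-- Every zero of `f'''` in `[0, rInf)` has finite order. -/
def FiniteOrderZeros (f : ℝ → ℝ) (rInf : ℝ) : Prop :=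
  ∀ r ∈ thirdDerivZeros f rInf, ∃ n : ℕ, 3 < n ∧
    iteratedDerivWithin n f (Set.Ico 0 rInf) r ≠ 0

/-- `r 0 < r 1 < ⋯ < r (j₀ - 1)` are the zeros of `f'''` in `[0, rInf)`, the first one being `0`,
and `r j₀` is some further point of `(r (j₀ - 1), rInf)`. -/
structure IsZeroSubdivision (f : ℝ → ℝ) (rInf : ℝ) (j₀ : ℕ) (r : ℕ → ℝ) : Prop where
  zero : r 0 = 0
  strictMonoOn : StrictMonoOn r (Set.Iic j₀)
  zeros : thirdDerivZeros f rInf = r '' Set.Iio j₀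
  last_lt : r j₀ < rInf

/-- `u_j = (f'(r_j))²`. -/
def slopeSq (f : ℝ → ℝ) (rInf : ℝ) (r : ℕ → ℝ) (j : ℕ) : ℝ :=
  (derivWithin f (Set.Ico 0 rInf) (r j)) ^ 2

/-- The support function `g(ξ) = sup {x · ξ : x ∈ E}`. -/
def supportFn (E : Set E3) (ξ : E3) : ℝ := sSup ((fun x : E3 => inner ℝ x ξ) '' E)

/-- `h(n, m) = g(√n, 0, m)`. -/
def phase (E : Set E3) (n m : ℝ) : ℝ := supportFn E !₂[√n, 0, m]

/-- `e(t) = exp(2πit)`. -/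
def e (t : ℝ) : ℂ := Complex.exp (2 * Real.pi * Complex.I * t)

/-- The number of representations of `n` as a sum of two integer squares. -/
def r2 (n : ℕ) : ℕ := Set.ncard {p : ℤ × ℤ | p.1 ^ 2 + p.2 ^ 2 = (n : ℤ)}

/-- The exponential sum `S(U₁, U₂, M)`: the sum of `r₂(n) e(R h(n, m))` over `M ≤ m < 2M` and
`U₁ ≤ n / m² < U₂`. -/
def expSum (E : Set E3) (R U₁ U₂ M : ℝ) : ℂ :=
  ∑ m ∈ Finset.Ico ⌈M⌉₊ ⌈2 * M⌉₊, ∑ n ∈ Finset.Ico ⌈U₁ * (m : ℝ) ^ 2⌉₊ ⌈U₂ * (m : ℝ) ^ 2⌉₊,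
    (r2 n : ℂ) * e (R * phase E n m)

/-- The range of summation in `expSum` is the intended one. -/
theorem mem_expSum_range {U₁ U₂ M : ℝ} (hM : 0 < M) (n m : ℕ) :
    (m ∈ Finset.Ico ⌈M⌉₊ ⌈2 * M⌉₊ ∧ n ∈ Finset.Ico ⌈U₁ * (m : ℝ) ^ 2⌉₊ ⌈U₂ * (m : ℝ) ^ 2⌉₊) ↔
      (M ≤ m ∧ (m : ℝ) < 2 * M) ∧ U₁ ≤ (n : ℝ) / (m : ℝ) ^ 2 ∧ (n : ℝ) / (m : ℝ) ^ 2 < U₂ := by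
  simp only [Finset.mem_Ico, Nat.ceil_le, Nat.lt_ceil]
  refine and_congr_right fun h => ?_
  have hm : (0 : ℝ) < (m : ℝ) ^ 2 := pow_pos (hM.trans_le h.1) 2
  rw [le_div_iff₀ hm, div_lt_iff₀ hm]

end RevolutionBody

end

open RevolutionBody

/-! ### Divisor bounds -/

namespace RevolutionBody

/-! Let `F` be the even extension `x ↦ f₁ |x|` of the upper profile. It is smooth with `F'' < 0`, so
`-F'` has an inverse `r`. The support function is a Legendre transform: `h(n, m) = m K(√n / m)` with
`K(v) = v r(v) + F(r(v))`, and `K' = r` since `F'(r(v)) = -v`. Hence `∂h/∂n = r(√n / m) / (2√n)`.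
Moreover `r'' = F'''(r) r'³` vanishes only at the slopes of the zeros of `F'''`, and there to finite
order. When `n / m²` is at distance about `U` from `u_j` or `u_{j+1}`, the function `r''` therefore
has constant sign and known size. `PhaseBlock` records exactly this, with constants uniform in `U`
(`IsProfile.exists_phaseBlock`); everything else is a bound for an arbitrary block
(`exists_norm_phaseSum_le`).

For a block, put `t = R^(1/8)`; the goal is `M² t³` up to divisor bounds. Since `r₂(n) ≪ n^ε`,
Cauchy's inequality over `n` removes `r₂`. Splitting the sum over `m` into blocks of length `Q` and
expanding the square leaves sums over `n` with phase `R (h(n, m) - h(n, m + q))`, `q < Q`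
(`PhaseBlock.norm_phaseSum_sq_le`). Up to sign, the derivative of this phase in `n` is close to `X q
/ (m (m + q))` with `X = R α / 2`, and its second derivative has constant sign and size `l ≍ R q κ /
M⁴`. Van der Corput's second derivative test always applies, and the Kusmin–Landau inequality gives
`1 / ‖X q / (m (m + q))‖` unless that distance to the nearest integer is small
(`PhaseBlock.norm_sum_diff_le`).

It remains to show that these distances are rarely small. For fixed `q` this follows from the
spacing of the values as `m` varies (`card_distInt_modelSlope_le`), which suffices with `Q ≍ U² M² /
t⁶` if `U⁴ ≤ κ t¹⁰` or `U⁴ M ≤ t⁴`. Otherwise `Q ≍ U M` is taken, and `m` and `q ∈ [D, 2D)` are used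
together (`card_distInt_modelSlope_block_le`). Let `p / b` be a Dirichlet approximation to `X` and
`k` the integer nearest to `X q / (m (m + q))`. Then `w = b k m (m + q) - p q` is small, and `(b k m
- p)(b k (m + q) + p) = b k w - p²` is a non-zero integer of polynomial size. For given `k` and `w`
there are thus few pairs `(m, q)`, by the divisor bound. If `U M ≪ t³`, the trivial bound suffices.
-/

theorem exists_card_divisors_le_rpow {ε : ℝ} (hε : 0 < ε) :
    ∃ C : ℝ, 1 ≤ C ∧ ∀ n : ℕ, n ≠ 0 → (n.divisors.card : ℝ) ≤ C * (n : ℝ) ^ ε := by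
  -- Primes `p ≥ T` satisfy `p^ε ≥ 2`, so their factor `k + 1 ≤ 2^k` costs nothing. Each of the
  -- fewer than `T` smaller primes costs at most a factor `c`.
  obtain ⟨T, hT⟩ := exists_nat_gt ((2 : ℝ) ^ (1 / ε))
  have hlog : 0 < ε * Real.log 2 := mul_pos hε (Real.log_pos one_lt_two)
  set c : ℝ := 1 + 1 / (ε * Real.log 2) with hc
  have hc1 : 1 ≤ c := by rw [hc]; have := one_div_pos.2 hlog; linarith
  refine ⟨c ^ T, one_le_pow₀ hc1, fun n hn => ?_⟩
  have key : ∀ p ∈ n.primeFactors, ((n.factorization p + 1 : ℕ) : ℝ) ≤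
      (if p < T then c else 1) * (((p : ℝ) ^ (n.factorization p)) ^ ε) := by
    intro p hp
    have hp2 : (2 : ℝ) ≤ p := by exact_mod_cast (Nat.prime_of_mem_primeFactors hp).two_le
    set k := n.factorization p
    have hpk : ((p : ℝ) ^ k) ^ ε = ((p : ℝ) ^ ε) ^ k := by
      rw [← Real.rpow_natCast, ← Real.rpow_natCast, ← Real.rpow_mul (by positivity),
        ← Real.rpow_mul (by positivity), mul_comm]
    rw [hpk]
    split_ifs with h
    · have h1 : 1 + ε * Real.log 2 ≤ (p : ℝ) ^ ε := by
        calc 1 + ε * Real.log 2 ≤ Real.exp (ε * Real.log 2) := by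
              linarith [Real.add_one_le_exp (ε * Real.log 2)]
          _ = (2 : ℝ) ^ ε := by rw [Real.rpow_def_of_pos two_pos, mul_comm]
          _ ≤ (p : ℝ) ^ ε := Real.rpow_le_rpow (by norm_num) hp2 hε.le
      have h2 : 1 + k * (ε * Real.log 2) ≤ ((p : ℝ) ^ ε) ^ k :=
        (one_add_mul_le_pow (by linarith) k).trans (pow_le_pow_left₀ (by linarith) h1 k)
      have h3 : (k : ℝ) + 1 ≤ c * (1 + k * (ε * Real.log 2)) := by
        rw [hc]
        have : 1 / (ε * Real.log 2) * (k * (ε * Real.log 2)) = k := by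
          field_simp
        have h5 := one_div_pos.2 hlog
        have h6 : (0 : ℝ) ≤ k * (ε * Real.log 2) := by positivity
        nlinarith
      push_cast
      exact h3.trans (by gcongr)
    · push Not at h
      have h1 : (2 : ℝ) ≤ (p : ℝ) ^ ε := by
        have h2 : (2 : ℝ) ^ (1 / ε) ≤ p := hT.le.trans (by exact_mod_cast h)
        have := Real.rpow_le_rpow (by positivity) h2 hε.le
        rwa [← Real.rpow_mul (by norm_num), one_div_mul_cancel hε.ne', Real.rpow_one] at this
      rw [one_mul]
      calc ((k + 1 : ℕ) : ℝ) ≤ (2 : ℝ) ^ k := by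
            exact_mod_cast Nat.succ_le_of_lt (Nat.lt_two_pow_self)
        _ ≤ _ := pow_le_pow_left₀ (by norm_num) h1 k
  rw [Nat.card_divisors hn]
  have hprod : ∏ p ∈ n.primeFactors, (((p : ℝ) ^ (n.factorization p)) ^ ε) = (n : ℝ) ^ ε := by
    rw [Real.finsetProd_rpow _ _ (fun i _ => by positivity)]
    congr 1
    have := Nat.prod_factorization_pow_eq_self hn
    conv_rhs => rw [← this]
    simp [Finsupp.prod]
  push_cast
  calc ∏ p ∈ n.primeFactors, ((n.factorization p : ℝ) + 1)
      ≤ ∏ p ∈ n.primeFactors, ((if p < T then c else 1) * (((p : ℝ) ^ (n.factorization p)) ^ ε)) :=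
        Finset.prod_le_prod (fun i _ => by positivity) fun p hp => by
          have := key p hp; push_cast at this; exact this
    _ = (∏ p ∈ n.primeFactors, (if p < T then c else 1)) * (n : ℝ) ^ ε := by
        rw [Finset.prod_mul_distrib, hprod]
    _ ≤ c ^ T * (n : ℝ) ^ ε := by
        gcongr
        rw [Finset.prod_ite, Finset.prod_const, Finset.prod_const_one, mul_one]
        refine pow_le_pow_right₀ hc1 ?_
        calc _ ≤ (Finset.range T).card := Finset.card_le_card fun p hp => by
                simpa using (Finset.mem_filter.1 hp).2
          _ = T := Finset.card_range T

/-! ### Sums of two squares through Gaussian integers. -/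

/-- The number of Gaussian integers of norm `n`. -/
noncomputable def gaussNormCount (n : ℕ) : ℕ := Set.ncard {z : GaussianInt | z.norm = n}

theorem finite_gauss_norm (n : ℕ) : {z : GaussianInt | z.norm = n}.Finite := by
  refine Set.Finite.of_injOn (f := fun z : GaussianInt => (z.re, z.im))
    (t := (Set.Icc (-(n : ℤ)) n) ×ˢ (Set.Icc (-(n : ℤ)) n)) ?_ ?_ ?_
  · intro z hz
    have h : z.re * z.re + z.im * z.im = n := by
      have := hz.symm.trans (Zsqrtd.norm_def z); linarith
    simp only [Set.mem_prod, Set.mem_Icc]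
    refine ⟨⟨?_, ?_⟩, ?_, ?_⟩ <;> nlinarith [mul_self_nonneg z.re, mul_self_nonneg z.im]
  · intro z _ w _ h
    simp only [Prod.mk.injEq] at h
    exact Zsqrtd.ext h.1 h.2
  · exact (Set.finite_Icc _ _).prod (Set.finite_Icc _ _)

theorem r2_eq_gaussNormCount (n : ℕ) : r2 n = gaussNormCount n := by
  unfold r2 gaussNormCount
  refine Set.ncard_congr (fun p _ => (⟨p.1, p.2⟩ : GaussianInt)) ?_ ?_ ?_
  · intro p hp
    have : p.1 ^ 2 + p.2 ^ 2 = (n : ℤ) := hp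
    simp only [Set.mem_ofPred_eq, Zsqrtd.norm_def]; linarith
  · intro p q _ _ h
    simp only [Zsqrtd.mk.injEq] at h
    exact Prod.ext h.1 h.2
  · intro z hz
    have : z.re * z.re - -1 * z.im * z.im = n := by rw [← Zsqrtd.norm_def]; exact hz
    exact ⟨(z.re, z.im), by simp only [Set.mem_ofPred_eq]; linarith, rfl⟩

theorem gaussNormCount_one_le : gaussNormCount 1 ≤ 9 := by
  unfold gaussNormCount
  have : Set.ncard {z : GaussianInt | z.norm = (1 : ℕ)} ≤
      Set.ncard (((Finset.Icc (-1 : ℤ) 1) ×ˢ (Finset.Icc (-1 : ℤ) 1) : Finset (ℤ × ℤ)) :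
        Set (ℤ × ℤ)) := by
    refine Set.ncard_le_ncard_of_injOn (fun z : GaussianInt => (z.re, z.im)) ?_ ?_
      (Finset.finite_toSet _)
    · intro z hz
      have h : z.re * z.re + z.im * z.im = 1 := by
        have := hz.symm.trans (Zsqrtd.norm_def z); push_cast at this; linarith
      simp only [Finset.coe_product, Finset.coe_Icc, Set.mem_prod, Set.mem_Icc]
      refine ⟨⟨?_, ?_⟩, ?_, ?_⟩ <;> nlinarith [mul_self_nonneg z.re, mul_self_nonneg z.im]
    · intro z _ w _ h
      simp only [Prod.mk.injEq] at h
      exact Zsqrtd.ext h.1 h.2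
  refine this.trans ?_
  rw [Set.ncard_coe_finset]
  decide

theorem gauss_norm_eq_mul_star (z : GaussianInt) : ((z.norm : ℤ) : GaussianInt) = z * star z :=
  Zsqrtd.norm_eq_mul_conj z

theorem ncard_gauss_image_mul_le (c : GaussianInt) (m : ℕ) :
    Set.ncard ((fun w => c * w) '' {z : GaussianInt | z.norm = m}) ≤ gaussNormCount m :=
  Set.ncard_image_le (finite_gauss_norm m)

theorem gauss_dvd_of_natCast_dvd {p k m : ℕ} (hp : p.Prime) (hm : ¬ p ∣ m) (hk : 1 ≤ k)
    {z : GaussianInt} (hz : z.norm = (p ^ k * m : ℕ)) (hpz : (p : GaussianInt) ∣ z) :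
    2 ≤ k ∧ z ∈ (fun w => (p : GaussianInt) * w) ''
      {z : GaussianInt | z.norm = (p ^ (k - 2) * m : ℕ)} := by
  obtain ⟨w, rfl⟩ := hpz
  have hn : (p : ℤ) ^ 2 * w.norm = (p : ℤ) ^ k * m := by
    rw [Zsqrtd.norm_mul] at hz
    have : (p : GaussianInt).norm = (p : ℤ) ^ 2 := by
      rw [Zsqrtd.norm_natCast]; ring
    rw [this] at hz; push_cast at hz; exact hz
  have hp0 : (p : ℤ) ≠ 0 := by exact_mod_cast hp.ne_zero
  have hk2 : 2 ≤ k := by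
    by_contra h
    have : k = 1 := by omega
    subst this
    have h2 : (p : ℤ) * w.norm = m := by
      apply mul_left_cancel₀ hp0; linarith [hn]
    exact hm (by exact_mod_cast (Dvd.intro _ h2))
  refine ⟨hk2, w, ?_, rfl⟩
  simp only [Set.mem_ofPred_eq]
  obtain ⟨j, rfl⟩ := Nat.exists_eq_add_of_le hk2
  push_cast
  rw [show 2 + j - 2 = j by omega]
  apply mul_left_cancel₀ (pow_ne_zero 2 hp0)
  rw [hn]; ring

/-- If `p ∣ z`, dividing by `p` lowers the exponent by two. If `p ∤ z`, then `p` is not inert, `p =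
π π̄`, and `z` is divisible by `π^k` or by `π̄^k`; this leaves two copies of the elements of norm
`m`. -/
theorem gaussNormCount_prime_pow_mul_step {p k m : ℕ} (hp : p.Prime) (hm : ¬ p ∣ m)
    (hk : 1 ≤ k) :
    gaussNormCount (p ^ k * m) ≤
      2 * gaussNormCount m + if 2 ≤ k then gaussNormCount (p ^ (k - 2) * m) else 0 := by
  obtain ⟨π, ρ, hsub⟩ : ∃ π ρ : GaussianInt, ∀ z : GaussianInt, z.norm = (p ^ k * m : ℕ) →
      ¬ (p : GaussianInt) ∣ z →
      z ∈ (fun w => π * w) '' {z : GaussianInt | z.norm = (m : ℕ)} ∪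
        (fun w => ρ * w) '' {z : GaussianInt | z.norm = (m : ℕ)} := by
    have hnormdvd : ∀ z : GaussianInt, ∀ j n : ℕ, z.norm = (p ^ j * n : ℕ) →
        (p : GaussianInt) ^ j ∣ z * star z := by
      intro z j n hz
      rw [← gauss_norm_eq_mul_star, hz]
      exact ⟨(n : GaussianInt), by push_cast; ring⟩
    by_cases hpp : Irreducible (p : GaussianInt)
    -- Inert `p`: from `p ∣ z z̄` it follows that `p ∣ z`, so the case `p ∤ z` is void and the
    -- multipliers are arbitrary.
    · refine ⟨0, 0, fun z hz hpz => absurd ?_ hpz⟩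
      have h1 : (p : GaussianInt) ∣ z * star z :=
        (dvd_pow_self _ (by omega)).trans (hnormdvd z k m hz)
      rcases hpp.prime.dvd_or_dvd h1 with h | h
      · exact h
      · obtain ⟨w, hw⟩ := h
        refine ⟨star w, ?_⟩
        have := congrArg star hw
        rw [star_star, star_mul, mul_comm] at this
        simpa using this
    · have := Fact.mk hp
      obtain ⟨a, b, hab⟩ := GaussianInt.sq_add_sq_of_nat_prime_of_not_irreducible p hpp
      set π : GaussianInt := ⟨a, b⟩ with hπ
      have hπn : π.norm = p := by
        rw [Zsqrtd.norm_def, hπ]; push_cast [← hab]; ring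
      have hirr : ∀ x : GaussianInt, x.norm = p → Irreducible x := by
        intro x hx
        refine ⟨?_, ?_⟩
        · intro hu
          rw [Zsqrtd.isUnit_iff_norm_isUnit, hx] at hu
          have := Int.isUnit_iff.1 hu
          have h2 := hp.two_le
          omega
        · intro y w hyw
          have : y.norm.natAbs * w.norm.natAbs = p := by
            rw [← Int.natAbs_mul, ← Zsqrtd.norm_mul, ← hyw, hx, Int.natAbs_natCast]
          rcases (Nat.prime_mul_iff.1 (this ▸ hp)) with ⟨_, h⟩ | ⟨_, h⟩
          · right; rw [Zsqrtd.isUnit_iff_norm_isUnit, Int.isUnit_iff_natAbs_eq]; exact h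
          · left; rw [Zsqrtd.isUnit_iff_norm_isUnit, Int.isUnit_iff_natAbs_eq]; exact h
      have hρn : (star π).norm = p := by rw [Zsqrtd.norm_conj, hπn]
      have hP : Prime π := (hirr π hπn).prime
      have hQ : Prime (star π) := (hirr _ hρn).prime
      have hpπ : (p : GaussianInt) = π * star π := by
        rw [← gauss_norm_eq_mul_star, hπn]; simp
      have hstar : ∀ x y : GaussianInt, ∀ j : ℕ, x ^ j ∣ star y → (star x) ^ j ∣ y := by
        rintro x y j ⟨w, hw⟩
        refine ⟨star w, ?_⟩
        have := congrArg star hw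
        rw [star_star, star_mul, star_pow, mul_comm] at this
        exact this
      have hmem : ∀ x z : GaussianInt, x.norm = p → z.norm = (p ^ k * m : ℕ) → x ^ k ∣ z →
          z ∈ (fun w => x ^ k * w) '' {z : GaussianInt | z.norm = (m : ℕ)} := by
        rintro x z hx hz ⟨w, rfl⟩
        refine ⟨w, ?_, rfl⟩
        have hxk : (x ^ k).norm = (p : ℤ) ^ k := by
          rw [← hx]; exact map_pow (Zsqrtd.normMonoidHom (d := -1)) x k
        rw [Zsqrtd.norm_mul, hxk] at hz
        push_cast at hz
        have hp0 : (p : ℤ) ≠ 0 := by exact_mod_cast hp.ne_zero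
        exact mul_left_cancel₀ (pow_ne_zero k hp0) hz
      refine ⟨π ^ k, star π ^ k, fun z hz hpz => ?_⟩
      have hd := hnormdvd z k m hz
      rw [hpπ, mul_pow] at hd
      by_cases h1 : π ∣ z
      · by_cases h2 : star π ∣ z
        · obtain ⟨w, rfl⟩ := h1
          -- `π̄ ∣ π` is the ramified case: for `k ≥ 2` it forces `p ∣ z`, and for `k = 1` the
          -- divisor `π` already suffices. Otherwise `π π̄ = p` divides `z` outright.
          rcases hQ.dvd_or_dvd h2 with h3 | h3
          · rcases Nat.lt_or_ge k 2 with hk2 | hk2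
            · left
              refine hmem π _ hπn hz ?_
              rw [show k = 1 by omega, pow_one]
              exact dvd_mul_right _ _
            · exfalso
              obtain ⟨j, rfl⟩ := Nat.exists_eq_add_of_le hk2
              have hw : w.norm = (p ^ 1 * (p ^ j * m) : ℕ) := by
                rw [Zsqrtd.norm_mul, hπn] at hz
                have hp0 : (p : ℤ) ≠ 0 := by exact_mod_cast hp.ne_zero
                apply mul_left_cancel₀ hp0
                rw [hz]; push_cast; ring
              have hdw := hnormdvd w 1 _ hw
              have hπw : π ∣ w * star w := by
                refine Dvd.dvd.trans ?_ hdw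
                rw [pow_one, hpπ]; exact dvd_mul_right _ _
              have h4 : star π ∣ w := by
                rcases hP.dvd_or_dvd hπw with h | h
                · exact h3.trans h
                · simpa using hstar π w 1 (by simpa using h)
              exact hpz (by rw [hpπ]; exact mul_dvd_mul_left _ h4)
          · exact absurd (by rw [hpπ]; exact mul_dvd_mul_left _ h3) hpz
        · left
          refine hmem π z hπn hz ?_
          have h3 : star π ^ k ∣ star z :=
            hQ.pow_dvd_of_dvd_mul_left k h2 ((dvd_mul_left _ _).trans hd)
          simpa using hstar (star π) z k h3
      · right
        refine hmem (star π) z hρn hz ?_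
        have h3 : π ^ k ∣ star z :=
          hP.pow_dvd_of_dvd_mul_left k h1 ((dvd_mul_right _ _).trans hd)
        exact hstar π z k h3
  set S1 := (fun w => π * w) '' {z : GaussianInt | z.norm = (m : ℕ)}
  set S2 := (fun w => ρ * w) '' {z : GaussianInt | z.norm = (m : ℕ)}
  set S3 := (fun w => (p : GaussianInt) * w) ''
      {z : GaussianInt | z.norm = (p ^ (k - 2) * m : ℕ)}
  have f1 : S1.Finite := (finite_gauss_norm m).image _
  have f2 : S2.Finite := (finite_gauss_norm m).image _
  have f3 : S3.Finite := (finite_gauss_norm _).image _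
  have c1 : S1.ncard ≤ gaussNormCount m := ncard_gauss_image_mul_le _ _
  have c2 : S2.ncard ≤ gaussNormCount m := ncard_gauss_image_mul_le _ _
  have c3 : S3.ncard ≤ gaussNormCount (p ^ (k - 2) * m) := ncard_gauss_image_mul_le _ _
  have c12 : (S1 ∪ S2).ncard ≤ 2 * gaussNormCount m :=
    (Set.ncard_union_le _ _).trans (by omega)
  split_ifs with hk2
  · calc gaussNormCount (p ^ k * m) ≤ ((S1 ∪ S2) ∪ S3).ncard := by
          refine Set.ncard_le_ncard ?_ ((f1.union f2).union f3)
          intro z hz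
          by_cases hpz : (p : GaussianInt) ∣ z
          · exact Or.inr (gauss_dvd_of_natCast_dvd hp hm hk hz hpz).2
          · exact Or.inl (hsub z hz hpz)
      _ ≤ (S1 ∪ S2).ncard + S3.ncard := Set.ncard_union_le _ _
      _ ≤ _ := by omega
  · rw [add_zero]
    refine le_trans (Set.ncard_le_ncard ?_ (f1.union f2)) c12
    intro z hz
    by_cases hpz : (p : GaussianInt) ∣ z
    · exact absurd (gauss_dvd_of_natCast_dvd hp hm hk hz hpz).1 hk2
    · exact hsub z hz hpz

/-- The recursion from `k` to `k - 2` adds two at each step: `2 + (k - 2 + 1) = k + 1`. -/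
theorem gaussNormCount_prime_pow_mul_le {p m : ℕ} (hp : p.Prime) (hm : ¬ p ∣ m) (k : ℕ) :
    gaussNormCount (p ^ k * m) ≤ (k + 1) * gaussNormCount m := by
  induction k using Nat.strong_induction_on with
  | _ k ih =>
    rcases Nat.eq_zero_or_pos k with rfl | hk
    · simp
    · have h := gaussNormCount_prime_pow_mul_step hp hm hk
      split_ifs at h with h2
      · have h3 := ih (k - 2) (by omega)
        obtain ⟨j, rfl⟩ := Nat.exists_eq_add_of_le h2
        rw [show 2 + j - 2 = j by omega] at h h3
        nlinarith
      · have : 2 * gaussNormCount m ≤ (k + 1) * gaussNormCount m :=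
          Nat.mul_le_mul_right _ (by omega)
        omega

/-- The count is not multiplicative because of the units, so the induction carries a coprime
cofactor `m` and peels off one prime power at a time. -/
theorem gaussNormCount_mul_le (n : ℕ) : n ≠ 0 → ∀ m : ℕ, n.Coprime m →
    gaussNormCount (n * m) ≤ n.divisors.card * gaussNormCount m := by
  induction n using Nat.recOnPosPrimePosCoprime with
  | prime_pow p k hp hk =>
    intro _ m hm
    rw [Nat.divisors_prime_pow hp, Finset.card_map, Finset.card_range]
    refine gaussNormCount_prime_pow_mul_le hp (fun h => ?_) k
    exact (Nat.Prime.coprime_iff_not_dvd hp).1 (Nat.Coprime.coprime_dvd_left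
      (dvd_pow_self p (by omega)) hm) h
  | zero => intro h; exact absurd rfl h
  | one => intro _ m _; simp
  | coprime a b ha hb hab iha ihb =>
    intro _ m hm
    have h1 := iha (by omega) (b * m) (Nat.Coprime.mul_right hab (Nat.Coprime.coprime_mul_right hm))
    have h2 := ihb (by omega) m (Nat.Coprime.coprime_mul_left hm)
    rw [mul_assoc, Nat.Coprime.card_divisors_mul hab, mul_assoc]
    exact h1.trans (Nat.mul_le_mul_left _ h2)

theorem r2_le_card_divisors {n : ℕ} (hn : n ≠ 0) : r2 n ≤ 9 * n.divisors.card := by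
  rw [r2_eq_gaussNormCount]
  have h := gaussNormCount_mul_le n hn 1 (Nat.coprime_one_right n)
  rw [mul_one] at h
  have := gaussNormCount_one_le
  nlinarith

/-- The first factor is a divisor of `|T|` with a sign, and it determines the second one since `T ≠
0`. -/
theorem card_int_mul_eq_le {T : ℤ} (hT : T ≠ 0) (s : Finset (ℤ × ℤ))
    (hs : ∀ x ∈ s, x.1 * x.2 = T) : s.card ≤ 2 * T.natAbs.divisors.card := by
  have hinj : Set.InjOn (fun x : ℤ × ℤ => (x.1.natAbs, decide (0 ≤ x.1))) s := by
    rintro ⟨a, b⟩ hx ⟨a', b'⟩ hy h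
    simp only [Prod.mk.injEq, decide_eq_decide] at h
    have h1 := hs _ hx
    have h2 := hs _ hy
    simp only at h1 h2
    have haa : a = a' := by omega
    subst haa
    have ha : a ≠ 0 := by rintro rfl; simp at h1; exact hT h1.symm
    rw [mul_left_cancel₀ ha (h1.trans h2.symm)]
  calc s.card = (s.image (fun x : ℤ × ℤ => (x.1.natAbs, decide (0 ≤ x.1)))).card :=
        (Finset.card_image_of_injOn hinj).symm
    _ ≤ (T.natAbs.divisors ×ˢ (Finset.univ : Finset Bool)).card := by
        refine Finset.card_le_card fun y hy => ?_
        obtain ⟨x, hx, rfl⟩ := Finset.mem_image.1 hy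
        simp only [Finset.mem_product, Nat.mem_divisors, Finset.mem_univ, and_true]
        exact ⟨by rw [← hs x hx, Int.natAbs_mul]; exact dvd_mul_right _ _, by simpa using hT⟩
    _ = 2 * T.natAbs.divisors.card := by
        rw [Finset.card_product, Finset.card_univ, Fintype.card_bool, mul_comm]

end RevolutionBody

/-! ### The Kusmin–Landau inequality and the second derivative test -/

namespace RevolutionBody

theorem e_eq_exp (t : ℝ) : e t = Complex.exp ((2 * Real.pi * t : ℝ) * Complex.I) := by
  unfold e; congr 1; push_cast; ring

theorem norm_e (t : ℝ) : ‖e t‖ = 1 := by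
  rw [e_eq_exp, Complex.norm_exp_ofReal_mul_I]

theorem e_add (s t : ℝ) : e (s + t) = e s * e t := by
  unfold e; rw [← Complex.exp_add]; congr 1; push_cast; ring

theorem e_neg (t : ℝ) : e (-t) = (starRingEnd ℂ) (e t) := by
  rw [e_eq_exp, e_eq_exp, ← Complex.exp_conj, map_mul, Complex.conj_ofReal, Complex.conj_I]
  congr 1
  push_cast
  ring

theorem e_intCast (k : ℤ) : e k = 1 := by
  unfold e
  rw [Complex.exp_eq_one_iff]
  exact ⟨k, by push_cast; ring⟩

theorem e_sub_int (t : ℝ) (k : ℤ) : e (t - k) = e t := by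
  have : e (t - k) * e (k : ℝ) = e t := by rw [← e_add]; congr 1; ring
  rwa [e_intCast, mul_one] at this

theorem e_mul_conj (s t : ℝ) : e s * (starRingEnd ℂ) (e t) = e (s - t) := by
  rw [← e_neg, ← e_add, sub_eq_add_neg]

theorem norm_sum_e_neg (s : Finset ℕ) (F : ℕ → ℝ) :
    ‖∑ n ∈ s, e (-F n)‖ = ‖∑ n ∈ s, e (F n)‖ := by
  simp_rw [e_neg]
  rw [← map_sum, RCLike.norm_conj]

theorem norm_sum_e_le_card (s : Finset ℕ) (F : ℕ → ℝ) : ‖∑ n ∈ s, e (F n)‖ ≤ s.card := by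
  refine (norm_sum_le _ _).trans ?_
  simp [norm_e]

/-- `1 / (e t - 1)`, in terms of the cotangent. -/
noncomputable def cotWeight (t : ℝ) : ℂ :=
  -1 / 2 - Complex.I / 2 * (Real.cos (Real.pi * t) / Real.sin (Real.pi * t) : ℝ)

theorem two_mul_le_sin_pi_mul {θ t : ℝ} (hθ : 0 < θ) (h1 : θ ≤ t) (h2 : t ≤ 1 - θ) :
    2 * θ ≤ Real.sin (Real.pi * t) := by
  have hπ := Real.pi_pos
  have key : ∀ s : ℝ, θ ≤ s → s ≤ 1 / 2 → 2 * θ ≤ Real.sin (Real.pi * s) := by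
    intro s h3 h4
    have := Real.mul_le_sin (x := Real.pi * s) (by nlinarith) (by nlinarith)
    have h5 : 2 / Real.pi * (Real.pi * s) = 2 * s := by field_simp
    linarith
  rcases le_total t (1 / 2) with h | h
  · exact key t h1 h
  · have := key (1 - t) (by linarith) (by linarith)
    rwa [show Real.pi * (1 - t) = Real.pi - Real.pi * t by ring, Real.sin_pi_sub] at this

theorem cotWeight_mul {t : ℝ} (h : Real.sin (Real.pi * t) ≠ 0) :
    cotWeight t * (e t - 1) = 1 := by
  have he : e t = (Real.cos (2 * (Real.pi * t)) : ℂ) +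
      (Real.sin (2 * (Real.pi * t)) : ℂ) * Complex.I := by
    rw [e_eq_exp, Complex.exp_mul_I]
    push_cast
    rw [show (2 : ℂ) * Real.pi * t = 2 * (Real.pi * t) by ring]
  rw [he, Real.cos_two_mul, Real.sin_two_mul, cotWeight]
  have hsc := Real.sin_sq_add_cos_sq (Real.pi * t)
  set s := Real.sin (Real.pi * t)
  set c := Real.cos (Real.pi * t)
  have hsc' : (s : ℂ) ^ 2 + (c : ℂ) ^ 2 = 1 := by exact_mod_cast hsc
  have hs : (s : ℂ) ≠ 0 := by exact_mod_cast h
  have h1 : ((2 * c ^ 2 - 1 : ℝ) : ℂ) + ((2 * s * c : ℝ) : ℂ) * Complex.I - 1 =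
      2 * s * (-s + c * Complex.I) := by
    push_cast
    linear_combination 2 * hsc'
  rw [h1]
  push_cast
  field_simp
  linear_combination hsc' - (c : ℂ) ^ 2 * Complex.I_sq

theorem norm_cotWeight_le {θ t : ℝ} (hθ : 0 < θ) (h1 : θ ≤ t) (h2 : t ≤ 1 - θ) :
    ‖cotWeight t‖ ≤ 1 / 2 + 1 / (4 * θ) := by
  have hs := two_mul_le_sin_pi_mul hθ h1 h2
  unfold cotWeight
  refine (norm_sub_le _ _).trans ?_
  rw [norm_mul, Complex.norm_real]
  have h3 : ‖Real.cos (Real.pi * t) / Real.sin (Real.pi * t)‖ ≤ 1 / (2 * θ) := by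
    rw [norm_div, Real.norm_eq_abs, Real.norm_eq_abs]
    exact div_le_div₀ zero_le_one (Real.abs_cos_le_one _) (by linarith) (hs.trans (le_abs_self _))
  have h4 : ‖(-1 / 2 : ℂ)‖ = 1 / 2 := by norm_num
  have h5 : ‖(Complex.I / 2 : ℂ)‖ = 1 / 2 := by simp
  rw [h4, h5]
  have : 1 / (4 * θ) = 1 / 2 * (1 / (2 * θ)) := by field_simp; norm_num
  rw [this]
  gcongr

/-- The real parts cancel, and the cotangent decreases on `(0, π)`. Having an equality here makes
the total variation telescope. -/
theorem norm_cotWeight_sub_eq {s t : ℝ} (h0 : 0 < s) (hst : s ≤ t) (h1 : t < 1) :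
    ‖cotWeight s - cotWeight t‖ = (Real.cos (Real.pi * s) / Real.sin (Real.pi * s) -
      Real.cos (Real.pi * t) / Real.sin (Real.pi * t)) / 2 := by
  have hπ := Real.pi_pos
  have e1 : cotWeight s - cotWeight t = -(Complex.I / 2) *
      ((Real.cos (Real.pi * s) / Real.sin (Real.pi * s) -
      Real.cos (Real.pi * t) / Real.sin (Real.pi * t) : ℝ) : ℂ) := by
    unfold cotWeight; push_cast; ring
  have hs : 0 < Real.sin (Real.pi * s) :=
    Real.sin_pos_of_pos_of_lt_pi (by positivity) (by nlinarith)
  have ht : 0 < Real.sin (Real.pi * t) :=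
    Real.sin_pos_of_pos_of_lt_pi (by nlinarith) (by nlinarith)
  have h2 : 0 ≤ Real.cos (Real.pi * s) / Real.sin (Real.pi * s) -
      Real.cos (Real.pi * t) / Real.sin (Real.pi * t) := by
    rw [div_sub_div _ _ hs.ne' ht.ne']
    refine div_nonneg ?_ (by positivity)
    have := Real.sin_nonneg_of_nonneg_of_le_pi (x := Real.pi * t - Real.pi * s)
      (by nlinarith) (by nlinarith)
    rw [Real.sin_sub] at this
    linarith
  rw [e1, norm_mul, Complex.norm_real, Real.norm_of_nonneg h2]
  simp
  ring

/-- Summation by parts. With `g n = F (n + 1) - F n` one has `e (F n) = cotWeight (g n) * (e (F (n +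
1)) - e (F n))`. As `g` is monotone, the variation of the weights collapses to a difference of two
cotangents. -/
theorem norm_sum_e_sub_le {F : ℕ → ℝ} {a : ℕ} {θ : ℝ} (hθ : 0 < θ) (b : ℕ) (hab : a < b)
    (h1 : ∀ n, a ≤ n → n < b → θ ≤ F (n + 1) - F n)
    (h2 : ∀ n, a ≤ n → n < b → F (n + 1) - F n ≤ 1 - θ)
    (hmono : ∀ n, a ≤ n → n + 1 < b → F (n + 1) - F n ≤ F (n + 2) - F (n + 1)) :
    ‖∑ n ∈ Finset.Ico a b, e (F n) - cotWeight (F (b - 1 + 1) - F (b - 1)) * e (F b) +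
      cotWeight (F (a + 1) - F a) * e (F a)‖ ≤
    (Real.cos (Real.pi * (F (a + 1) - F a)) / Real.sin (Real.pi * (F (a + 1) - F a)) -
      Real.cos (Real.pi * (F (b - 1 + 1) - F (b - 1))) /
        Real.sin (Real.pi * (F (b - 1 + 1) - F (b - 1)))) / 2 := by
  have hstep : ∀ n, a ≤ n → n < b →
      cotWeight (F (n + 1) - F n) * (e (F (n + 1)) - e (F n)) = e (F n) := by
    intro n hn hn'
    have hs := two_mul_le_sin_pi_mul hθ (h1 n hn hn') (h2 n hn hn')
    have : e (F (n + 1)) = e (F (n + 1) - F n) * e (F n) := by rw [← e_add]; congr 1; ring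
    rw [this, ← sub_one_mul, ← mul_assoc, cotWeight_mul (by linarith), one_mul]
  induction b, hab using Nat.le_induction with
  | base =>
    simp only [Nat.succ_eq_add_one, Nat.Ico_succ_singleton, Finset.sum_singleton,
      Nat.add_sub_cancel, sub_self, zero_div, norm_le_zero_iff]
    have := hstep a le_rfl (Nat.lt_succ_self a)
    linear_combination -this
  | succ b hab ih =>
    have hab' : a + 1 ≤ b := hab
    have hi := ih (fun n hn hn' => h1 n hn (by omega)) (fun n hn hn' => h2 n hn (by omega))
      (fun n hn hn' => hmono n hn (by omega)) (fun n hn hn' => hstep n hn (by omega))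
    rw [Finset.sum_Ico_succ_top (by omega)]
    obtain ⟨k, rfl⟩ : ∃ k, b = k + 1 := ⟨b - 1, by omega⟩
    simp only [Nat.add_sub_cancel] at hi ⊢
    have hw := norm_cotWeight_sub_eq (s := F (k + 1) - F k) (t := F (k + 1 + 1) - F (k + 1))
      (by linarith [h1 k (by omega) (by omega)]) (hmono k (by omega) (by omega))
      (by linarith [h2 (k + 1) (by omega) (by omega)])
    have hs := hstep (k + 1) (by omega) (by omega)
    have heq : ∑ n ∈ Finset.Ico a (k + 1), e (F n) + e (F (k + 1)) -
        cotWeight (F (k + 1 + 1) - F (k + 1)) * e (F (k + 1 + 1)) +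
          cotWeight (F (a + 1) - F a) * e (F a) =
        (∑ n ∈ Finset.Ico a (k + 1), e (F n) - cotWeight (F (k + 1) - F k) * e (F (k + 1)) +
          cotWeight (F (a + 1) - F a) * e (F a)) +
        (cotWeight (F (k + 1) - F k) - cotWeight (F (k + 1 + 1) - F (k + 1))) *
          e (F (k + 1)) := by
      linear_combination -hs
    rw [heq]
    refine (norm_add_le _ _).trans ?_
    rw [norm_mul, norm_e, mul_one, hw]
    linarith

/-- Only differences inside the range are controlled, so the last term is split off. The two
boundary weights, the variation and this term give at most `2 + 1 / θ ≤ 3 / θ`. -/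
theorem norm_sum_e_le_of_diff_mem {F : ℕ → ℝ} {a b : ℕ} {θ : ℝ} (hθ : 0 < θ) (hθ' : θ ≤ 1)
    (h1 : ∀ n, a ≤ n → n + 1 < b → θ ≤ F (n + 1) - F n)
    (h2 : ∀ n, a ≤ n → n + 1 < b → F (n + 1) - F n ≤ 1 - θ)
    (hmono : ∀ n, a ≤ n → n + 2 < b → F (n + 1) - F n ≤ F (n + 2) - F (n + 1)) :
    ‖∑ n ∈ Finset.Ico a b, e (F n)‖ ≤ 3 / θ := by
  have hone : 1 ≤ 1 / θ := (one_le_div hθ).2 hθ'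
  have h3 : 3 / θ = 3 * (1 / θ) := by ring
  rcases Nat.lt_or_ge (a + 1) b with hab | hab
  · obtain ⟨b, rfl⟩ : ∃ k, b = k + 1 := ⟨b - 1, by omega⟩
    have h := norm_sum_e_sub_le hθ b (by omega) (fun n hn hn' => h1 n hn (by omega))
      (fun n hn hn' => h2 n hn (by omega)) (fun n hn hn' => hmono n hn (by omega))
    have hcot : ∀ n, a ≤ n → n < b → |Real.cos (Real.pi * (F (n + 1) - F n)) /
        Real.sin (Real.pi * (F (n + 1) - F n))| ≤ 1 / (2 * θ) := by
      intro n hn hn'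
      have hs := two_mul_le_sin_pi_mul hθ (h1 n hn (by omega)) (h2 n hn (by omega))
      rw [abs_div]
      exact div_le_div₀ zero_le_one (Real.abs_cos_le_one _) (by linarith)
        (hs.trans (le_abs_self _))
    have c1 := abs_le.1 (hcot a le_rfl (by omega))
    have c2 := abs_le.1 (hcot (b - 1) (by omega) (by omega))
    have w1 := norm_cotWeight_le hθ (h1 a le_rfl (by omega)) (h2 a le_rfl (by omega))
    have w2 := norm_cotWeight_le hθ (h1 (b - 1) (by omega) (by omega))
      (h2 (b - 1) (by omega) (by omega))
    rw [Finset.sum_Ico_succ_top (by omega)]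
    set S := ∑ n ∈ Finset.Ico a b, e (F n)
    set A := cotWeight (F (b - 1 + 1) - F (b - 1)) * e (F b) with hA
    set B := cotWeight (F (a + 1) - F a) * e (F a) with hB
    have hAn : ‖A‖ ≤ 1 / 2 + 1 / (4 * θ) := by rw [hA, norm_mul, norm_e, mul_one]; exact w2
    have hBn : ‖B‖ ≤ 1 / 2 + 1 / (4 * θ) := by rw [hB, norm_mul, norm_e, mul_one]; exact w1
    have htri : ‖S + e (F b)‖ ≤ ‖S - A + B‖ + ‖A‖ + ‖B‖ + ‖e (F b)‖ := by
      calc ‖S + e (F b)‖ = ‖(S - A + B) + A - B + e (F b)‖ := by congr 1; ring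
        _ ≤ ‖(S - A + B) + A - B‖ + ‖e (F b)‖ := norm_add_le _ _
        _ ≤ ‖(S - A + B) + A‖ + ‖B‖ + ‖e (F b)‖ := by gcongr; exact norm_sub_le _ _
        _ ≤ _ := by gcongr; exact norm_add_le _ _
    rw [norm_e] at htri
    have h4 : 1 / (4 * θ) = 1 / 4 * (1 / θ) := by field_simp
    have h5 : 1 / (2 * θ) = 1 / 2 * (1 / θ) := by field_simp
    rw [h4] at hAn hBn
    rw [h5] at c1 c2
    rw [h3]
    linarith [c1.1, c1.2, c2.1, c2.2]
  · refine (norm_sum_e_le_card _ _).trans ?_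
    rw [Nat.card_Ico]
    have : ((b - a : ℕ) : ℝ) ≤ 1 := by exact_mod_cast (by omega : b - a ≤ 1)
    linarith

/-- **Kusmin–Landau inequality**. -/
theorem norm_sum_e_le_of_diff_mem_int {F : ℕ → ℝ} {a b : ℕ} {θ : ℝ} (hθ : 0 < θ) (hθ' : θ ≤ 1)
    (ν : ℤ) (h1 : ∀ n, a ≤ n → n + 1 < b → ν + θ ≤ F (n + 1) - F n)
    (h2 : ∀ n, a ≤ n → n + 1 < b → F (n + 1) - F n ≤ ν + 1 - θ)
    (hmono : ∀ n, a ≤ n → n + 2 < b → F (n + 1) - F n ≤ F (n + 2) - F (n + 1)) :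
    ‖∑ n ∈ Finset.Ico a b, e (F n)‖ ≤ 3 / θ := by
  have h : ∀ n : ℕ, e (F n - ν * n) = e (F n) := fun n => by
    have := e_sub_int (F n) (ν * n); push_cast at this; exact this
  have key := norm_sum_e_le_of_diff_mem (F := fun n => F n - ν * n) (a := a) (b := b) hθ hθ'
    (fun n hn hn' => by have := h1 n hn hn'; push_cast; linarith)
    (fun n hn hn' => by have := h2 n hn hn'; push_cast; linarith)
    (fun n hn hn' => by have := hmono n hn hn'; push_cast; linarith)
  simpa only [h] using key

theorem exists_eq_Ico_of_ordConnected (s : Finset ℕ)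
    (hs : ∀ x ∈ s, ∀ y ∈ s, ∀ z, x ≤ z → z ≤ y → z ∈ s) : ∃ a b, s = Finset.Ico a b := by
  rcases s.eq_empty_or_nonempty with rfl | hne
  · exact ⟨0, 0, by simp⟩
  · refine ⟨s.min' hne, s.max' hne + 1, ?_⟩
    ext z
    simp only [Finset.mem_Ico]
    exact ⟨fun hz => ⟨s.min'_le z hz, Nat.lt_succ_of_le (s.le_max' z hz)⟩, fun ⟨h1, h2⟩ =>
      hs _ (s.min'_mem hne) _ (s.max'_mem hne) z h1 (Nat.le_of_lt_succ h2)⟩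

theorem card_le_of_spaced (s : Finset ℕ) (G : ℕ → ℝ) {x δ l : ℝ} (hl : 0 < l) (hδ : 0 ≤ δ)
    (h1 : ∀ n ∈ s, x ≤ G n) (h2 : ∀ n ∈ s, G n ≤ x + δ)
    (hG : ∀ m ∈ s, ∀ n ∈ s, m ≤ n → l * ((n : ℝ) - m) ≤ G n - G m) :
    (s.card : ℝ) ≤ δ / l + 1 := by
  rcases s.eq_empty_or_nonempty with rfl | hne
  · simp; positivity
  · set p := s.min' hne
    set q := s.max' hne
    have hp := s.min'_mem hne
    have hq := s.max'_mem hne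
    have hpq : p ≤ q := s.min'_le _ hq
    have hsub : s ⊆ Finset.Icc p q := fun z hz =>
      Finset.mem_Icc.2 ⟨s.min'_le z hz, s.le_max' z hz⟩
    have hcard := Finset.card_le_card hsub
    rw [Nat.card_Icc] at hcard
    have h3 : (s.card : ℝ) ≤ (q : ℝ) - p + 1 := by
      have : s.card + p ≤ q + 1 := by omega
      have : (s.card : ℝ) + p ≤ q + 1 := by exact_mod_cast this
      linarith
    have h4 := hG p hp q hq hpq
    have h5 : (q : ℝ) - p ≤ δ / l := by
      rw [le_div_iff₀ hl]
      have := h1 p hp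
      have := h2 q hq
      nlinarith
    linarith

theorem mul_sub_le_of_step {g : ℕ → ℝ} {a b : ℕ} {l : ℝ}
    (h : ∀ n, a ≤ n → n + 1 < b → l ≤ g (n + 1) - g n) (m n : ℕ) (ham : a ≤ m) (hmn : m ≤ n)
    (hn : n < b) : l * ((n : ℝ) - m) ≤ g n - g m := by
  induction n, hmn using Nat.le_induction with
  | base => simp
  | succ k hk ih =>
    have := ih (by omega)
    have := h k (by omega) hn
    push_cast
    linarith

theorem norm_sum_e_floor_fiber_le {F : ℕ → ℝ} {a b : ℕ} {l : ℝ} (hl : 0 < l) (hl1 : l ≤ 1)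
    (h : ∀ n, a ≤ n → n + 1 < b → l ≤ (F (n + 2) - F (n + 1)) - (F (n + 1) - F n)) (k : ℤ) :
    ‖∑ n ∈ Finset.Ico a b with ⌊F (n + 1) - F n⌋ = k, e (F n)‖ ≤ 10 / √l := by
  set g : ℕ → ℝ := fun n => F (n + 1) - F n with hg
  have hgrow := mul_sub_le_of_step (g := g) h
  have hmono : ∀ m n, a ≤ m → m ≤ n → n < b → g m ≤ g n := fun m n h1 h2 h3 => by
    have := hgrow m n h1 h2 h3
    have : (m : ℝ) ≤ n := by exact_mod_cast h2
    nlinarith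
  have hsl : 0 < √l := Real.sqrt_pos.2 hl
  have hsl1 : √l ≤ 1 := Real.sqrt_le_one.2 hl1
  have hsq : √l * √l = l := Real.mul_self_sqrt hl.le
  -- This choice balances the number `δ / l + 1` of `n` whose difference lies within `δ` of an
  -- integer against the Kusmin–Landau bound `3 / δ` for the remaining ones.
  set δ := √l / 2 with hδ
  have hδ0 : 0 < δ := by positivity
  set s := {n ∈ Finset.Ico a b | ⌊g n⌋ = k} with hs
  set lo := {n ∈ s | g n < k + δ} with hlo
  set mid := {n ∈ s | k + δ ≤ g n ∧ g n ≤ k + 1 - δ} with hmid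
  set hi := {n ∈ s | ¬ (g n < k + δ) ∧ ¬ (g n ≤ k + 1 - δ)} with hhi
  have hmem : ∀ n ∈ s, (a ≤ n ∧ n < b) ∧ (k : ℝ) ≤ g n ∧ g n < k + 1 := by
    intro n hn
    rw [hs, Finset.mem_filter, Finset.mem_Ico, Int.floor_eq_iff] at hn
    exact hn
  have hsplit : ∑ n ∈ s, e (F n) =
      ∑ n ∈ lo, e (F n) + ∑ n ∈ mid, e (F n) + ∑ n ∈ hi, e (F n) := by
    have e1 := Finset.sum_filter_add_sum_filter_not s (fun n => g n < k + δ) (fun n => e (F n))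
    have e2 := Finset.sum_filter_add_sum_filter_not (Finset.filter (fun n => ¬ (g n < k + δ)) s)
        (fun n => g n ≤ k + 1 - δ) (fun n => e (F n))
    rw [Finset.filter_filter (fun n => ¬ (g n < k + δ)) (fun n => g n ≤ k + 1 - δ) s,
      Finset.filter_filter (fun n => ¬ (g n < k + δ)) (fun n => ¬ g n ≤ k + 1 - δ) s] at e2
    have e3 : mid = {n ∈ s | ¬ (g n < k + δ) ∧ g n ≤ k + 1 - δ} := by
      rw [hmid]; ext n; simp only [Finset.mem_filter, not_lt]
    rw [e3, add_assoc, e2, e1]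
  have hcount : ∀ t ⊆ s, ∀ x : ℝ, (∀ n ∈ t, x ≤ g n) → (∀ n ∈ t, g n ≤ x + δ) →
      ‖∑ n ∈ t, e (F n)‖ ≤ 2 / √l := by
    intro t ht x hx1 hx2
    refine (norm_sum_e_le_card _ _).trans ?_
    have := card_le_of_spaced t g hl hδ0.le hx1 hx2 (fun m hm n hn hmn =>
      hgrow m n (hmem m (ht hm)).1.1 hmn (hmem n (ht hn)).1.2)
    refine this.trans ?_
    have h1 : δ / l = 1 / 2 * (1 / √l) := by
      rw [hδ]; nth_rewrite 2 [← hsq]; field_simp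
    have h2 : 1 ≤ 1 / √l := (one_le_div hsl).2 hsl1
    have h3 : 2 / √l = 2 * (1 / √l) := by ring
    rw [h1, h3]; linarith
  have blo := hcount lo (Finset.filter_subset _ _) k
    (fun n hn => (hmem n (Finset.filter_subset _ _ hn)).2.1)
    (fun n hn => (Finset.mem_filter.1 hn).2.le)
  have bhi := hcount hi (Finset.filter_subset _ _) (k + 1 - δ)
    (fun n hn => by have := (Finset.mem_filter.1 hn).2.2; linarith)
    (fun n hn => by have := (hmem n (Finset.filter_subset _ _ hn)).2.2; linarith)
  have bmid : ‖∑ n ∈ mid, e (F n)‖ ≤ 6 / √l := by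
    obtain ⟨a', b', hab⟩ := exists_eq_Ico_of_ordConnected mid (by
      intro x hx y hy z hxz hzy
      rw [hmid, Finset.mem_filter] at hx hy ⊢
      have hx1 := hmem x hx.1
      have hy1 := hmem y hy.1
      have hz1 : a ≤ z := hx1.1.1.trans hxz
      have hz2 : z < b := lt_of_le_of_lt hzy hy1.1.2
      have e1 := hmono x z hx1.1.1 hxz hz2
      have e2 := hmono z y hz1 hzy hy1.1.2
      refine ⟨?_, hx.2.1.trans e1, e2.trans hy.2.2⟩
      rw [hs, Finset.mem_filter, Finset.mem_Ico, Int.floor_eq_iff]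
      exact ⟨⟨hz1, hz2⟩, hx1.2.1.trans e1, e2.trans_lt hy1.2.2⟩)
    have hm : ∀ n, a' ≤ n → n < b' → (a ≤ n ∧ n < b) ∧ k + δ ≤ g n ∧ g n ≤ k + 1 - δ := by
      intro n h1 h2
      have : n ∈ mid := by rw [hab]; exact Finset.mem_Ico.2 ⟨h1, h2⟩
      rw [hmid, Finset.mem_filter] at this
      exact ⟨(hmem n this.1).1, this.2⟩
    rw [hab]
    have := norm_sum_e_le_of_diff_mem_int (F := F) (a := a') (b := b') hδ0 (by linarith) k
      (fun n h1 h2 => (hm n h1 (by omega)).2.1) (fun n h1 h2 => (hm n h1 (by omega)).2.2)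
      (fun n h1 h2 => by
        have q1 := (hm n h1 (by omega)).1.1
        have q2 := (hm (n + 1) (by omega) (by omega)).1.2
        exact hmono n (n + 1) q1 (by omega) q2)
    refine this.trans (le_of_eq ?_)
    rw [hδ]; field_simp; norm_num
  rw [hsplit]
  have e3 : 10 / √l = 2 / √l + 6 / √l + 2 / √l := by ring
  rw [e3]
  exact (norm_add₃_le).trans (by linarith)

/-- **Van der Corput's second derivative test**. -/
theorem norm_sum_e_le_of_second_diff {F : ℕ → ℝ} {a b : ℕ} {l K N : ℝ} (hl : 0 < l) (hK : 1 ≤ K)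
    (h1 : ∀ n, a ≤ n → n + 2 < b → l ≤ (F (n + 2) - F (n + 1)) - (F (n + 1) - F n))
    (h2 : ∀ n, a ≤ n → n + 2 < b → (F (n + 2) - F (n + 1)) - (F (n + 1) - F n) ≤ K * l)
    (hN : (b : ℝ) - a ≤ N) (hN0 : 0 ≤ N) :
    ‖∑ n ∈ Finset.Ico a b, e (F n)‖ ≤ 30 * K * (N * √l + 1 / √l) := by
  have hsl : 0 < √l := Real.sqrt_pos.2 hl
  have hsq : √l * √l = l := Real.mul_self_sqrt hl.le
  have hinv : 0 < 1 / √l := by positivity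
  have hcardN : ((b - a : ℕ) : ℝ) ≤ N := by
    rcases le_total a b with h | h
    · rw [Nat.cast_sub h]; exact hN
    · rw [Nat.sub_eq_zero_of_le h]; simpa using hN0
  rcases le_or_gt l 1 with hl1 | hl1
  swap
  -- For `l > 1` the number of terms is already below the claimed bound.
  · have hs1 : 1 ≤ √l := Real.one_le_sqrt.2 hl1.le
    refine (norm_sum_e_le_card _ _).trans ?_
    rw [Nat.card_Ico]
    nlinarith [mul_nonneg hN0 (by linarith : (0 : ℝ) ≤ √l - 1),
      mul_nonneg (by linarith : (0 : ℝ) ≤ K - 1) (by positivity : 0 ≤ N * √l + 1 / √l)]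
  have hs1 : √l ≤ 1 := Real.sqrt_le_one.2 hl1
  have hone : 1 ≤ 1 / √l := (one_le_div hsl).2 hs1
  rcases Nat.lt_or_ge (a + 1) b with hab | hab
  · obtain ⟨b, rfl⟩ : ∃ k, b = k + 1 := ⟨b - 1, by omega⟩
    rw [Finset.sum_Ico_succ_top (by omega)]
    set g : ℕ → ℝ := fun n => F (n + 1) - F n with hg
    have hgrow := mul_sub_le_of_step (g := g) (a := a) (b := b) (l := l)
      (fun n hn hn' => h1 n hn (by omega))
    have hgrow2 := mul_sub_le_of_step (g := fun n => - g n) (a := a) (b := b) (l := -(K * l))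
      (fun n hn hn' => by have := h2 n hn (by omega); simp only [hg]; linarith)
    have hmaps : ∀ n ∈ Finset.Ico a b, ⌊g n⌋ ∈ Finset.Icc ⌊g a⌋ ⌊g (b - 1)⌋ := by
      intro n hn
      rw [Finset.mem_Ico] at hn
      have e1 := hgrow a n le_rfl hn.1 hn.2
      have e2 := hgrow n (b - 1) hn.1 (by omega) (by omega)
      have c1 : (a : ℝ) ≤ n := by exact_mod_cast hn.1
      have c2 : (n : ℝ) ≤ ((b - 1 : ℕ) : ℝ) := by exact_mod_cast (by omega : n ≤ b - 1)
      exact Finset.mem_Icc.2 ⟨Int.floor_le_floor (by nlinarith), Int.floor_le_floor (by nlinarith)⟩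
    have hfib := Finset.sum_fiberwise_of_maps_to hmaps (fun n => e (F n))
    rw [← hfib]
    -- The differences increase by at most `N K l` in total, which bounds the number of integer
    -- parts they take.
    have hcard : ((Finset.Icc ⌊g a⌋ ⌊g (b - 1)⌋).card : ℝ) ≤ N * (K * l) + 2 := by
      rw [Int.card_Icc]
      have e0 : g a ≤ g (b - 1) := by
        have := hgrow a (b - 1) le_rfl (by omega) (by omega)
        have : (a : ℝ) ≤ ((b - 1 : ℕ) : ℝ) := by exact_mod_cast (by omega : a ≤ b - 1)
        nlinarith
      have e1 : (0 : ℤ) ≤ ⌊g (b - 1)⌋ + 1 - ⌊g a⌋ := by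
        have := Int.floor_le_floor e0; omega
      have e2 : ((⌊g (b - 1)⌋ + 1 - ⌊g a⌋).toNat : ℝ) = (⌊g (b - 1)⌋ : ℝ) + 1 - ⌊g a⌋ := by
        have := Int.toNat_of_nonneg e1
        have h3 : (((⌊g (b - 1)⌋ + 1 - ⌊g a⌋).toNat : ℤ) : ℝ) =
          ((⌊g (b - 1)⌋ + 1 - ⌊g a⌋ : ℤ) : ℝ) := by rw [this]
        push_cast at h3
        exact h3
      rw [e2]
      have e3 := Int.floor_le (g (b - 1))
      have e4 := Int.lt_floor_add_one (g a)
      have e5 := hgrow2 a (b - 1) le_rfl (by omega) (by omega)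
      have e6 : ((b - 1 : ℕ) : ℝ) - a ≤ N := by
        have : ((b - 1 : ℕ) : ℝ) ≤ ((b + 1 : ℕ) : ℝ) := by exact_mod_cast (by omega)
        linarith
      have : K * l * (((b - 1 : ℕ) : ℝ) - a) ≤ K * l * N := by gcongr
      linarith
    have hsum : ‖∑ j ∈ Finset.Icc ⌊g a⌋ ⌊g (b - 1)⌋,
        ∑ n ∈ Finset.Ico a b with ⌊g n⌋ = j, e (F n)‖ ≤ (N * (K * l) + 2) * (10 / √l) := by
      refine (norm_sum_le _ _).trans ?_
      refine (Finset.sum_le_card_nsmul _ _ (10 / √l) (fun k _ =>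
        norm_sum_e_floor_fiber_le hl hl1 (fun n hn hn' => h1 n hn (by omega)) k)).trans ?_
      rw [nsmul_eq_mul]
      gcongr
    refine (norm_add_le _ _).trans ?_
    rw [norm_e]
    have e7 : (N * (K * l) + 2) * (10 / √l) = 10 * K * (N * √l) + 20 * (1 / √l) := by
      nth_rewrite 1 [← hsq]; field_simp; ring
    rw [e7] at hsum
    have : 0 ≤ N * √l := by positivity
    nlinarith [mul_nonneg (by linarith : (0 : ℝ) ≤ K - 1) hinv.le,
      mul_nonneg (by linarith : (0 : ℝ) ≤ K - 1) this]
  · refine (norm_sum_e_le_card _ _).trans ?_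
    rw [Nat.card_Ico]
    have : ((b - a : ℕ) : ℝ) ≤ 1 := by exact_mod_cast (by omega : b - a ≤ 1)
    have : 0 ≤ N * √l := by positivity
    nlinarith [mul_nonneg (by linarith : (0 : ℝ) ≤ K - 1) hinv.le,
      mul_nonneg (by linarith : (0 : ℝ) ≤ K - 1) this]

end RevolutionBody

/-! ### Counting, and bounds for sums over pairs -/

namespace RevolutionBody

/-- The distance to the nearest integer. -/
noncomputable def distInt (x : ℝ) : ℝ := |x - round x|

theorem distInt_nonneg (x : ℝ) : 0 ≤ distInt x := abs_nonneg _

theorem distInt_le_half (x : ℝ) : distInt x ≤ 1 / 2 := abs_sub_round x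

theorem distInt_le (x : ℝ) (k : ℤ) : distInt x ≤ |x - k| := round_le x k

theorem distInt_neg (x : ℝ) : distInt (-x) = distInt x := by
  apply le_antisymm
  · have := distInt_le (-x) (-round x)
    rwa [Int.cast_neg, ← neg_sub', abs_neg] at this
  · have := distInt_le x (-round (-x))
    rw [Int.cast_neg, sub_neg_eq_add, ← abs_neg, neg_add, ← sub_eq_add_neg] at this
    exact this

/-! ### From differentiable phases to finite differences. -/

theorem exists_slope_eq {Φ Φ1 : ℝ → ℝ} {A B x : ℝ} (h : ∀ x ∈ Set.Icc A B, HasDerivAt Φ (Φ1 x) x)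
    (h1 : A ≤ x) (h2 : x + 1 ≤ B) : ∃ ξ ∈ Set.Ioo x (x + 1), Φ (x + 1) - Φ x = Φ1 ξ := by
  have hsub : Set.Icc x (x + 1) ⊆ Set.Icc A B := Set.Icc_subset_Icc h1 h2
  obtain ⟨ξ, hξ, hξ'⟩ := exists_hasDerivAt_eq_slope Φ Φ1 (by linarith : x < x + 1)
    (fun y hy => (h y (hsub hy)).continuousAt.continuousWithinAt)
    (fun y hy => h y (hsub (Set.Ioo_subset_Icc_self hy)))
  exact ⟨ξ, hξ, by rw [hξ']; simp⟩

theorem exists_second_diff_eq {Φ Φ1 Φ2 : ℝ → ℝ} {A B x : ℝ}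
    (h : ∀ x ∈ Set.Icc A B, HasDerivAt Φ (Φ1 x) x)
    (h' : ∀ x ∈ Set.Icc A B, HasDerivAt Φ1 (Φ2 x) x)
    (h1 : A ≤ x) (h2 : x + 2 ≤ B) :
    ∃ ξ ∈ Set.Icc A B, (Φ (x + 2) - Φ (x + 1)) - (Φ (x + 1) - Φ x) = Φ2 ξ := by
  have hg : ∀ y ∈ Set.Icc A (B - 1),
      HasDerivAt (fun y => Φ (y + 1) - Φ y) (Φ1 (y + 1) - Φ1 y) y := by
    intro y hy
    refine HasDerivAt.sub ?_ (h y ⟨hy.1, by linarith [hy.2]⟩)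
    exact HasDerivAt.comp_add_const y 1 (h (y + 1) ⟨by linarith [hy.1], by linarith [hy.2]⟩)
  obtain ⟨ξ, hξ, hξ'⟩ := exists_slope_eq hg h1 (by linarith)
  obtain ⟨ζ, hζ, hζ'⟩ := exists_slope_eq h' (x := ξ) (by linarith [hξ.1]) (by linarith [hξ.2])
  refine ⟨ζ, ⟨by linarith [hξ.1, hζ.1], by linarith [hξ.2, hζ.2]⟩, ?_⟩
  rw [← hζ', ← hξ']
  rw [show x + 1 + 1 = x + 2 by ring]

theorem natCeil_sub_le {A B N : ℝ} (hA : 0 ≤ A) (hAB : A ≤ B) (hN : B - A + 1 ≤ N) :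
    (⌈B⌉₊ : ℝ) - ⌈A⌉₊ ≤ N := by
  have := Nat.ceil_lt_add_one (hA.trans hAB)
  have := Nat.le_ceil A
  linarith

/-- Bounds for an exponential sum whose phase has derivative near `G` and second derivative of size
`l`. -/
theorem norm_sum_e_phase_le {Φ Φ1 Φ2 : ℝ → ℝ} {A B G η l K N : ℝ} (hA : 0 ≤ A) (hAB : A ≤ B)
    (hN : B - A + 1 ≤ N) (hl : 0 < l) (hK : 1 ≤ K)
    (h : ∀ x ∈ Set.Icc A B, HasDerivAt Φ (Φ1 x) x)
    (h' : ∀ x ∈ Set.Icc A B, HasDerivAt Φ1 (Φ2 x) x)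
    (hG : ∀ x ∈ Set.Icc A B, |Φ1 x - G| ≤ η)
    (hlo : ∀ x ∈ Set.Icc A B, l ≤ Φ2 x) (hhi : ∀ x ∈ Set.Icc A B, Φ2 x ≤ K * l) :
    ‖∑ n ∈ Finset.Ico ⌈A⌉₊ ⌈B⌉₊, e (Φ n)‖ ≤ 30 * K * min N (N * √l + 1 / √l) ∧
      (0 < distInt G → 2 * η ≤ distInt G →
        ‖∑ n ∈ Finset.Ico ⌈A⌉₊ ⌈B⌉₊, e (Φ n)‖ ≤ 6 / distInt G) := by
  have hmem : ∀ n : ℕ, ⌈A⌉₊ ≤ n → n < ⌈B⌉₊ → A ≤ n ∧ (n : ℝ) ≤ B := fun n h1 h2 =>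
    ⟨Nat.ceil_le.1 h1, (Nat.lt_ceil.1 h2).le⟩
  have hN' := natCeil_sub_le hA hAB hN
  have hN0 : 0 ≤ N := by linarith
  have hsec : ∀ n : ℕ, ⌈A⌉₊ ≤ n → n + 2 < ⌈B⌉₊ →
      ∃ ξ ∈ Set.Icc A B, (Φ ((n + 2 : ℕ) : ℝ) - Φ ((n + 1 : ℕ) : ℝ)) -
        (Φ ((n + 1 : ℕ) : ℝ) - Φ n) = Φ2 ξ := by
    intro n h1 h2
    push_cast
    refine exists_second_diff_eq h h' (hmem n h1 (by omega)).1 ?_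
    have := (hmem (n + 2) (by omega) h2).2
    push_cast at this; exact this
  constructor
  · rw [mul_min_of_nonneg _ _ (by linarith)]
    refine le_min ?_ ?_
    · refine (norm_sum_e_le_card _ _).trans ?_
      rw [Nat.card_Ico, Nat.cast_sub (Nat.ceil_le_ceil hAB)]
      nlinarith
    · refine norm_sum_e_le_of_second_diff (F := fun n : ℕ => Φ n) hl hK ?_ ?_ hN' hN0
      · intro n h1 h2
        obtain ⟨ξ, hξ, hξ'⟩ := hsec n h1 h2
        rw [hξ']; exact hlo ξ hξ
      · intro n h1 h2
        obtain ⟨ξ, hξ, hξ'⟩ := hsec n h1 h2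
        rw [hξ']; exact hhi ξ hξ
  · intro hy hη
    set y := distInt G
    have hy2 : y ≤ 1 / 2 := distInt_le_half G
    -- The differences stay within `y / 2` of `G`, hence at distance at least `y / 2` from all
    -- integers. This is the source of `6 / y = 3 / (y / 2)`.
    have hfirst : ∀ n : ℕ, ⌈A⌉₊ ≤ n → n + 1 < ⌈B⌉₊ →
        |(Φ ((n + 1 : ℕ) : ℝ) - Φ n) - G| ≤ y / 2 := by
      intro n h1 h2
      have e1 := (hmem n h1 (by omega)).1
      have e2 := (hmem (n + 1) (by omega) h2).2
      push_cast at e2 ⊢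
      obtain ⟨ξ, hξ, hξ'⟩ := exists_slope_eq h e1 e2
      rw [hξ']
      have := hG ξ ⟨by linarith [hξ.1], by linarith [hξ.2]⟩
      linarith
    have hf1 : y ≤ G - ⌊G⌋ := by
      have := distInt_le G ⌊G⌋
      rwa [abs_of_nonneg (by linarith [Int.floor_le G])] at this
    have hf2 : y ≤ ⌊G⌋ + 1 - G := by
      have := distInt_le G (⌊G⌋ + 1)
      rw [abs_sub_comm] at this
      push_cast at this
      rwa [abs_of_nonneg (by linarith [Int.lt_floor_add_one G])] at this
    have := norm_sum_e_le_of_diff_mem_int (F := fun n : ℕ => Φ n) (a := ⌈A⌉₊) (b := ⌈B⌉₊)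
      (θ := y / 2) (by positivity) (by linarith) ⌊G⌋
      (fun n h1 h2 => by have := (abs_le.1 (hfirst n h1 h2)).1; linarith)
      (fun n h1 h2 => by have := (abs_le.1 (hfirst n h1 h2)).2; linarith)
      (fun n h1 h2 => by
        obtain ⟨ξ, hξ, hξ'⟩ := hsec n h1 h2
        have := hlo ξ hξ
        linarith)
    refine this.trans (le_of_eq ?_)
    field_simp; norm_num

/-- Summing a bound of the type `min ρ (1 / y)` when the small values of `y` are rare. -/
theorem sum_le_of_count {ι : Type*} (P : Finset ι) (y t : ι → ℝ) {A B C ρ θ : ℝ} {I : ℕ}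
    (hA : 0 ≤ A) (hB : 0 ≤ B) (hC : 0 ≤ C) (hρ : 0 < ρ) (hθ : 0 < θ)
    (hρθ : 1 ≤ ρ * θ) (hI : 1 ≤ 2 ^ I * θ) (hy : ∀ p ∈ P, y p ≤ 1)
    (ht : ∀ p ∈ P, t p ≤ C * ρ) (ht' : ∀ p ∈ P, θ < y p → t p ≤ C / y p)
    (hcount : ∀ s : ℝ, 0 < s → s ≤ 1 → (({p ∈ P | y p ≤ s}).card : ℝ) ≤ A * s + B) :
    ∑ p ∈ P, t p ≤ 2 * C * ((I + 1) * A * (ρ * θ) + 2 * B * ρ) := by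
  have hcount' : ∀ s : ℝ, 0 < s → (({p ∈ P | y p ≤ s}).card : ℝ) ≤ A * s + B := by
    intro s hs
    rcases le_total s 1 with h | h
    · exact hcount s hs h
    · have h1 := hcount 1 one_pos le_rfl
      have h2 : (({p ∈ P | y p ≤ s}).card : ℝ) ≤ (({p ∈ P | y p ≤ 1}).card : ℝ) := by
        exact_mod_cast Finset.card_le_card fun p hp => by
          rw [Finset.mem_filter] at hp ⊢
          exact ⟨hp.1, hy p hp.1⟩
      nlinarith
  -- Let `i` be least with `y p ≤ 2^i θ`. If `i ≥ 1`, then `C / y p < 2 C / (2^i θ) ≤ 2 C ρ / 2^i`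
  -- because `ρ θ ≥ 1`; summing over all scales `i` dominates this single term.
  have hpt : ∀ p ∈ P, t p ≤ ∑ i ∈ Finset.range (I + 1),
      2 * C * ρ * (1 / 2) ^ i * (if y p ≤ 2 ^ i * θ then 1 else 0) := by
    intro p hp
    have hnn : ∀ i ∈ Finset.range (I + 1),
        0 ≤ 2 * C * ρ * (1 / 2) ^ i * (if y p ≤ 2 ^ i * θ then (1 : ℝ) else 0) := by
      intro i _; split_ifs <;> positivity
    rcases le_or_gt (y p) θ with h | h
    · refine le_trans ?_ (Finset.single_le_sum hnn (Finset.mem_range.2 (Nat.succ_pos I)))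
      have := ht p hp
      have h0 : 0 ≤ C * ρ := by positivity
      simp only [pow_zero, one_mul, h, if_true]
      linarith
    · have hex : ∃ i, y p ≤ 2 ^ i * θ := ⟨I, (hy p hp).trans hI⟩
      classical
      set i := Nat.find hex
      have hi : y p ≤ 2 ^ i * θ := Nat.find_spec hex
      have hiI : i ≤ I := Nat.find_min' hex ((hy p hp).trans hI)
      refine le_trans ?_ (Finset.single_le_sum hnn (Finset.mem_range.2 (Nat.lt_succ_of_le hiI)))
      simp only [hi, if_true, mul_one]
      have hi0 : i ≠ 0 := by
        intro h0; rw [h0] at hi; simp at hi; linarith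
      obtain ⟨j, hj⟩ := Nat.exists_eq_succ_of_ne_zero hi0
      have hlt : 2 ^ j * θ < y p := by
        have := Nat.find_min hex (m := j) (by omega)
        push Not at this; exact this
      refine (ht' p hp h).trans ?_
      rw [div_le_iff₀ (hθ.trans h), hj, pow_succ]
      have h2 : (1 / 2 : ℝ) ^ j * 2 ^ j = 1 := by rw [← mul_pow]; norm_num
      have h3 : 1 ≤ ρ * (1 / 2) ^ j * y p := by
        calc 1 ≤ ρ * θ := hρθ
          _ = ρ * (1 / 2) ^ j * (2 ^ j * θ) := by linear_combination (-(ρ * θ)) * h2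
          _ ≤ _ := by gcongr
      nlinarith
  calc ∑ p ∈ P, t p ≤ ∑ p ∈ P, ∑ i ∈ Finset.range (I + 1),
        2 * C * ρ * (1 / 2) ^ i * (if y p ≤ 2 ^ i * θ then 1 else 0) := Finset.sum_le_sum hpt
    _ = ∑ i ∈ Finset.range (I + 1), 2 * C * ρ * (1 / 2) ^ i *
        (({p ∈ P | y p ≤ 2 ^ i * θ}).card : ℝ) := by
        rw [Finset.sum_comm]
        refine Finset.sum_congr rfl fun i _ => ?_
        rw [← Finset.mul_sum, Finset.sum_boole]
    _ ≤ ∑ i ∈ Finset.range (I + 1), (2 * C * (A * (ρ * θ)) + 2 * C * ρ * B * (1 / 2) ^ i) := by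
        refine Finset.sum_le_sum fun i _ => ?_
        have h2 : (1 / 2 : ℝ) ^ i * 2 ^ i = 1 := by rw [← mul_pow]; norm_num
        calc _ ≤ 2 * C * ρ * (1 / 2) ^ i * (A * (2 ^ i * θ) + B) := by
              gcongr
              exact hcount' _ (by positivity)
          _ = _ := by linear_combination (2 * C * ρ * A * θ) * h2
    _ = (I + 1) * (2 * C * (A * (ρ * θ))) +
          2 * C * ρ * B * ∑ i ∈ Finset.range (I + 1), (1 / 2 : ℝ) ^ i := by
        rw [Finset.sum_add_distrib, Finset.sum_const, Finset.card_range, ← Finset.mul_sum]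
        push_cast [nsmul_eq_mul]; ring
    _ ≤ (I + 1) * (2 * C * (A * (ρ * θ))) + 2 * C * ρ * B * 2 := by
        gcongr
        exact sum_geometric_two_le (I + 1)
    _ = _ := by ring

/-! ### Differencing -/

/-- Two indices with the same quotient by `Q` differ by less than `Q`. By symmetry the pairs with `b
< a` repeat those with `a < b`. -/
theorem sum_filter_div_eq_le (s : Finset ℕ) (Q : ℕ) (hQ : 0 < Q) (f : ℕ → ℕ → ℝ)
    (hf : ∀ a b, 0 ≤ f a b) (hsymm : ∀ a b, f a b = f b a) :
    ∑ a ∈ s, ∑ b ∈ s with b / Q = a / Q, f a b ≤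
      ∑ a ∈ s, f a a + 2 * ∑ q ∈ Finset.Ico 1 Q, ∑ a ∈ s with a + q ∈ s, f a (a + q) := by
  have hlt : ∑ a ∈ s, ∑ b ∈ s with b / Q = a / Q ∧ a < b, f a b ≤
      ∑ q ∈ Finset.Ico 1 Q, ∑ a ∈ s with a + q ∈ s, f a (a + q) := by
    have hr : ∑ q ∈ Finset.Ico 1 Q, ∑ a ∈ s with a + q ∈ s, f a (a + q) =
        ∑ a ∈ s, ∑ q ∈ Finset.Ico 1 Q with a + q ∈ s, f a (a + q) := by
      simp_rw [Finset.sum_filter]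
      exact Finset.sum_comm
    rw [hr]
    refine Finset.sum_le_sum fun a _ => ?_
    have hinj : Set.InjOn (fun q => a + q)
        (({q ∈ Finset.Ico 1 Q | a + q ∈ s} : Finset ℕ) : Set ℕ) :=
      fun x _ y _ hxy => Nat.add_left_cancel hxy
    rw [← Finset.sum_image (f := fun b => f a b) hinj]
    refine Finset.sum_le_sum_of_subset_of_nonneg (fun b hb => ?_) (fun b _ _ => hf a b)
    rw [Finset.mem_filter] at hb
    obtain ⟨hbs, hbQ, hab⟩ := hb
    rw [Finset.mem_image]
    refine ⟨b - a, ?_, by omega⟩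
    rw [Finset.mem_filter, Finset.mem_Ico, Nat.add_sub_cancel' hab.le]
    refine ⟨⟨by omega, ?_⟩, hbs⟩
    have h1 := Nat.div_add_mod a Q
    have h2 := Nat.div_add_mod b Q
    have h3 := Nat.mod_lt b hQ
    rw [hbQ] at h2
    omega
  have hgt : ∑ a ∈ s, ∑ b ∈ s with b / Q = a / Q ∧ b < a, f a b =
      ∑ a ∈ s, ∑ b ∈ s with b / Q = a / Q ∧ a < b, f a b := by
    simp_rw [Finset.sum_filter]
    rw [Finset.sum_comm]
    refine Finset.sum_congr rfl fun a _ => Finset.sum_congr rfl fun b _ => ?_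
    rw [hsymm b a]
    congr 1
    rw [eq_comm (a := b / Q)]
  have heq : ∀ a ∈ s, ∑ b ∈ s with b / Q = a / Q, f a b =
      f a a + ∑ b ∈ s with b / Q = a / Q ∧ a < b, f a b +
        ∑ b ∈ s with b / Q = a / Q ∧ b < a, f a b := by
    intro a ha
    have h0 : f a a = ∑ b ∈ s, if b = a then f a b else 0 := by
      rw [Finset.sum_ite_eq' s a]; simp [ha]
    rw [h0]
    simp_rw [Finset.sum_filter]
    rw [← Finset.sum_add_distrib, ← Finset.sum_add_distrib]
    refine Finset.sum_congr rfl fun b _ => ?_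
    rcases lt_trichotomy a b with h | h | h
    · simp [h, h.ne', h.le.not_gt]
    · subst h; simp
    · simp [h, h.ne, h.le.not_gt]
  rw [Finset.sum_congr rfl heq, Finset.sum_add_distrib, Finset.sum_add_distrib, hgt]
  linarith

theorem norm_sum_sq_le_card_mul (s : Finset ℕ) (w : ℕ → ℂ) :
    ‖∑ k ∈ s, w k‖ ^ 2 ≤ s.card * ∑ k ∈ s, ‖w k‖ ^ 2 := by
  calc ‖∑ k ∈ s, w k‖ ^ 2 ≤ (∑ k ∈ s, ‖w k‖) ^ 2 := by gcongr; exact norm_sum_le _ _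
    _ ≤ _ := sq_sum_le_card_mul_sum_sq

theorem norm_sum_sq_eq_re (s : Finset ℕ) (w : ℕ → ℂ) :
    ((‖∑ k ∈ s, w k‖ ^ 2 : ℝ) : ℂ) = ∑ a ∈ s, ∑ b ∈ s, w a * (starRingEnd ℂ) (w b) := by
  rw [← Finset.sum_mul_sum, ← map_sum, Complex.mul_conj, Complex.normSq_eq_norm_sq]

/-- Differencing by splitting the inner sum in blocks of length `Q`. -/
theorem sum_norm_sum_sq_le (ns ms : Finset ℕ) (z : ℕ → ℕ → ℂ) {Q : ℕ} (hQ : 0 < Q) {K : ℝ}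
    (hK : ∀ n ∈ ns, ((({m ∈ ms | z n m ≠ 0}).image (· / Q)).card : ℝ) ≤ K) :
    ∑ n ∈ ns, ‖∑ m ∈ ms, z n m‖ ^ 2 ≤
      K * (∑ m ∈ ms, ‖∑ n ∈ ns, z n m * (starRingEnd ℂ) (z n m)‖ +
        2 * ∑ q ∈ Finset.Ico 1 Q, ∑ m ∈ ms with m + q ∈ ms,
          ‖∑ n ∈ ns, z n m * (starRingEnd ℂ) (z n (m + q))‖) := by
  rcases ns.eq_empty_or_nonempty with rfl | ⟨n0, hn0⟩
  · simp
  have hK0 : 0 ≤ K := (Nat.cast_nonneg _).trans (hK n0 hn0)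
  -- Cauchy's inequality over the blocks, of which at most `K` contain a non-zero term.
  have hpt : ∀ n ∈ ns, ‖∑ m ∈ ms, z n m‖ ^ 2 ≤
      K * ∑ k ∈ ms.image (· / Q), ‖∑ m ∈ ms with m / Q = k, z n m‖ ^ 2 := by
    intro n hn
    have h1 : ∑ m ∈ ms, z n m = ∑ m ∈ ms with z n m ≠ 0, z n m :=
      (Finset.sum_filter_ne_zero ms).symm
    have h2 := Finset.sum_fiberwise_of_maps_to (s := {m ∈ ms | z n m ≠ 0})
      (t := ({m ∈ ms | z n m ≠ 0}).image (· / Q)) (g := (· / Q))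
      (fun m hm => Finset.mem_image_of_mem _ hm) (fun m => z n m)
    have h3 : ∀ k, ∑ m ∈ {m ∈ ms | z n m ≠ 0} with m / Q = k, z n m =
        ∑ m ∈ ms with m / Q = k, z n m := by
      intro k
      rw [Finset.filter_comm, Finset.sum_filter_ne_zero]
    rw [h1, ← h2]
    refine (norm_sum_sq_le_card_mul _ _).trans ?_
    refine mul_le_mul (hK n hn) ?_ (Finset.sum_nonneg fun k _ => by positivity) hK0
    simp_rw [h3]
    refine Finset.sum_le_sum_of_subset_of_nonneg ?_ (fun k _ _ => by positivity)
    exact Finset.image_subset_image (Finset.filter_subset _ _)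
  set T : ℕ → ℕ → ℂ := fun a b => ∑ n ∈ ns, z n a * (starRingEnd ℂ) (z n b) with hT
  have hTsymm : ∀ a b, ‖T a b‖ = ‖T b a‖ := by
    intro a b
    rw [← RCLike.norm_conj (T a b)]
    congr 1
    simp only [hT, map_sum, map_mul, Complex.conj_conj]
    exact Finset.sum_congr rfl fun n _ => mul_comm _ _
  have hmain : ∑ n ∈ ns, ∑ k ∈ ms.image (· / Q), ‖∑ m ∈ ms with m / Q = k, z n m‖ ^ 2 ≤
      ∑ a ∈ ms, ∑ b ∈ ms with b / Q = a / Q, ‖T a b‖ := by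
    -- The squares are expanded as complex numbers, and `n` is summed before norms are taken, so
    -- that the cancellation in `n` is kept.
    have hC : ((∑ n ∈ ns, ∑ k ∈ ms.image (· / Q),
        ‖∑ m ∈ ms with m / Q = k, z n m‖ ^ 2 : ℝ) : ℂ) =
        ∑ a ∈ ms, ∑ b ∈ ms with b / Q = a / Q, T a b := by
      rw [Complex.ofReal_sum]
      simp_rw [Complex.ofReal_sum, norm_sum_sq_eq_re]
      rw [Finset.sum_comm]
      have : ∀ k ∈ ms.image (· / Q), ∑ n ∈ ns, ∑ a ∈ ms with a / Q = k,
          ∑ b ∈ ms with b / Q = k, z n a * (starRingEnd ℂ) (z n b) =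
          ∑ a ∈ ms with a / Q = k, ∑ b ∈ ms with b / Q = a / Q, T a b := by
        intro k _
        rw [Finset.sum_comm]
        refine Finset.sum_congr rfl fun a ha => ?_
        rw [Finset.sum_comm, (Finset.mem_filter.1 ha).2]
      rw [Finset.sum_congr rfl this]
      exact Finset.sum_fiberwise_of_maps_to (fun m hm => Finset.mem_image_of_mem _ hm)
        (fun a => ∑ b ∈ ms with b / Q = a / Q, T a b)
    have hnn : 0 ≤ ∑ n ∈ ns, ∑ k ∈ ms.image (· / Q), ‖∑ m ∈ ms with m / Q = k, z n m‖ ^ 2 :=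
      Finset.sum_nonneg fun n _ => Finset.sum_nonneg fun k _ => by positivity
    calc _ = ‖((∑ n ∈ ns, ∑ k ∈ ms.image (· / Q),
        ‖∑ m ∈ ms with m / Q = k, z n m‖ ^ 2 : ℝ) : ℂ)‖ := by
          rw [Complex.norm_real, Real.norm_of_nonneg hnn]
      _ ≤ _ := by
          rw [hC]
          refine (norm_sum_le _ _).trans (Finset.sum_le_sum fun a _ => norm_sum_le _ _)
  calc ∑ n ∈ ns, ‖∑ m ∈ ms, z n m‖ ^ 2
      ≤ ∑ n ∈ ns, K * ∑ k ∈ ms.image (· / Q), ‖∑ m ∈ ms with m / Q = k, z n m‖ ^ 2 :=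
        Finset.sum_le_sum hpt
    _ = K * ∑ n ∈ ns, ∑ k ∈ ms.image (· / Q), ‖∑ m ∈ ms with m / Q = k, z n m‖ ^ 2 := by
        rw [Finset.mul_sum]
    _ ≤ K * ∑ a ∈ ms, ∑ b ∈ ms with b / Q = a / Q, ‖T a b‖ := by gcongr
    _ ≤ _ := by
        gcongr
        exact sum_filter_div_eq_le ms Q hQ (fun a b => ‖T a b‖) (fun _ _ => norm_nonneg _) hTsymm

end RevolutionBody

/-! ### Spacing of the values `X q / (m (m + q))` modulo one -/

namespace RevolutionBody

/-- The integers `m` with `M ≤ m < 2 M`. -/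
noncomputable def dyadicRange (M : ℝ) : Finset ℕ := Finset.Ico ⌈M⌉₊ ⌈2 * M⌉₊

theorem mem_dyadicRange {M : ℝ} {m : ℕ} : m ∈ dyadicRange M ↔ M ≤ m ∧ (m : ℝ) < 2 * M := by
  simp only [dyadicRange, Finset.mem_Ico, Nat.ceil_le, Nat.lt_ceil]

theorem half_le_of_mem_dyadicRange {M : ℝ} (hM : 0 < M) {m : ℕ} (hm : m ∈ dyadicRange M) :
    1 / 2 < M := by
  rw [mem_dyadicRange] at hm
  have h : 0 < (m : ℝ) := hM.trans_le hm.1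
  have : (1 : ℝ) ≤ m := by exact_mod_cast (Nat.cast_pos.1 h)
  linarith

theorem card_dyadicRange_le {M : ℝ} (hM : 0 < M) : ((dyadicRange M).card : ℝ) ≤ 3 * M := by
  rcases (dyadicRange M).eq_empty_or_nonempty with h | ⟨m, hm⟩
  · rw [h]; simp; linarith
  · have h1 := half_le_of_mem_dyadicRange hM hm
    rw [dyadicRange, Nat.card_Ico, Nat.cast_sub (Nat.ceil_le_ceil (by linarith))]
    have := natCeil_sub_le (N := M + 1) hM.le (by linarith : M ≤ 2 * M) (by linarith)
    linarith

/-- The main part of the derivative of the phase differences. -/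
noncomputable def modelSlope (X : ℝ) (m q : ℕ) : ℝ := X * q / (m * (m + q))

section bounds

variable {M X : ℝ} {m q : ℕ}

theorem dyadic_pair_bounds (hm : m ∈ dyadicRange M) (hmq : m + q ∈ dyadicRange M) :
    M ≤ m ∧ (m : ℝ) < 2 * M ∧ M ≤ (m : ℝ) + q ∧ (m : ℝ) + q < 2 * M ∧ (q : ℝ) < M := by
  rw [mem_dyadicRange] at hm hmq
  push_cast at hmq
  exact ⟨hm.1, hm.2, hmq.1, hmq.2, by linarith⟩

theorem le_modelSlope (hM : 0 < M) (hX : 0 ≤ X) (hm : m ∈ dyadicRange M)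
    (hmq : m + q ∈ dyadicRange M) : X * q / (4 * M ^ 2) ≤ modelSlope X m q := by
  obtain ⟨h1, h2, h3, h4, -⟩ := dyadic_pair_bounds hm hmq
  unfold modelSlope
  have : (m : ℝ) * (m + q) ≤ 4 * M ^ 2 := by nlinarith
  have : 0 < (m : ℝ) * (m + q) := by nlinarith
  gcongr

theorem modelSlope_le (hM : 0 < M) (hX : 0 ≤ X) (hm : m ∈ dyadicRange M)
    (hmq : m + q ∈ dyadicRange M) : modelSlope X m q ≤ X * q / M ^ 2 := by
  obtain ⟨h1, h2, h3, h4, -⟩ := dyadic_pair_bounds hm hmq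
  unfold modelSlope
  have : M ^ 2 ≤ (m : ℝ) * (m + q) := by nlinarith
  gcongr

theorem modelSlope_nonneg (hX : 0 ≤ X) : 0 ≤ modelSlope X m q := by
  unfold modelSlope; positivity

theorem round_modelSlope_nonneg (hX : 0 ≤ X) : 0 ≤ round (modelSlope X m q) := by
  rw [round_eq]
  exact Int.floor_nonneg.2 (by have := modelSlope_nonneg (X := X) (m := m) (q := q) hX; linarith)

theorem round_le_two_mul {x : ℝ} (h : 1 ≤ round x) : (round x : ℝ) ≤ 2 * x := by
  have h1 := abs_le.1 (abs_sub_round x)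
  have h2 : (1 : ℝ) ≤ round x := by exact_mod_cast h
  linarith [h1.1]

/-- For fixed `q`, the function `1 / (m (m + q))` decreases in `m` at rate at least a constant times
`M⁻³`. -/
theorem modelSlope_sub_ge {m' : ℕ} (hM : 0 < M) (hX : 0 ≤ X) (hmm : m ≤ m')
    (hm : m ∈ dyadicRange M) (hmq : m + q ∈ dyadicRange M) (hm' : m' ∈ dyadicRange M)
    (hmq' : m' + q ∈ dyadicRange M) :
    X * q / (8 * M ^ 3) * ((m' : ℝ) - m) ≤ modelSlope X m q - modelSlope X m' q := by
  obtain ⟨h1, h2, h3, h4, -⟩ := dyadic_pair_bounds hm hmq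
  obtain ⟨h1', h2', h3', h4', -⟩ := dyadic_pair_bounds hm' hmq'
  have hmm' : (m : ℝ) ≤ m' := by exact_mod_cast hmm
  have p1 : 0 < (m : ℝ) := by linarith
  have p2 : 0 < (m' : ℝ) := by linarith
  have p3 : 0 < (m : ℝ) + q := by linarith
  have p4 : 0 < (m' : ℝ) + q := by linarith
  have heq : modelSlope X m q - modelSlope X m' q =
      X * q * ((m' : ℝ) - m) * ((m' + m + q) / ((m * (m + q)) * (m' * (m' + q)))) := by
    unfold modelSlope
    field_simp
    ring
  have hfrac : 1 / (8 * M ^ 3) ≤ ((m' : ℝ) + m + q) / ((m * (m + q)) * (m' * (m' + q))) := by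
    rw [div_le_div_iff₀ (by positivity) (by positivity)]
    have e1 : (m : ℝ) * (m + q) ≤ 4 * M ^ 2 := by nlinarith
    have e2 : (m' : ℝ) * (m' + q) ≤ 4 * M ^ 2 := by nlinarith
    have e3 : (m : ℝ) * (m + q) * (m' * (m' + q)) ≤ 4 * M ^ 2 * (4 * M ^ 2) := by gcongr
    have e4 : 2 * M * (8 * M ^ 3) ≤ ((m' : ℝ) + m + q) * (8 * M ^ 3) := by
      gcongr; linarith
    nlinarith
  rw [heq]
  have hnn : 0 ≤ X * q * ((m' : ℝ) - m) := by
    have : 0 ≤ (m' : ℝ) - m := by linarith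
    positivity
  calc X * q / (8 * M ^ 3) * ((m' : ℝ) - m) = X * q * ((m' : ℝ) - m) * (1 / (8 * M ^ 3)) := by ring
    _ ≤ _ := by gcongr

end bounds

/-- For a fixed difference `q`, the values are rarely close to an integer. -/
theorem card_distInt_modelSlope_le {M X s : ℝ} {q : ℕ} (hM : 0 < M) (hX : 0 < X) (hq : 1 ≤ q)
    (hs : 0 < s) :
    (({m ∈ {m ∈ dyadicRange M | m + q ∈ dyadicRange M} |
        distInt (modelSlope X m q) ≤ s}).card : ℝ) ≤
      (32 * M + 12 * M ^ 3 / (X * q)) * s + 2 * X * q / M ^ 2 := by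
  have hq0 : (0 : ℝ) < q := by exact_mod_cast hq
  have hXq : 0 < X * q := by positivity
  set P := {m ∈ {m ∈ dyadicRange M | m + q ∈ dyadicRange M} | distInt (modelSlope X m q) ≤ s}
    with hP
  have hmem : ∀ m ∈ P, m ∈ dyadicRange M ∧ m + q ∈ dyadicRange M ∧
      |modelSlope X m q - round (modelSlope X m q)| ≤ s := by
    intro m hm
    simp only [hP, Finset.mem_filter] at hm
    exact ⟨hm.1.1, hm.1.2, hm.2⟩
  rw [← Finset.card_filter_add_card_filter_not (s := P)
    (fun m => round (modelSlope X m q) = 0)]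
  push_cast
  -- If the nearest integer is `0`, then `s ≥ X q / (4 M²)`, and the trivial count `3 M` is absorbed
  -- in the term linear in `s`.
  have c0 : (({m ∈ P | round (modelSlope X m q) = 0}).card : ℝ) ≤ 12 * M ^ 3 / (X * q) * s := by
    rcases ({m ∈ P | round (modelSlope X m q) = 0}).eq_empty_or_nonempty with h | ⟨m, hm⟩
    · rw [h]; simp; positivity
    · rw [Finset.mem_filter] at hm
      obtain ⟨h1, h2, h3⟩ := hmem m hm.1
      rw [hm.2] at h3
      have h4 := le_modelSlope hM hX.le h1 h2
      have h5 : X * q / (4 * M ^ 2) ≤ s := by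
        have := le_abs_self (modelSlope X m q - ((0 : ℤ) : ℝ))
        push_cast at this h3
        linarith
      have h6 : 1 ≤ 4 * M ^ 2 / (X * q) * s := by
        rw [div_le_iff₀ (by positivity)] at h5
        rw [div_mul_eq_mul_div, le_div_iff₀ hXq]
        linarith
      calc (({m ∈ P | round (modelSlope X m q) = 0}).card : ℝ) ≤ (dyadicRange M).card := by
            exact_mod_cast Finset.card_le_card fun x hx => (hmem x (Finset.mem_filter.1 hx).1).1
        _ ≤ 3 * M := card_dyadicRange_le hM
        _ ≤ 3 * M * (4 * M ^ 2 / (X * q) * s) := by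
            have : 0 ≤ 3 * M := by positivity
            nlinarith
        _ = _ := by ring
  -- At most `K` positive integers occur as nearest integers, each for at most `L` values of `m` by
  -- the spacing. The factor 2 in `K` comes from `round x ≤ 2 x`, valid once `round x ≥ 1`.
  have c1 : (({m ∈ P | ¬ round (modelSlope X m q) = 0}).card : ℝ) ≤
      32 * M * s + 2 * X * q / M ^ 2 := by
    set P1 := {m ∈ P | ¬ round (modelSlope X m q) = 0} with hP1
    set K : ℝ := 2 * (X * q / M ^ 2) with hK
    have hK0 : 0 ≤ K := by positivity
    set L : ℝ := 2 * s / (X * q / (8 * M ^ 3)) + 1 with hL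
    have hL0 : 0 ≤ L := by positivity
    have hpos : ∀ m ∈ P1, 1 ≤ round (modelSlope X m q) := by
      intro m hm
      have := round_modelSlope_nonneg (X := X) (m := m) (q := q) hX.le
      have := (Finset.mem_filter.1 hm).2
      omega
    have himg : P1.image (fun m => round (modelSlope X m q)) ⊆ Finset.Icc 1 ⌊K⌋ := by
      intro k hk
      obtain ⟨m, hm, rfl⟩ := Finset.mem_image.1 hk
      obtain ⟨h1, h2, h3⟩ := hmem m (Finset.mem_filter.1 hm).1
      refine Finset.mem_Icc.2 ⟨hpos m hm, Int.le_floor.2 ?_⟩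
      have := round_le_two_mul (hpos m hm)
      have := modelSlope_le hM hX.le h1 h2
      linarith
    have hfib : ∀ k ∈ P1.image (fun m => round (modelSlope X m q)),
        ({m ∈ P1 | round (modelSlope X m q) = k}).card ≤ ⌊L⌋₊ := by
      intro k _
      refine Nat.le_floor ?_
      refine card_le_of_spaced _ (fun m => - modelSlope X m q) (x := -k - s)
        (l := X * q / (8 * M ^ 3)) (δ := 2 * s) (by positivity) (by positivity) ?_ ?_ ?_
      · intro m hm
        rw [Finset.mem_filter] at hm
        have := (abs_le.1 (hmem m (Finset.mem_filter.1 hm.1).1).2.2).2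
        rw [hm.2] at this
        linarith
      · intro m hm
        rw [Finset.mem_filter] at hm
        have := (abs_le.1 (hmem m (Finset.mem_filter.1 hm.1).1).2.2).1
        rw [hm.2] at this
        linarith
      · intro m hm n hn hmn
        rw [Finset.mem_filter] at hm hn
        obtain ⟨a1, a2, -⟩ := hmem m (Finset.mem_filter.1 hm.1).1
        obtain ⟨b1, b2, -⟩ := hmem n (Finset.mem_filter.1 hn.1).1
        have := modelSlope_sub_ge hM hX.le hmn a1 a2 b1 b2
        linarith
    have h1 := Finset.card_le_mul_card_image P1 ⌊L⌋₊ hfib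
    have h2 := Finset.card_le_card himg
    rw [Int.card_Icc] at h2
    have h3 : ((⌊K⌋ + 1 - 1).toNat : ℝ) ≤ K := by
      have e1 : 0 ≤ ⌊K⌋ := Int.floor_nonneg.2 hK0
      have e2 : (((⌊K⌋ + 1 - 1).toNat : ℤ) : ℝ) = (⌊K⌋ : ℝ) := by
        rw [Int.toNat_of_nonneg (by omega)]; simp
      have e3 := Int.floor_le K
      rw [Int.cast_natCast] at e2
      linarith
    calc (P1.card : ℝ)
        ≤ (⌊L⌋₊ : ℝ) * ((P1.image (fun m => round (modelSlope X m q))).card : ℝ) := by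
          exact_mod_cast h1
      _ ≤ L * K := by
          refine mul_le_mul (Nat.floor_le hL0) ?_ (by positivity) hL0
          exact le_trans (by exact_mod_cast h2) h3
      _ = _ := by rw [hL, hK]; field_simp; ring
  linarith

/-- Counting solutions of `b k m (m + q) - p q = w` by divisors of `b k w - p ^ 2`. -/
theorem card_fiber_le_divisors {b k p w : ℤ} {Δ : ℕ} (hbk : b * k ≠ 0)
    (hT : b * k * w - p ^ 2 ≠ 0) (hΔ : (b * k * w - p ^ 2).natAbs.divisors.card ≤ Δ)
    (s : Finset (ℕ × ℕ))
    (hs : ∀ x ∈ s, b * k * (x.1 * (x.1 + x.2)) - p * x.2 = w) : s.card ≤ 2 * Δ := by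
  -- The two factors multiply to `b k w - p²`, and they determine `m` and `m + q` because `b k ≠ 0`.
  have hinj : Set.InjOn (fun x : ℕ × ℕ => (b * k * x.1 - p, b * k * ((x.1 : ℤ) + x.2) + p))
      (s : Set (ℕ × ℕ)) := by
    rintro ⟨m, q⟩ _ ⟨m', q'⟩ _ h
    simp only [Prod.mk.injEq] at h
    have h1 : (m : ℤ) = m' := mul_left_cancel₀ hbk (by linarith [h.1])
    have h2 : (m : ℤ) + q = m' + q' := mul_left_cancel₀ hbk (by linarith [h.2])
    ext <;> simp <;> omega
  rw [← Finset.card_image_of_injOn hinj]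
  refine (card_int_mul_eq_le hT _ ?_).trans (Nat.mul_le_mul_left _ hΔ)
  intro y hy
  obtain ⟨x, hx, rfl⟩ := Finset.mem_image.1 hy
  have := hs x hx
  simp only
  rw [← this]
  ring

/-- Since `p` is close to `b X`, its square is at least `(b X)² / 4`. The constants 128 and 256 are
chosen to make `|b k w| ≤ (b X)² / 8`, so the square dominates. -/
theorem sub_sq_ne_zero_of_bounds {b k p w : ℤ} {M X D s B : ℝ} (hX : 128 ≤ X)
    (hDX : 256 * D ≤ X) (hs : 0 ≤ s) (hs1 : s ≤ 1) (hb : (1 : ℝ) ≤ b) (hB : 1 ≤ B)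
    (hbp : |b * X - p| ≤ 1 / B) (hM : 0 < M) (hDM : D ≤ M) (hD : 0 ≤ D) (hk : (1 : ℝ) ≤ k)
    (hkK : (k : ℝ) ≤ 4 * (X * D / M ^ 2))
    (hw : |(w : ℝ)| ≤ 4 * b * s * M ^ 2 + 2 * D / B) :
    b * k * w - p ^ 2 ≠ 0 ∧ |((b * k * w - p ^ 2 : ℤ) : ℝ)| ≤ 8 * b ^ 2 * X ^ 2 := by
  have hB1 : 1 / B ≤ 1 := (div_le_one (by linarith)).2 hB
  have hX0 : 0 < X := by linarith
  have hbX : 128 ≤ b * X := by nlinarith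
  have hp := abs_le.1 hbp
  have hp1 : b * X / 2 ≤ p := by linarith [hp.1, hp.2]
  have hp2 : (p : ℝ) ≤ 2 * (b * X) := by linarith [hp.1, hp.2]
  have hsq : 128 * (b * X) ≤ (b * X) ^ 2 := by nlinarith
  have hbkw : |((b * k * w : ℤ) : ℝ)| ≤ (b * X) ^ 2 / 8 := by
    push_cast
    rw [abs_mul, abs_of_pos (by positivity)]
    calc (b : ℝ) * k * |(w : ℝ)|
        ≤ b * (4 * (X * D / M ^ 2)) * (4 * b * s * M ^ 2 + 2 * D / B) := by gcongr
      _ = 16 * b ^ 2 * X * D * s + 8 * b * X * (D * D / M ^ 2) / B := by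
          field_simp; ring
      _ ≤ 16 * b ^ 2 * X * (X / 256) * 1 + 8 * b * X * 1 / 1 := by
          have e1 : D * D / M ^ 2 ≤ 1 := by
            rw [div_le_one (by positivity), sq]; gcongr
          gcongr
          linarith
      _ = (b * X) ^ 2 / 16 + 8 * (b * X) := by ring
      _ ≤ (b * X) ^ 2 / 8 := by linarith
  have hpsq : (b * X) ^ 2 / 4 ≤ (p : ℝ) ^ 2 := by nlinarith
  have hpsq' : (p : ℝ) ^ 2 ≤ 4 * (b * X) ^ 2 := by nlinarith
  have hpp : 0 < (b * X) ^ 2 := by positivity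
  have hab := abs_le.1 hbkw
  have heq : ((b * k * w - p ^ 2 : ℤ) : ℝ) = ((b * k * w : ℤ) : ℝ) - (p : ℝ) ^ 2 := by
    push_cast; ring
  have heq' : 8 * (b : ℝ) ^ 2 * X ^ 2 = 8 * (b * X) ^ 2 := by ring
  constructor
  · intro h0
    have : ((b * k * w - p ^ 2 : ℤ) : ℝ) = 0 := by rw [h0]; simp
    linarith [hab.2]
  · rw [heq, heq', abs_le]
    constructor <;> linarith [hab.1, hab.2]

/-- On a dyadic block of differences, the values are rarely close to an integer, in terms of a
rational approximation `p / b` to `X`. -/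
theorem card_distInt_modelSlope_block_le {M X s B : ℝ} {D : ℕ} {b p : ℤ} {Δ : ℕ} (hM : 0 < M)
    (hX : 128 ≤ X) (hD : 1 ≤ D) (hDX : 256 * (D : ℝ) ≤ X) (hDM : (D : ℝ) ≤ M) (hs : 0 < s)
    (hs1 : s ≤ 1) (hb : 1 ≤ b) (hB : 1 ≤ B) (hbp : |b * X - p| ≤ 1 / B)
    (hΔ : ∀ T : ℤ, T ≠ 0 → |(T : ℝ)| ≤ 8 * b ^ 2 * X ^ 2 → T.natAbs.divisors.card ≤ Δ) :
    (({x ∈ {x ∈ dyadicRange M ×ˢ Finset.Ico D (2 * D) | x.1 + x.2 ∈ dyadicRange M} |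
        distInt (modelSlope X x.1 x.2) ≤ s}).card : ℝ) ≤
      (12 * M ^ 3 / X + 64 * Δ * X * D * b) * s + 8 * Δ * (X * D / M ^ 2) * (4 * D / B + 1) := by
  have hX0 : 0 < X := by linarith
  have hD0 : (0 : ℝ) < D := by exact_mod_cast hD
  have hb0 : (1 : ℝ) ≤ b := by exact_mod_cast hb
  have hB1 : 1 / B ≤ 1 := (div_le_one (by linarith)).2 hB
  set P := {x ∈ {x ∈ dyadicRange M ×ˢ Finset.Ico D (2 * D) | x.1 + x.2 ∈ dyadicRange M} |
        distInt (modelSlope X x.1 x.2) ≤ s} with hP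
  have hmem : ∀ x ∈ P, x.1 ∈ dyadicRange M ∧ x.1 + x.2 ∈ dyadicRange M ∧ (D : ℝ) ≤ x.2 ∧
      (x.2 : ℝ) ≤ 2 * D ∧
      |modelSlope X x.1 x.2 - round (modelSlope X x.1 x.2)| ≤ s := by
    intro x hx
    simp only [hP, Finset.mem_filter, Finset.mem_product, Finset.mem_Ico] at hx
    exact ⟨hx.1.1.1, hx.1.2, by exact_mod_cast hx.1.1.2.1, by exact_mod_cast hx.1.1.2.2.le, hx.2⟩
  rw [← Finset.card_filter_add_card_filter_not (s := P)
    (fun x => round (modelSlope X x.1 x.2) = 0)]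
  push_cast
  have c0 : (({x ∈ P | round (modelSlope X x.1 x.2) = 0}).card : ℝ) ≤ 12 * M ^ 3 / X * s := by
    rcases ({x ∈ P | round (modelSlope X x.1 x.2) = 0}).eq_empty_or_nonempty with h | ⟨x, hx⟩
    · rw [h]; simp; positivity
    · rw [Finset.mem_filter] at hx
      obtain ⟨h1, h2, h3, h3', h4⟩ := hmem x hx.1
      rw [hx.2] at h4
      have h5 := le_modelSlope hM hX0.le h1 h2
      have h6 : X * D / (4 * M ^ 2) ≤ s := by
        have e1 := le_abs_self (modelSlope X x.1 x.2 - ((0 : ℤ) : ℝ))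
        push_cast at e1 h4
        have : X * D / (4 * M ^ 2) ≤ X * x.2 / (4 * M ^ 2) := by gcongr
        linarith
      have h7 : D ≤ 4 * M ^ 2 / X * s := by
        rw [div_le_iff₀ (by positivity)] at h6
        rw [div_mul_eq_mul_div, le_div_iff₀ hX0]
        linarith
      calc (({x ∈ P | round (modelSlope X x.1 x.2) = 0}).card : ℝ)
          ≤ ((dyadicRange M ×ˢ Finset.Ico D (2 * D)).card : ℝ) := by
            refine Nat.cast_le.2 (Finset.card_le_card fun x hx => ?_)
            have := (Finset.mem_filter.1 hx).1
            simp only [hP, Finset.mem_filter] at this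
            exact this.1.1
        _ = (dyadicRange M).card * (D : ℝ) := by
            rw [Finset.card_product, Nat.card_Ico]; push_cast
            congr 2; omega
        _ ≤ 3 * M * (4 * M ^ 2 / X * s) := by
            have := card_dyadicRange_le hM
            gcongr
        _ = _ := by ring
  have c1 : (({x ∈ P | ¬ round (modelSlope X x.1 x.2) = 0}).card : ℝ) ≤
      64 * Δ * X * D * b * s + 8 * Δ * (X * D / M ^ 2) * (4 * D / B + 1) := by
    set P1 := {x ∈ P | ¬ round (modelSlope X x.1 x.2) = 0} with hP1
    set K : ℝ := 4 * (X * D / M ^ 2) with hK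
    have hK0 : 0 ≤ K := by positivity
    -- `W` bounds `|w|`: its first part comes from the distance to the nearest integer, multiplied
    -- by `b m (m + q) ≤ 4 b M²`, its second part from `|b X - p| q`.
    set W : ℝ := 4 * b * s * M ^ 2 + 2 * D / B with hW
    have hW0 : 0 ≤ W := by positivity
    have hpos : ∀ x ∈ P1, 1 ≤ round (modelSlope X x.1 x.2) := by
      intro x hx
      have := round_modelSlope_nonneg (X := X) (m := x.1) (q := x.2) hX0.le
      have := (Finset.mem_filter.1 hx).2
      omega
    -- Pairs are sorted by the nearest integer `k` and by `w = b k m (m + q) - p q`; each fibre is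
    -- controlled by the divisors of `b k w - p²`.
    set f : ℕ × ℕ → ℤ × ℤ := fun x => (round (modelSlope X x.1 x.2),
      b * round (modelSlope X x.1 x.2) * (x.1 * (x.1 + x.2)) - p * x.2) with hf
    have hbd : ∀ x ∈ P1, (1 ≤ (f x).1 ∧ ((f x).1 : ℝ) ≤ K) ∧ |((f x).2 : ℝ)| ≤ W := by
      intro x hx
      obtain ⟨h1, h2, h3, h3', h4⟩ := hmem x (Finset.mem_filter.1 hx).1
      obtain ⟨g1, g2, g3, g4, -⟩ := dyadic_pair_bounds h1 h2
      refine ⟨⟨hpos x hx, ?_⟩, ?_⟩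
      · have e1 := round_le_two_mul (hpos x hx)
        have e2 := modelSlope_le hM hX0.le h1 h2
        have e3 : X * x.2 / M ^ 2 ≤ X * (2 * D) / M ^ 2 := by gcongr
        have e4 : X * (2 * D) / M ^ 2 = 2 * (X * D / M ^ 2) := by ring
        simp only [hf, hK]
        linarith
      · have hprod : 0 < (x.1 : ℝ) * (x.1 + x.2) := by nlinarith
        have hprod' : (x.1 : ℝ) * (x.1 + x.2) ≤ 4 * M ^ 2 := by nlinarith
        have hms : modelSlope X x.1 x.2 * ((x.1 : ℝ) * (x.1 + x.2)) = X * x.2 := by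
          rw [modelSlope, div_mul_cancel₀ _ hprod.ne']
        have heq : ((f x).2 : ℝ) =
            -(b * ((modelSlope X x.1 x.2 - round (modelSlope X x.1 x.2)) *
              ((x.1 : ℝ) * (x.1 + x.2)))) + (b * X - p) * x.2 := by
          simp only [hf]; push_cast
          linear_combination (b : ℝ) * hms
        rw [heq, hW]
        refine (abs_add_le _ _).trans (add_le_add ?_ ?_)
        · rw [abs_neg, abs_mul, abs_mul, abs_of_pos (by linarith : (0 : ℝ) < b),
            abs_of_pos hprod]
          calc (b : ℝ) * (|modelSlope X x.1 x.2 - round (modelSlope X x.1 x.2)| *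
                ((x.1 : ℝ) * (x.1 + x.2))) ≤ b * (s * (4 * M ^ 2)) := by gcongr
            _ = _ := by ring
        · rw [abs_mul, abs_of_nonneg (by positivity : (0 : ℝ) ≤ x.2)]
          calc |b * X - p| * (x.2 : ℝ) ≤ 1 / B * (2 * D) := by gcongr
            _ = _ := by ring
    have himg : P1.image f ⊆ Finset.Icc 1 ⌊K⌋ ×ˢ Finset.Icc (-⌊W⌋) ⌊W⌋ := by
      intro y hy
      obtain ⟨x, hx, rfl⟩ := Finset.mem_image.1 hy
      obtain ⟨⟨h1, h2⟩, h3⟩ := hbd x hx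
      have h4 := abs_le.1 h3
      simp only [Finset.mem_product, Finset.mem_Icc]
      refine ⟨⟨h1, Int.le_floor.2 h2⟩, ?_, Int.le_floor.2 h4.2⟩
      have : -(f x).2 ≤ ⌊W⌋ := Int.le_floor.2 (by push_cast; linarith [h4.1])
      omega
    have hfib : ∀ y ∈ P1.image f, ({x ∈ P1 | f x = y}).card ≤ 2 * Δ := by
      intro y hy
      obtain ⟨x, hx, rfl⟩ := Finset.mem_image.1 hy
      obtain ⟨⟨h1, h2⟩, h3⟩ := hbd x hx
      have hk1 : (1 : ℝ) ≤ ((f x).1 : ℝ) := by exact_mod_cast h1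
      obtain ⟨hT, hT'⟩ := sub_sq_ne_zero_of_bounds (w := (f x).2) hX hDX hs.le hs1 hb0 hB hbp hM hDM
        hD0.le hk1 h2 h3
      have hb1 : b * (f x).1 ≠ 0 := mul_ne_zero (by omega) (by omega)
      refine card_fiber_le_divisors hb1 hT (hΔ _ hT hT') _ fun z hz => ?_
      have hz := (Finset.mem_filter.1 hz).2
      rw [← hz]
    have h1 := Finset.card_le_mul_card_image P1 (2 * Δ) hfib
    have h2 := Finset.card_le_card himg
    rw [Finset.card_product, Int.card_Icc, Int.card_Icc] at h2
    have h3 : ((⌊K⌋ + 1 - 1).toNat : ℝ) ≤ K := by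
      have e1 : 0 ≤ ⌊K⌋ := Int.floor_nonneg.2 hK0
      have e2 : (((⌊K⌋ + 1 - 1).toNat : ℤ) : ℝ) = (⌊K⌋ : ℝ) := by
        rw [Int.toNat_of_nonneg (by omega)]; simp
      have e3 := Int.floor_le K
      rw [Int.cast_natCast] at e2
      linarith
    have h4 : ((⌊W⌋ + 1 - -⌊W⌋).toNat : ℝ) ≤ 2 * W + 1 := by
      have e1 : 0 ≤ ⌊W⌋ := Int.floor_nonneg.2 hW0
      have e2 : (((⌊W⌋ + 1 - -⌊W⌋).toNat : ℤ) : ℝ) = 2 * (⌊W⌋ : ℝ) + 1 := by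
        rw [Int.toNat_of_nonneg (by omega)]; push_cast; ring
      have e3 := Int.floor_le W
      rw [Int.cast_natCast] at e2
      linarith
    calc (P1.card : ℝ) ≤ (2 * Δ : ℝ) * ((P1.image f).card : ℝ) := by exact_mod_cast h1
      _ ≤ 2 * Δ * (K * (2 * W + 1)) := by
          gcongr
          calc ((P1.image f).card : ℝ) ≤
              ((⌊K⌋ + 1 - 1).toNat : ℝ) * ((⌊W⌋ + 1 - -⌊W⌋).toNat : ℝ) := by exact_mod_cast h2
            _ ≤ _ := by gcongr
      _ = _ := by rw [hK, hW]; field_simp; ring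
  linarith

end RevolutionBody

/-! ### The differenced phase -/

namespace RevolutionBody

/-- Bounds for a phase `h` with `∂h/∂n = r(√n / m) / (2 √n)` on a range `U₁ ≤ n / m² ≤ U₁ + U`:
`√U₁` is of size `W`, `r''` has constant sign `σ` and size `κ W`, and `r'` is close to `α`. -/
structure PhaseBlock (K α σ U₁ U W κ : ℝ) (h : ℝ → ℝ → ℝ) (r r' r'' : ℝ → ℝ) : Prop where
  one_le : 1 ≤ K
  U_pos : 0 < U
  W_pos : 0 < W
  κ_pos : 0 < κ
  U_le : U ≤ K
  W_le : W ≤ K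
  κ_le : κ ≤ K
  α_ge : 1 ≤ K * α
  α_le : α ≤ K
  sign : σ = 1 ∨ σ = -1
  U₁_pos : 0 < U₁
  lower : W ≤ K * √U₁
  upper : √(U₁ + U) ≤ K * W
  deriv_r : ∀ v ∈ Set.Icc √U₁ √(U₁ + U), HasDerivAt r (r' v) v
  deriv_r' : ∀ v ∈ Set.Icc √U₁ √(U₁ + U), HasDerivAt r' (r'' v) v
  r''_ge : ∀ v ∈ Set.Icc √U₁ √(U₁ + U), κ * W ≤ K * (σ * r'' v)
  r''_le : ∀ v ∈ Set.Icc √U₁ √(U₁ + U), σ * r'' v ≤ K * (κ * W)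
  r'_sub : ∀ v ∈ Set.Icc √U₁ √(U₁ + U), |r' v - α| ≤ K * (κ * U)
  deriv_h : ∀ m : ℕ, 0 < m → ∀ x : ℝ, 0 < x → √x / m ∈ Set.Icc √U₁ √(U₁ + U) →
    HasDerivAt (fun x => h x m) (r (√x / m) / (2 * √x)) x

theorem exists_sub_eq_mul {f f' : ℝ → ℝ} {a b : ℝ} (hab : a < b)
    (h : ∀ x ∈ Set.Icc a b, HasDerivAt f (f' x) x) :
    ∃ ξ ∈ Set.Icc a b, f b - f a = (b - a) * f' ξ := by
  obtain ⟨ξ, hξ, hξ'⟩ := exists_hasDerivAt_eq_slope f f' hab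
    (fun y hy => (h y hy).continuousAt.continuousWithinAt)
    (fun y hy => h y (Set.Ioo_subset_Icc_self hy))
  refine ⟨ξ, Set.Ioo_subset_Icc_self hξ, ?_⟩
  have : b - a ≠ 0 := by linarith
  rw [hξ']; field_simp

theorem hasDerivAt_div_two_sqrt {r : ℝ → ℝ} {r1 m x : ℝ} (hx : 0 < x) (hm : 0 < m)
    (hr : HasDerivAt r r1 (√x / m)) :
    HasDerivAt (fun x => r (√x / m) / (2 * √x))
      ((√x / m * r1 - r (√x / m)) / (4 * (x * √x))) x := by
  have hs : HasDerivAt (fun x => √x) (1 / (2 * √x)) x := Real.hasDerivAt_sqrt hx.ne'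
  have hsx : 0 < √x := Real.sqrt_pos.2 hx
  have h1 : HasDerivAt (fun x => r (√x / m)) (r1 * (1 / (2 * √x) / m)) x :=
    HasDerivAt.comp x hr (hs.div_const m)
  have h2 := h1.div (hs.const_mul 2) (by positivity)
  refine h2.congr_deriv ?_
  have hsq : √x * √x = x := Real.mul_self_sqrt hx.le
  rw [show x * √x = √x * √x * √x by rw [hsq]]
  generalize r (√x / m) = ρ
  field_simp
  ring

namespace PhaseBlock

variable {K α σ U₁ U W κ : ℝ} {h : ℝ → ℝ → ℝ} {r r' r'' : ℝ → ℝ}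

theorem α_pos (H : PhaseBlock K α σ U₁ U W κ h r r' r'') : 0 < α := by
  have := H.α_ge
  have := H.one_le
  by_contra hc
  push Not at hc
  nlinarith

theorem abs_σ (H : PhaseBlock K α σ U₁ U W κ h r r' r'') : |σ| = 1 := by
  rcases H.sign with h | h <;> simp [h]

theorem sqrt_div_mem (_ : PhaseBlock K α σ U₁ U W κ h r r' r'') {m m' : ℕ} (hm : 0 < m)
    (hmm : m ≤ m') {x : ℝ} (hx : x ∈ Set.Icc (U₁ * (m' : ℝ) ^ 2) ((U₁ + U) * (m : ℝ) ^ 2)) :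
    √x / m ∈ Set.Icc √U₁ √(U₁ + U) ∧ √x / m' ∈ Set.Icc √U₁ √(U₁ + U) := by
  have hm0 : (0 : ℝ) < m := by exact_mod_cast hm
  have hm0' : (m : ℝ) ≤ m' := by exact_mod_cast hmm
  have e1 : √U₁ * m' ≤ √x := by
    have := Real.sqrt_le_sqrt hx.1
    rwa [Real.sqrt_mul' _ (by positivity), Real.sqrt_sq (by positivity)] at this
  have e2 : √x ≤ √(U₁ + U) * m := by
    have := Real.sqrt_le_sqrt hx.2
    rwa [Real.sqrt_mul' _ (by positivity), Real.sqrt_sq (by positivity)] at this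
  have n1 := Real.sqrt_nonneg U₁
  have n2 := Real.sqrt_nonneg (U₁ + U)
  have p' : (0 : ℝ) < m' := by linarith
  refine ⟨⟨?_, ?_⟩, ?_, ?_⟩
  · rw [le_div_iff₀ hm0]; nlinarith
  · rwa [div_le_iff₀ hm0]
  · rwa [le_div_iff₀ p']
  · rw [div_le_iff₀ p']; nlinarith

end PhaseBlock

/-- The derivative of the differenced phase. -/
noncomputable def phaseDiff₁ (r : ℝ → ℝ) (σ R : ℝ) (m q : ℕ) (x : ℝ) : ℝ :=
  σ * R * (r (√x / m) / (2 * √x) - r (√x / (m + q : ℕ)) / (2 * √x))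

/-- The second derivative of the differenced phase. -/
noncomputable def phaseDiff₂ (r r' : ℝ → ℝ) (σ R : ℝ) (m q : ℕ) (x : ℝ) : ℝ :=
  σ * R * ((√x / m * r' (√x / m) - r (√x / m)) / (4 * (x * √x)) -
    (√x / (m + q : ℕ) * r' (√x / (m + q : ℕ)) - r (√x / (m + q : ℕ))) / (4 * (x * √x)))

namespace PhaseBlock

variable {K α σ U₁ U W κ : ℝ} {h : ℝ → ℝ → ℝ} {r r' r'' : ℝ → ℝ} {m q : ℕ} {R x : ℝ}

theorem hasDerivAt_phaseDiff (H : PhaseBlock K α σ U₁ U W κ h r r' r'') (hm : 0 < m)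
    (hx : x ∈ Set.Icc (U₁ * ((m + q : ℕ) : ℝ) ^ 2) ((U₁ + U) * (m : ℝ) ^ 2)) :
    HasDerivAt (fun x => σ * R * (h x m - h x (m + q : ℕ))) (phaseDiff₁ r σ R m q x) x ∧
    HasDerivAt (phaseDiff₁ r σ R m q) (phaseDiff₂ r r' σ R m q x) x := by
  have hm0 : (0 : ℝ) < m := by exact_mod_cast hm
  have hmq0 : (0 : ℝ) < ((m + q : ℕ) : ℝ) := by positivity
  have hx0 : 0 < x := by
    have := H.U₁_pos
    exact lt_of_lt_of_le (by positivity) hx.1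
  obtain ⟨h1, h2⟩ := H.sqrt_div_mem hm (Nat.le_add_right m q) hx
  exact ⟨((H.deriv_h m hm x hx0 h1).sub (H.deriv_h (m + q) (by omega) x hx0 h2)).const_mul _,
    ((hasDerivAt_div_two_sqrt hx0 hm0 (H.deriv_r _ h1)).sub
      (hasDerivAt_div_two_sqrt hx0 hmq0 (H.deriv_r _ h2))).const_mul _⟩

/-- The mean value theorem in `v` between `√x / (m + q)` and `√x / m`, applied to `r` and to `v r' -
r`. The derivative of the latter is `v r''`, so the second derivative inherits the sign of `r''`,
which the factor `σ` makes positive. -/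
theorem exists_phaseDiff_eq (H : PhaseBlock K α σ U₁ U W κ h r r' r'') (hm : 0 < m) (hq : 0 < q)
    (hx : x ∈ Set.Icc (U₁ * ((m + q : ℕ) : ℝ) ^ 2) ((U₁ + U) * (m : ℝ) ^ 2)) :
    (∃ ξ ∈ Set.Icc √U₁ √(U₁ + U),
      phaseDiff₁ r σ R m q x = σ * (R * q / (2 * (m * (m + q)))) * r' ξ) ∧
    (∃ ξ ∈ Set.Icc √U₁ √(U₁ + U),
      phaseDiff₂ r r' σ R m q x = R * q / (4 * x * (m * (m + q))) * (ξ * (σ * r'' ξ))) := by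
  have hm0 : (0 : ℝ) < m := by exact_mod_cast hm
  have hq0 : (0 : ℝ) < q := by exact_mod_cast hq
  have hx0 : 0 < x := by
    have := H.U₁_pos
    exact lt_of_lt_of_le (by positivity) hx.1
  have hsx : 0 < √x := Real.sqrt_pos.2 hx0
  have hsq : √x * √x = x := Real.mul_self_sqrt hx0.le
  obtain ⟨h1, h2⟩ := H.sqrt_div_mem hm (Nat.le_add_right m q) hx
  have hlt : √x / (m + q : ℕ) < √x / m := by
    push_cast
    exact div_lt_div_of_pos_left hsx hm0 (by linarith)
  have hsub : Set.Icc (√x / (m + q : ℕ)) (√x / m) ⊆ Set.Icc √U₁ √(U₁ + U) :=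
    Set.Icc_subset_Icc h2.1 h1.2
  have hdiff : √x / m - √x / (m + q : ℕ) = √x * q / (m * (m + q)) := by
    push_cast; field_simp; ring
  constructor
  · obtain ⟨ξ, hξ, hξ'⟩ := exists_sub_eq_mul hlt (fun v hv => H.deriv_r v (hsub hv))
    refine ⟨ξ, hsub hξ, ?_⟩
    unfold phaseDiff₁
    rw [← sub_div, hξ', hdiff]
    field_simp
  · obtain ⟨ξ, hξ, hξ'⟩ := exists_sub_eq_mul (f := fun v => v * r' v - r v)
      (f' := fun v => v * r'' v) hlt (fun v hv => by
        have e1 := ((hasDerivAt_id v).mul (H.deriv_r' v (hsub hv))).sub (H.deriv_r v (hsub hv))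
        refine e1.congr_deriv ?_
        simp)
    refine ⟨ξ, hsub hξ, ?_⟩
    unfold phaseDiff₂
    rw [← sub_div, hξ', hdiff]
    field_simp

/-- Bounds for the sums produced by differencing, on a dyadic range of differences. -/
theorem norm_sum_diff_le (H : PhaseBlock K α σ U₁ U W κ h r r' r'') {M D : ℝ} (hR : 0 < R)
    (hM : 0 < M) (hD : 0 < D) (hq : 0 < q) (hqD : D ≤ q) (hqD' : (q : ℝ) ≤ 2 * D)
    (hm : m ∈ dyadicRange M) (hmq : m + q ∈ dyadicRange M) (hUM : 1 ≤ U * M ^ 2) {l N : ℝ}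
    (hl : l = R * D * κ / (64 * K ^ 4 * M ^ 4)) (hN : N = 5 * U * M ^ 2) :
    ‖∑ n ∈ Finset.Ico ⌈U₁ * ((m + q : ℕ) : ℝ) ^ 2⌉₊ ⌈(U₁ + U) * (m : ℝ) ^ 2⌉₊,
        e (R * h n m - R * h n (m + q : ℕ))‖ ≤ 960 * K ^ 8 * min N (N * √l + 1 / √l) ∧
      (26 * K ^ 5 * (l * N) < distInt (modelSlope (R * α / 2) m q) →
        ‖∑ n ∈ Finset.Ico ⌈U₁ * ((m + q : ℕ) : ℝ) ^ 2⌉₊ ⌈(U₁ + U) * (m : ℝ) ^ 2⌉₊,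
        e (R * h n m - R * h n (m + q : ℕ))‖ ≤ 6 / distInt (modelSlope (R * α / 2) m q)) := by
  have hK := H.one_le
  have hK0 : 0 < K := by linarith
  have hU := H.U_pos
  have hU1 := H.U₁_pos
  have hW := H.W_pos
  have hκ := H.κ_pos
  have hα := H.α_pos
  obtain ⟨g1, g2, g3, g4, g5⟩ := dyadic_pair_bounds hm hmq
  have hm0 : (0 : ℝ) < m := by linarith
  have hm0' : 0 < m := by exact_mod_cast hm0
  have hq0 : (0 : ℝ) < q := by exact_mod_cast hq
  have hprod1 : M ^ 2 ≤ (m : ℝ) * (m + q) := by nlinarith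
  have hprod2 : (m : ℝ) * (m + q) ≤ 4 * M ^ 2 := by nlinarith
  have hl0 : 0 < l := by rw [hl]; positivity
  have hN0 : 0 < N := by rw [hN]; positivity
  -- The ranges of `n` for `m` and `m + q` may be disjoint; the sum is then empty.
  rcases le_or_gt ((U₁ + U) * (m : ℝ) ^ 2) (U₁ * ((m + q : ℕ) : ℝ) ^ 2) with hAB | hAB
  · rw [Finset.Ico_eq_empty (by have := Nat.ceil_le_ceil hAB; omega)]
    simp only [Finset.sum_empty, norm_zero]
    refine ⟨by positivity, fun _ => ?_⟩
    have := distInt_nonneg (modelSlope (R * α / 2) m q)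
    positivity
  set A := U₁ * ((m + q : ℕ) : ℝ) ^ 2 with hA
  set B := (U₁ + U) * (m : ℝ) ^ 2 with hB
  have hA0 : 0 ≤ A := by positivity
  have hBA : B - A + 1 ≤ N := by
    have e1 : U₁ * (m : ℝ) ^ 2 ≤ A := by rw [hA]; push_cast; gcongr; linarith
    have e2 : U * (m : ℝ) ^ 2 ≤ U * (2 * M) ^ 2 := by gcongr
    rw [hN, hB]; nlinarith
  set G := σ * modelSlope (R * α / 2) m q with hG
  have hdist : distInt G = distInt (modelSlope (R * α / 2) m q) := by
    rw [hG]
    rcases H.sign with h1 | h1 <;> rw [h1]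
    · rw [one_mul]
    · rw [neg_one_mul, distInt_neg]
  set η := K * R * D * κ * U / M ^ 2 with hη
  -- The constant 26 is chosen here: `26 K⁵ l N` equals `(130 / 64) η`, just above `2 η`.
  have hηl : 2 * η ≤ 26 * K ^ 5 * (l * N) := by
    have : 26 * K ^ 5 * (l * N) = 130 / 64 * η := by
      rw [hη, hl, hN]; field_simp; ring
    have : 0 < η := by positivity
    linarith
  have hder : ∀ x ∈ Set.Icc A B, |phaseDiff₁ r σ R m q x - G| ≤ η := by
    intro x hx
    obtain ⟨⟨ξ, hξ, hξ'⟩, -⟩ := H.exists_phaseDiff_eq (R := R) hm0' hq hx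
    have e1 : phaseDiff₁ r σ R m q x - G =
        σ * (R * q / (2 * (m * (m + q)))) * (r' ξ - α) := by
      rw [hξ', hG, modelSlope]; field_simp
    rw [e1, abs_mul, abs_mul, H.abs_σ, one_mul, abs_of_pos (by positivity), hη]
    calc R * q / (2 * (m * (m + q))) * |r' ξ - α|
        ≤ R * (2 * D) / (2 * M ^ 2) * (K * (κ * U)) := by
          gcongr
          exact H.r'_sub ξ hξ
      _ = _ := by field_simp
  -- The size `W` cancels: `x` is of order `W² M²`, while `ξ` and `r'' ξ` contribute `W` and `κ W`.
  have hsec : ∀ x ∈ Set.Icc A B, l ≤ phaseDiff₂ r r' σ R m q x ∧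
      phaseDiff₂ r r' σ R m q x ≤ 32 * K ^ 8 * l := by
    intro x hx
    obtain ⟨-, ⟨ξ, hξ, hξ'⟩⟩ := H.exists_phaseDiff_eq (R := R) hm0' hq hx
    have x1 : (W / K) ^ 2 * M ^ 2 ≤ x := by
      refine le_trans ?_ hx.1
      have : W / K ≤ √U₁ := by rw [div_le_iff₀ hK0]; linarith [H.lower]
      have e1 : (W / K) ^ 2 ≤ U₁ := by
        calc (W / K) ^ 2 ≤ √U₁ ^ 2 := by gcongr
          _ = U₁ := Real.sq_sqrt hU1.le
      rw [hA]
      push_cast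
      gcongr
    have x2 : x ≤ (K * W) ^ 2 * (2 * M) ^ 2 := by
      refine hx.2.trans ?_
      have e1 : U₁ + U ≤ (K * W) ^ 2 := by
        calc U₁ + U = √(U₁ + U) ^ 2 := (Real.sq_sqrt (by linarith)).symm
          _ ≤ _ := by gcongr; exact H.upper
      rw [hB]
      gcongr
    have y1 : W / K ≤ ξ := by
      refine le_trans ?_ hξ.1
      rw [div_le_iff₀ hK0]; linarith [H.lower]
    have y2 : ξ ≤ K * W := hξ.2.trans H.upper
    have z1 : κ * W / K ≤ σ * r'' ξ := by rw [div_le_iff₀ hK0]; linarith [H.r''_ge ξ hξ]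
    have z2 := H.r''_le ξ hξ
    have x0 : 0 < x := lt_of_lt_of_le (by positivity) x1
    have y0 : 0 < ξ := lt_of_lt_of_le (by positivity) y1
    have z0 : 0 < σ * r'' ξ := lt_of_lt_of_le (by positivity) z1
    rw [hξ']
    constructor
    · calc l = R * D / (4 * ((K * W) ^ 2 * (2 * M) ^ 2) * (4 * M ^ 2)) *
            (W / K * (κ * W / K)) := by rw [hl]; field_simp; ring
        _ ≤ _ := by gcongr
    · calc R * q / (4 * x * (m * (m + q))) * (ξ * (σ * r'' ξ))
          ≤ R * (2 * D) / (4 * ((W / K) ^ 2 * M ^ 2) * M ^ 2) * (K * W * (K * (κ * W))) := by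
            gcongr
        _ = _ := by rw [hl]; field_simp; ring
  have key := norm_sum_e_phase_le (Φ := fun x => σ * R * (h x m - h x (m + q : ℕ)))
    (Φ1 := phaseDiff₁ r σ R m q) (Φ2 := phaseDiff₂ r r' σ R m q) (K := 32 * K ^ 8) (G := G) (η := η)
    hA0 hAB.le hBA hl0 (by have := one_le_pow₀ (n := 8) hK; linarith)
    (fun x hx => (H.hasDerivAt_phaseDiff hm0' hx).1)
    (fun x hx => (H.hasDerivAt_phaseDiff hm0' hx).2) hder (fun x hx => (hsec x hx).1)
    (fun x hx => (hsec x hx).2)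
  have hnorm : ‖∑ n ∈ Finset.Ico ⌈A⌉₊ ⌈B⌉₊, e (R * h n m - R * h n (m + q : ℕ))‖ =
      ‖∑ n ∈ Finset.Ico ⌈A⌉₊ ⌈B⌉₊, e (σ * R * (h n m - h n (m + q : ℕ)))‖ := by
    rcases H.sign with h1 | h1 <;> rw [h1]
    · congr 1; refine Finset.sum_congr rfl fun n _ => ?_; congr 1; ring
    · rw [← norm_sum_e_neg]
      congr 1; refine Finset.sum_congr rfl fun n _ => ?_; congr 1; ring
  rw [hnorm, ← hdist]
  refine ⟨key.1.trans (le_of_eq (by ring)), fun hlt => key.2 ?_ (hηl.trans hlt.le)⟩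
  exact lt_of_le_of_lt (by positivity) hlt

end PhaseBlock

end RevolutionBody

/-! ### Sums over differences -/

namespace RevolutionBody

/-- The absolute value of the exponential sum with the differenced phase. -/
noncomputable def diffNorm (h : ℝ → ℝ → ℝ) (R U₁ U : ℝ) (m q : ℕ) : ℝ :=
  ‖∑ n ∈ Finset.Ico ⌈U₁ * ((m + q : ℕ) : ℝ) ^ 2⌉₊ ⌈(U₁ + U) * (m : ℝ) ^ 2⌉₊,
        e (R * h n m - R * h n (m + q : ℕ))‖

theorem diffNorm_nonneg (h : ℝ → ℝ → ℝ) (R U₁ U : ℝ) (m q : ℕ) : 0 ≤ diffNorm h R U₁ U m q :=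
  norm_nonneg _

/-- The second factor is the threshold `θ` beyond which the Kusmin–Landau bound is used. This
inequality says that `1 / θ` does not exceed the second derivative bound; the cases depend on
whether `N √l ≥ 1`. -/
theorem one_le_min_mul_max {l N c : ℝ} (hl : 0 < l) (hN : 1 ≤ N) (hc : 1 ≤ c) :
    1 ≤ min N (N * √l + 1 / √l) * min 1 (max (1 / N) (c * (l * N))) := by
  have hs : 0 < √l := Real.sqrt_pos.2 hl
  have hsq : √l * √l = l := Real.mul_self_sqrt hl.le
  have hN0 : 0 < N := by linarith
  have a1 : 1 ≤ N * √l + 1 / √l := by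
    rcases le_total 1 (N * √l) with h | h
    · have : 0 ≤ 1 / √l := by positivity
      linarith
    · have h1 : √l ≤ 1 := by nlinarith
      have : 1 ≤ 1 / √l := (one_le_div hs).2 h1
      have : 0 ≤ N * √l := by positivity
      linarith
  have a2 : 1 ≤ (N * √l + 1 / √l) * max (1 / N) (c * (l * N)) := by
    rcases le_total 1 (N * √l) with h | h
    · calc (1 : ℝ) ≤ N * √l := h
        _ = 1 / √l * (1 * (√l * √l * N)) := by field_simp
        _ = 1 / √l * (1 * (l * N)) := by rw [hsq]
        _ ≤ _ := by
          refine mul_le_mul ?_ ?_ (by positivity) (by positivity)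
          · have : 0 ≤ N * √l := by positivity
            linarith
          · refine le_trans ?_ (le_max_right _ _)
            gcongr
    · calc (1 : ℝ) ≤ 1 / (N * √l) := (one_le_div (by positivity)).2 h
        _ = 1 / √l * (1 / N) := by field_simp
        _ ≤ _ := by
          refine mul_le_mul ?_ (le_max_left _ _) (by positivity) (by positivity)
          have : 0 ≤ N * √l := by positivity
          linarith
  rcases min_choice N (N * √l + 1 / √l) with h1 | h1 <;>
  rcases min_choice 1 (max (1 / N) (c * (l * N))) with h2 | h2 <;> rw [h1, h2]
  · linarith
  · calc (1 : ℝ) = N * (1 / N) := by field_simp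
      _ ≤ _ := by gcongr; exact le_max_left _ _
  · linarith
  · exact a2

/-- Conversely the threshold is not wasteful: `1 / N` is paired with the trivial bound `N`, and `c l
N` with `N √l + 1 / √l`. -/
theorem min_mul_max_le {l N c : ℝ} (hl : 0 < l) (hN : 1 ≤ N) (hc : 1 ≤ c) :
    min N (N * √l + 1 / √l) * min 1 (max (1 / N) (c * (l * N))) ≤ 2 * c * (1 + N * √l) := by
  have hs : 0 < √l := Real.sqrt_pos.2 hl
  have hsq : √l * √l = l := Real.mul_self_sqrt hl.le
  have hN0 : 0 < N := by linarith
  have hNs : 0 ≤ N * √l := by positivity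
  set ρ := min N (N * √l + 1 / √l) with hρ
  have hρ0 : 0 ≤ ρ := by positivity
  rcases le_total (1 / N) (c * (l * N)) with h | h
  · rw [max_eq_right h]
    calc ρ * min 1 (c * (l * N)) ≤ (N * √l + 1 / √l) * min 1 (c * (l * N)) := by
          gcongr; exact min_le_right _ _
      _ = N * √l * min 1 (c * (l * N)) + 1 / √l * min 1 (c * (l * N)) := by ring
      _ ≤ N * √l * 1 + 1 / √l * (c * (l * N)) := by
          gcongr
          · exact min_le_left _ _
          · exact min_le_right _ _
      _ = N * √l + c * (N * √l) := by
          congr 1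
          · ring
          · rw [show l * N = √l * √l * N by rw [hsq]]; field_simp
      _ ≤ _ := by nlinarith
  · rw [max_eq_left h]
    calc ρ * min 1 (1 / N) ≤ N * (1 / N) := by
          gcongr
          · exact min_le_left _ _
          · exact min_le_right _ _
      _ = 1 := by field_simp
      _ ≤ _ := by nlinarith

namespace PhaseBlock

variable {K α σ U₁ U W κ : ℝ} {h : ℝ → ℝ → ℝ} {r r' r'' : ℝ → ℝ} {R : ℝ}

/-- A counting bound `A s + B` for small distances becomes a bound for the differenced sums, by
summing over dyadic distances. The factor 99840 is `2 · 960 · 2 · 26`. -/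
theorem sum_diffNorm_le (H : PhaseBlock K α σ U₁ U W κ h r r' r'') {M D A B : ℝ} (hR : 0 < R)
    (hM : 0 < M) (hD : 0 < D) (hUM : 1 ≤ U * M ^ 2) {l N : ℝ}
    (hl : l = R * D * κ / (64 * K ^ 4 * M ^ 4)) (hN : N = 5 * U * M ^ 2) (P : Finset (ℕ × ℕ))
    (hP : ∀ x ∈ P, x.1 ∈ dyadicRange M ∧ x.1 + x.2 ∈ dyadicRange M ∧ D ≤ x.2 ∧ (x.2 : ℝ) ≤ 2 * D)
    (hA : 0 ≤ A) (hB : 0 ≤ B)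
    (hcount : ∀ s : ℝ, 0 < s → s ≤ 1 →
      (({x ∈ P | distInt (modelSlope (R * α / 2) x.1 x.2) ≤ s}).card : ℝ) ≤ A * s + B)
    {I : ℕ} (hI : N ≤ 2 ^ I) :
    ∑ x ∈ P, diffNorm h R U₁ U x.1 x.2 ≤
      99840 * K ^ 13 * ((I + 1) * A * (1 + N * √l) + B * min N (N * √l + 1 / √l)) := by
  have hK := H.one_le
  have hK0 : 0 < K := by linarith
  have hκ := H.κ_pos
  have hl0 : 0 < l := by rw [hl]; positivity
  have hN1 : 1 ≤ N := by rw [hN]; nlinarith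
  have hN0 : 0 < N := by linarith
  have hs : 0 < √l := Real.sqrt_pos.2 hl0
  have hK5 : (1 : ℝ) ≤ 26 * K ^ 5 := by have := one_le_pow₀ (n := 5) hK; linarith
  have hK8 : (1 : ℝ) ≤ K ^ 8 := one_le_pow₀ hK
  set ρ := min N (N * √l + 1 / √l) with hρ
  have hρ0 : 0 < ρ := by positivity
  set θ := min 1 (max (1 / N) (26 * K ^ 5 * (l * N))) with hθ
  have hθ0 : 0 < θ := lt_min one_pos (lt_max_of_lt_left (by positivity))
  have hIθ : 1 ≤ 2 ^ I * θ := by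
    have h1 : 1 / N ≤ θ := le_min ((div_le_one hN0).2 hN1) (le_max_left _ _)
    calc (1 : ℝ) = N * (1 / N) := by field_simp
      _ ≤ _ := by gcongr
  have key := sum_le_of_count P (fun x => distInt (modelSlope (R * α / 2) x.1 x.2))
    (fun x => diffNorm h R U₁ U x.1 x.2) (C := 960 * K ^ 8) (ρ := ρ) (θ := θ) (I := I) hA hB
    (by positivity) hρ0 hθ0 (one_le_min_mul_max hl0 hN1 hK5) hIθ
    (fun x _ => (distInt_le_half _).trans (by norm_num))
    (fun x hx => by
      obtain ⟨h1, h2, h3, h4⟩ := hP x hx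
      have hq : 0 < x.2 := by exact_mod_cast hD.trans_le h3
      exact (H.norm_sum_diff_le hR hM hD hq h3 h4 h1 h2 hUM hl hN).1)
    (fun x hx hlt => by
      obtain ⟨h1, h2, h3, h4⟩ := hP x hx
      have hq : 0 < x.2 := by exact_mod_cast hD.trans_le h3
      have hy : 0 < distInt (modelSlope (R * α / 2) x.1 x.2) := hθ0.trans hlt
      refine ((H.norm_sum_diff_le hR hM hD hq h3 h4 h1 h2 hUM hl hN).2 ?_).trans ?_
      · rcases min_lt_iff.1 hlt with h5 | h5
        · have := distInt_le_half (modelSlope (R * α / 2) x.1 x.2)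
          linarith
        · exact (le_max_right _ _).trans_lt h5
      · gcongr
        linarith)
    hcount
  refine key.trans ?_
  have hρθ : ρ * θ ≤ 2 * (26 * K ^ 5) * (1 + N * √l) := min_mul_max_le hl0 hN1 hK5
  have hNs : 0 ≤ N * √l := by positivity
  calc 2 * (960 * K ^ 8) * ((I + 1) * A * (ρ * θ) + 2 * B * ρ)
      ≤ 2 * (960 * K ^ 8) * ((I + 1) * A * (2 * (26 * K ^ 5) * (1 + N * √l)) +
          2 * B * ρ * (26 * K ^ 5)) := by
        have h0 : 0 ≤ 2 * B * ρ := by positivity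
        have h1 : 2 * B * ρ ≤ 2 * B * ρ * (26 * K ^ 5) := le_mul_of_one_le_right h0 hK5
        gcongr
    _ = _ := by ring

end PhaseBlock

/-! ### Cauchy's inequality and differencing for the sum itself -/

section reduction

variable {K α σ U₁ U W κ : ℝ} {h : ℝ → ℝ → ℝ} {r r' r'' : ℝ → ℝ} {R M : ℝ}

/-- The sum to be bounded, for a general phase. -/
noncomputable def phaseSum (h : ℝ → ℝ → ℝ) (R U₁ U M : ℝ) : ℂ :=
  ∑ m ∈ dyadicRange M, ∑ n ∈ Finset.Ico ⌈U₁ * (m : ℝ) ^ 2⌉₊ ⌈(U₁ + U) * (m : ℝ) ^ 2⌉₊,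
    (r2 n : ℂ) * e (R * h n m)

theorem card_Ico_dyadic_le {m : ℕ} (hU1 : 0 ≤ U₁) (hU : 0 ≤ U)
    (hm : m ∈ dyadicRange M) :
    ((Finset.Ico ⌈U₁ * (m : ℝ) ^ 2⌉₊ ⌈(U₁ + U) * (m : ℝ) ^ 2⌉₊).card : ℝ) ≤
      4 * U * M ^ 2 + 1 := by
  rw [mem_dyadicRange] at hm
  have h1 : U₁ * (m : ℝ) ^ 2 ≤ (U₁ + U) * (m : ℝ) ^ 2 := by gcongr; linarith
  rw [Nat.card_Ico, Nat.cast_sub (Nat.ceil_le_ceil h1)]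
  refine natCeil_sub_le (by positivity) h1 ?_
  have : U * (m : ℝ) ^ 2 ≤ U * (2 * M) ^ 2 := by gcongr; exact hm.2.le
  nlinarith

/-- The trivial bound. -/
theorem norm_phaseSum_le_trivial {Z : ℝ} (hM : 0 < M) (hU1 : 0 < U₁) (hU : 0 ≤ U) (hZ : 0 ≤ Z)
    (hr2 : ∀ n : ℕ, n ≠ 0 → (n : ℝ) ≤ 4 * (U₁ + U) * M ^ 2 → (r2 n : ℝ) ≤ Z) :
    ‖phaseSum h R U₁ U M‖ ≤ 3 * M * ((4 * U * M ^ 2 + 1) * Z) := by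
  unfold phaseSum
  refine (norm_sum_le _ _).trans ?_
  refine (Finset.sum_le_card_nsmul _ _ ((4 * U * M ^ 2 + 1) * Z) fun m hm => ?_).trans ?_
  · refine (norm_sum_le _ _).trans ((Finset.sum_le_card_nsmul _ _ Z fun n hn => ?_).trans ?_)
    · rw [norm_mul, norm_e, mul_one, Complex.norm_natCast]
      rw [Finset.mem_Ico, Nat.ceil_le, Nat.lt_ceil] at hn
      rw [mem_dyadicRange] at hm
      have hm0 : (0 : ℝ) < m := hM.trans_le hm.1
      refine hr2 n ?_ ?_
      · rintro rfl
        have : 0 < U₁ * (m : ℝ) ^ 2 := by positivity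
        have := hn.1
        push_cast at this
        linarith
      · have : (U₁ + U) * (m : ℝ) ^ 2 ≤ (U₁ + U) * (2 * M) ^ 2 := by gcongr; exact hm.2.le
        nlinarith [hn.2]
    · rw [nsmul_eq_mul]
      gcongr
      exact card_Ico_dyadic_le hU1.le hU hm
  · rw [nsmul_eq_mul]
    have := card_dyadicRange_le hM
    gcongr

/-- For fixed `n` the condition `U₁ ≤ n / m² < U₁ + U` confines `m` to an interval of length at most
`2 K² U M / W²`. -/
theorem PhaseBlock.card_image_div_le (H : PhaseBlock K α σ U₁ U W κ h r r' r'') (hM : 0 < M)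
    {Q : ℕ} (hQ : 0 < Q) (n : ℕ) :
    ((({m ∈ dyadicRange M | n ∈
      Finset.Ico ⌈U₁ * ((m : ℕ) : ℝ) ^ 2⌉₊ ⌈(U₁ + U) * ((m : ℕ) : ℝ) ^ 2⌉₊}).image
      (· / Q)).card : ℝ) ≤ 2 * K ^ 2 * U * M / (W ^ 2 * Q) + 2 := by
  have hK := H.one_le
  have hK0 : 0 < K := by linarith
  have hU := H.U_pos
  have hU1 := H.U₁_pos
  have hW := H.W_pos
  have hQ0 : (0 : ℝ) < Q := by exact_mod_cast hQ
  set s := {m ∈ dyadicRange M | n ∈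
    Finset.Ico ⌈U₁ * ((m : ℕ) : ℝ) ^ 2⌉₊ ⌈(U₁ + U) * ((m : ℕ) : ℝ) ^ 2⌉₊}
    with hs
  rcases s.eq_empty_or_nonempty with he | hne
  · rw [he]; simp; positivity
  have hmem : ∀ m ∈ s, (M ≤ m ∧ (m : ℝ) < 2 * M) ∧ U₁ * (m : ℝ) ^ 2 ≤ n ∧
      (n : ℝ) < (U₁ + U) * (m : ℝ) ^ 2 := by
    intro m hm
    rw [hs, Finset.mem_filter, mem_dyadicRange, Finset.mem_Ico, Nat.ceil_le, Nat.lt_ceil] at hm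
    exact hm
  set p := s.min' hne
  set p' := s.max' hne
  have hp := hmem p (s.min'_mem hne)
  have hp' := hmem p' (s.max'_mem hne)
  have hpp : p ≤ p' := s.min'_le _ (s.max'_mem hne)
  have hpp' : (p : ℝ) ≤ p' := by exact_mod_cast hpp
  have hp0 : (0 : ℝ) < p := hM.trans_le hp.1.1
  have hlen : (p' : ℝ) - p ≤ 2 * K ^ 2 * U * M / W ^ 2 := by
    have e1 : U₁ * ((p' : ℝ) ^ 2 - p ^ 2) ≤ U * p ^ 2 := by nlinarith [hp'.2.1, hp.2.2]
    have e2 : W ^ 2 ≤ K ^ 2 * U₁ := by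
      calc W ^ 2 ≤ (K * √U₁) ^ 2 := by gcongr; exact H.lower
        _ = K ^ 2 * U₁ := by rw [mul_pow, Real.sq_sqrt hU1.le]
    have e3 : U₁ * ((p' : ℝ) - p) ≤ U * p := by
      have : U₁ * ((p' : ℝ) - p) * p ≤ U * p * p := by
        have : (p' : ℝ) ^ 2 - p ^ 2 = (p' - p) * (p' + p) := by ring
        rw [this] at e1
        have e4 : 0 ≤ U₁ * ((p' : ℝ) - p) := mul_nonneg hU1.le (by linarith)
        nlinarith
      exact le_of_mul_le_mul_right this hp0
    rw [le_div_iff₀ (by positivity)]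
    have e5 : 0 ≤ (p' : ℝ) - p := by linarith
    calc ((p' : ℝ) - p) * W ^ 2 ≤ (p' - p) * (K ^ 2 * U₁) := by gcongr
      _ = K ^ 2 * (U₁ * (p' - p)) := by ring
      _ ≤ K ^ 2 * (U * p) := by gcongr
      _ ≤ K ^ 2 * (U * (2 * M)) := by gcongr; exact hp.1.2.le
      _ = _ := by ring
  have hsub : s.image (· / Q) ⊆ Finset.Icc (p / Q) (p' / Q) := by
    intro k hk
    obtain ⟨m, hm, rfl⟩ := Finset.mem_image.1 hk
    exact Finset.mem_Icc.2 ⟨Nat.div_le_div_right (s.min'_le m hm),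
      Nat.div_le_div_right (s.le_max' m hm)⟩
  have hcard := Finset.card_le_card hsub
  rw [Nat.card_Icc] at hcard
  have h1 : ((s.image (· / Q)).card : ℝ) + ((p / Q : ℕ) : ℝ) ≤ ((p' / Q : ℕ) : ℝ) + 1 := by
    have := Nat.div_le_div_right (c := Q) hpp
    exact_mod_cast (by omega : (s.image (· / Q)).card + p / Q ≤ p' / Q + 1)
  have h2 : ((p' / Q : ℕ) : ℝ) ≤ p' / Q := Nat.cast_div_le
  have h3 : (p : ℝ) / Q ≤ ((p / Q : ℕ) : ℝ) + 1 := by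
    rw [div_le_iff₀ hQ0]
    have e1 := Nat.div_add_mod p Q
    have e2 := Nat.mod_lt p hQ
    have e3 : p ≤ (p / Q + 1) * Q := by nlinarith
    exact_mod_cast e3
  have h4 : ((p' : ℝ) - p) / Q ≤ 2 * K ^ 2 * U * M / (W ^ 2 * Q) := by
    rw [← div_div]; gcongr
  rw [sub_div] at h4
  linarith

/-- Cauchy's inequality over `n`, then differencing over `m`. -/
theorem PhaseBlock.norm_phaseSum_sq_le (H : PhaseBlock K α σ U₁ U W κ h r r' r'') (hM : 0 < M)
    {Q : ℕ} (hQ : 0 < Q) (hQU : (Q : ℝ) ≤ 2 * K * U * M) (hUM : 1 ≤ U * M ^ 2) {Z : ℝ}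
    (hr2 : ∀ n : ℕ, n ≠ 0 → (n : ℝ) ≤ 4 * (U₁ + U) * M ^ 2 → (r2 n : ℝ) ≤ Z) :
    ‖phaseSum h R U₁ U M‖ ^ 2 ≤ 24 * K ^ 5 * Z ^ 2 * (U * M ^ 3 / Q) *
      (15 * (U * M ^ 3) + 2 * ∑ q ∈ Finset.Ico 1 Q,
        ∑ m ∈ dyadicRange M with m + q ∈ dyadicRange M, diffNorm h R U₁ U m q) := by
  have hK := H.one_le
  have hK0 : 0 < K := by linarith
  have hU := H.U_pos
  have hU1 := H.U₁_pos
  have hW := H.W_pos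
  have hQ0 : (0 : ℝ) < Q := by exact_mod_cast hQ
  -- `n = 0` never occurs since `U₁ > 0`, so the divisor bound for `r₂` is available throughout.
  set ns := Finset.Ico 1 ⌈4 * (U₁ + U) * M ^ 2⌉₊ with hns
  set I : ℕ → Finset ℕ := fun m => Finset.Ico ⌈U₁ * (m : ℝ) ^ 2⌉₊ ⌈(U₁ + U) * (m : ℝ) ^ 2⌉₊ with hI
  set z : ℕ → ℕ → ℂ := fun n m => if n ∈ I m then e (R * h n m) else 0 with hz
  have hIns : ∀ m ∈ dyadicRange M, I m ⊆ ns := by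
    intro m hm n hn
    rw [mem_dyadicRange] at hm
    have hm0 : (0 : ℝ) < m := hM.trans_le hm.1
    rw [hI, Finset.mem_Ico, Nat.ceil_le, Nat.lt_ceil] at hn
    rw [hns, Finset.mem_Ico, Nat.lt_ceil]
    constructor
    · have : 0 < U₁ * (m : ℝ) ^ 2 := by positivity
      have : (0 : ℝ) < n := by linarith [hn.1]
      exact_mod_cast this
    · have : (U₁ + U) * (m : ℝ) ^ 2 ≤ (U₁ + U) * (2 * M) ^ 2 := by gcongr; exact hm.2.le
      nlinarith [hn.2]
  have hns' : ∀ n ∈ ns, (r2 n : ℝ) ≤ Z := by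
    intro n hn
    rw [hns, Finset.mem_Ico, Nat.lt_ceil] at hn
    exact hr2 n (by omega) hn.2.le
  -- The `W²` here cancels the one in the number of blocks of `m`: near the origin `m` runs over
  -- longer intervals, but there are fewer `n`.
  have hnscard : (ns.card : ℝ) ≤ 4 * (K * W) ^ 2 * M ^ 2 := by
    have e1 : U₁ + U ≤ (K * W) ^ 2 := by
      calc U₁ + U = √(U₁ + U) ^ 2 := (Real.sq_sqrt (by linarith)).symm
        _ ≤ _ := by gcongr; exact H.upper
    have e2 : (ns.card : ℝ) ≤ 4 * (U₁ + U) * M ^ 2 := by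
      rw [hns, Nat.card_Ico]
      have := Nat.ceil_lt_add_one (a := 4 * (U₁ + U) * M ^ 2) (by positivity)
      rw [Nat.cast_sub (Nat.one_le_ceil_iff.2 (by positivity))]
      push_cast
      linarith
    calc (ns.card : ℝ) ≤ 4 * (U₁ + U) * M ^ 2 := e2
      _ ≤ _ := by gcongr
  have hS : phaseSum h R U₁ U M = ∑ n ∈ ns, (r2 n : ℂ) * ∑ m ∈ dyadicRange M, z n m := by
    unfold phaseSum
    simp_rw [Finset.mul_sum]
    rw [Finset.sum_comm (s := ns)]
    refine Finset.sum_congr rfl fun m hm => ?_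
    simp only [hz, mul_ite, mul_zero]
    rw [Finset.sum_ite_mem, Finset.inter_eq_right.2 (hIns m hm)]
  have hcs : ‖phaseSum h R U₁ U M‖ ^ 2 ≤ (ns.card * Z ^ 2) *
      ∑ n ∈ ns, ‖∑ m ∈ dyadicRange M, z n m‖ ^ 2 := by
    rw [hS]
    calc _ ≤ (∑ n ∈ ns, (r2 n : ℝ) * ‖∑ m ∈ dyadicRange M, z n m‖) ^ 2 := by
          gcongr
          refine (norm_sum_le _ _).trans (le_of_eq (Finset.sum_congr rfl fun n _ => ?_))
          rw [norm_mul, Complex.norm_natCast]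
      _ ≤ (∑ n ∈ ns, (r2 n : ℝ) ^ 2) * ∑ n ∈ ns, ‖∑ m ∈ dyadicRange M, z n m‖ ^ 2 :=
          Finset.sum_mul_sq_le_sq_mul_sq _ _ _
      _ ≤ _ := by
          gcongr
          refine (Finset.sum_le_card_nsmul _ _ (Z ^ 2) fun n hn => ?_).trans (by rw [nsmul_eq_mul])
          have := hns' n hn
          gcongr
  have hzne : ∀ n m, z n m ≠ 0 → n ∈ I m := by
    intro n m hne
    by_contra hc
    exact hne (by simp only [hz, hc, if_false])
  have hblocks := sum_norm_sum_sq_le ns (dyadicRange M) z hQ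
    (K := 2 * K ^ 2 * U * M / (W ^ 2 * Q) + 2) (fun n _ => by
      refine le_trans ?_ (H.card_image_div_le hM hQ n)
      refine Nat.cast_le.2 (Finset.card_le_card (Finset.image_subset_image fun m hm => ?_))
      rw [Finset.mem_filter] at hm ⊢
      exact ⟨hm.1, hzne n m hm.2⟩)
  have hdiag : ∑ m ∈ dyadicRange M, ‖∑ n ∈ ns, z n m * (starRingEnd ℂ) (z n m)‖ ≤
      15 * (U * M ^ 3) := by
    have : ∀ m ∈ dyadicRange M, ‖∑ n ∈ ns, z n m * (starRingEnd ℂ) (z n m)‖ ≤ 5 * U * M ^ 2 := by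
      intro m hm
      have e1 : ∑ n ∈ ns, z n m * (starRingEnd ℂ) (z n m) = ∑ n ∈ ns, if n ∈ I m then 1 else 0 := by
        refine Finset.sum_congr rfl fun n _ => ?_
        simp only [hz]
        split_ifs
        · rw [e_mul_conj, sub_self]; simp [e]
        · simp
      rw [e1, Finset.sum_ite_mem, Finset.inter_eq_right.2 (hIns m hm)]
      simp only [Finset.sum_const, nsmul_eq_mul, mul_one, Complex.norm_natCast]
      refine (card_Ico_dyadic_le hU1.le hU.le hm).trans ?_
      linarith
    refine (Finset.sum_le_card_nsmul _ _ _ this).trans ?_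
    rw [nsmul_eq_mul]
    have := card_dyadicRange_le hM
    calc ((dyadicRange M).card : ℝ) * (5 * U * M ^ 2) ≤ 3 * M * (5 * U * M ^ 2) := by gcongr
      _ = _ := by ring
  have hoff : ∀ q m, m ∈ dyadicRange M → m + q ∈ dyadicRange M →
      ‖∑ n ∈ ns, z n m * (starRingEnd ℂ) (z n (m + q))‖ = diffNorm h R U₁ U m q := by
    intro q m hm hmq
    unfold diffNorm
    congr 1
    have hinter : Finset.Ico ⌈U₁ * ((m + q : ℕ) : ℝ) ^ 2⌉₊ ⌈(U₁ + U) * (m : ℝ) ^ 2⌉₊ =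
        I m ∩ I (m + q) := by
      simp only [hI]
      rw [Finset.Ico_inter_Ico]
      have l1 : U₁ * (m : ℝ) ^ 2 ≤ U₁ * ((m + q : ℕ) : ℝ) ^ 2 := by
        gcongr; linarith
      have l2 : (U₁ + U) * (m : ℝ) ^ 2 ≤ (U₁ + U) * ((m + q : ℕ) : ℝ) ^ 2 := by
        gcongr; linarith
      congr 1
      · exact (max_eq_right (Nat.ceil_le_ceil l1)).symm
      · exact (min_eq_left (Nat.ceil_le_ceil l2)).symm
    have e1 : ∀ n, z n m * (starRingEnd ℂ) (z n (m + q)) =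
        if n ∈ I m ∩ I (m + q) then e (R * h n m - R * h n (m + q : ℕ)) else 0 := by
      intro n
      rw [← e_mul_conj]
      simp only [hz, Finset.mem_inter]
      by_cases h1 : n ∈ I m <;> by_cases h2 : n ∈ I (m + q) <;> simp [h1, h2]
    simp_rw [e1]
    rw [Finset.sum_ite_mem, hinter, Finset.inter_eq_right.2]
    exact Finset.inter_subset_left.trans (hIns m hm)
  have hoff' : ∑ q ∈ Finset.Ico 1 Q, ∑ m ∈ dyadicRange M with m + q ∈ dyadicRange M,
      ‖∑ n ∈ ns, z n m * (starRingEnd ℂ) (z n (m + q))‖ = ∑ q ∈ Finset.Ico 1 Q,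
        ∑ m ∈ dyadicRange M with m + q ∈ dyadicRange M, diffNorm h R U₁ U m q := by
    refine Finset.sum_congr rfl fun q _ => Finset.sum_congr rfl fun m hm => ?_
    rw [Finset.mem_filter] at hm
    exact hoff q m hm.1 hm.2
  rw [hoff'] at hblocks
  set Y := ∑ q ∈ Finset.Ico 1 Q,
        ∑ m ∈ dyadicRange M with m + q ∈ dyadicRange M, diffNorm h R U₁ U m q
  have hY : 0 ≤ Y :=
    Finset.sum_nonneg fun q _ => Finset.sum_nonneg fun m _ => diffNorm_nonneg _ _ _ _ _ _
  -- The summand 2 is absorbed by means of `Q ≤ 2 K U M` and `W ≤ K`.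
  have hK2 : 2 * K ^ 2 * U * M / (W ^ 2 * Q) + 2 ≤ 6 * K ^ 3 * U * M / (W ^ 2 * Q) := by
    have hWK : W ^ 2 ≤ K ^ 2 := by gcongr; exact H.W_le
    have e1 : 2 ≤ 4 * K ^ 3 * U * M / (W ^ 2 * Q) := by
      rw [le_div_iff₀ (by positivity)]
      calc 2 * (W ^ 2 * Q) ≤ 2 * (K ^ 2 * (2 * K * U * M)) := by gcongr
        _ = _ := by ring
    have e2 : 2 * K ^ 2 * U * M / (W ^ 2 * Q) ≤ 2 * K ^ 3 * U * M / (W ^ 2 * Q) := by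
      have : K ^ 2 ≤ K ^ 3 := pow_le_pow_right₀ hK (by norm_num)
      gcongr
    have e3 : 6 * K ^ 3 * U * M / (W ^ 2 * Q) = 2 * K ^ 3 * U * M / (W ^ 2 * Q) +
        4 * K ^ 3 * U * M / (W ^ 2 * Q) := by ring
    linarith
  calc ‖phaseSum h R U₁ U M‖ ^ 2 ≤ (ns.card * Z ^ 2) *
      ∑ n ∈ ns, ‖∑ m ∈ dyadicRange M, z n m‖ ^ 2 := hcs
    _ ≤ (4 * (K * W) ^ 2 * M ^ 2 * Z ^ 2) *
        (6 * K ^ 3 * U * M / (W ^ 2 * Q) * (15 * (U * M ^ 3) + 2 * Y)) := by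
        gcongr
        refine hblocks.trans ?_
        gcongr
    _ = _ := by field_simp; ring

end reduction

end RevolutionBody

/-! ### Optimisation of the parameters -/

namespace RevolutionBody

theorem le_of_sq_le {a b : ℝ} (hb : 0 ≤ b) (h : a ^ 2 ≤ b ^ 2) : a ≤ b := by
  rcases le_or_gt a 0 with ha | ha
  · linarith
  · exact (pow_le_pow_iff_left₀ ha.le hb two_ne_zero).1 h

/-- Here `s = √l` and `w = N s`. The target `M t⁶ / U` for a single `q`, times `Q = U² M² / t⁶`,
equals the size `U M³` of the diagonal terms. The first alternative of `hcase` handles the term `1 /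
s`; under the second one the trivial bound `N` suffices. -/
theorem short_range_second {K U M κ t q s X w : ℝ} (hK : 1 ≤ K) (hU : 0 < U) (hUK : U ≤ K)
    (hM : 0 < M) (ht : 1 ≤ t) (hUM : t ^ 3 ≤ U * M) (hκ : 0 < κ)
    (hq : 1 ≤ q) (hqt : q * t ^ 6 ≤ U ^ 2 * M ^ 2)
    (hcase : U ^ 4 ≤ κ * t ^ 10 ∨ U ^ 4 * M ≤ t ^ 4) (hs : 0 < s)
    (hsl : s ^ 2 = t ^ 8 * q * κ / (64 * K ^ 4 * M ^ 4))
    (hX' : 2 * X ≤ K * t ^ 8) (hw0 : 0 < w) (hMw : M * w ≤ K ^ 4 * (M * t ^ 6 / U)) :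
    2 * X * q / M ^ 2 * min (5 * U * M ^ 2) (w + 1 / s) ≤ 13 * K ^ 8 * (M * t ^ 6 / U) := by
  have hK0 : 0 < K := by linarith
  have ht0 : 0 < t := by linarith
  have hq0 : 0 < q := by linarith
  set V := M * t ^ 6 / U with hV
  have hV0 : 0 < V := by positivity
  have p1 : K ≤ K ^ 8 := by simpa using pow_le_pow_right₀ hK (by norm_num : 1 ≤ 8)
  have p3 : K ^ 3 ≤ K ^ 8 := pow_le_pow_right₀ hK (by norm_num)
  have hB : 2 * X * q / M ^ 2 ≤ K * t ^ 8 * q / M ^ 2 := by gcongr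
  rcases hcase with hc | hc
  · have b1 : K * t ^ 8 * q / M ^ 2 ≤ K ^ 4 * M := by
      rw [div_le_iff₀ (by positivity)]
      have e2 : t ^ 2 * U ^ 2 ≤ K ^ 3 * M := by
        calc t ^ 2 * U ^ 2 ≤ t ^ 3 * U ^ 2 := by
              gcongr
              norm_num
          _ ≤ U * M * U ^ 2 := by gcongr
          _ = U ^ 3 * M := by ring
          _ ≤ K ^ 3 * M := by gcongr
      calc K * t ^ 8 * q = K * t ^ 2 * (q * t ^ 6) := by ring
        _ ≤ K * t ^ 2 * (U ^ 2 * M ^ 2) := by gcongr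
        _ = K * (t ^ 2 * U ^ 2) * M ^ 2 := by ring
        _ ≤ K * (K ^ 3 * M) * M ^ 2 := by gcongr
        _ = _ := by ring
    have b2 : K * t ^ 8 * q / M ^ 2 * (1 / s) ≤ 8 * K ^ 3 * V := by
      have e3 : q ≤ 8 * K ^ 2 * M ^ 3 / (t ^ 2 * U) * s := by
        refine le_of_sq_le (by positivity) ?_
        have e4 : (8 * K ^ 2 * M ^ 3 / (t ^ 2 * U) * s) ^ 2 = q * (M ^ 2 * t ^ 4 * κ / U ^ 2) := by
          rw [mul_pow, hsl]; field_simp; norm_num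
        rw [e4, sq]
        refine mul_le_mul_of_nonneg_left ?_ hq0.le
        rw [le_div_iff₀ (by positivity)]
        have : q * U ^ 2 * (t ^ 6 * U ^ 2) ≤ M ^ 2 * t ^ 4 * κ * (t ^ 6 * U ^ 2) := by
          calc q * U ^ 2 * (t ^ 6 * U ^ 2) = U ^ 4 * (q * t ^ 6) := by ring
            _ ≤ κ * t ^ 10 * (U ^ 2 * M ^ 2) := by gcongr
            _ = _ := by ring
        exact le_of_mul_le_mul_right this (by positivity)
      calc K * t ^ 8 * q / M ^ 2 * (1 / s)
          ≤ K * t ^ 8 * (8 * K ^ 2 * M ^ 3 / (t ^ 2 * U) * s) / M ^ 2 * (1 / s) := by gcongr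
        _ = _ := by rw [hV]; field_simp
    calc 2 * X * q / M ^ 2 * min (5 * U * M ^ 2) (w + 1 / s)
        ≤ K * t ^ 8 * q / M ^ 2 * (w + 1 / s) := by
          gcongr
          exact min_le_right _ _
      _ = K * t ^ 8 * q / M ^ 2 * w + K * t ^ 8 * q / M ^ 2 * (1 / s) := by ring
      _ ≤ K ^ 4 * M * w + 8 * K ^ 3 * V := by gcongr
      _ = K ^ 4 * (M * w) + 8 * K ^ 3 * V := by ring
      _ ≤ K ^ 4 * (K ^ 4 * V) + 8 * K ^ 8 * V := by gcongr
      _ ≤ _ := by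
          have : 0 < K ^ 8 * V := by positivity
          nlinarith
  · calc 2 * X * q / M ^ 2 * min (5 * U * M ^ 2) (w + 1 / s)
        ≤ K * t ^ 8 * q / M ^ 2 * (5 * U * M ^ 2) := by
          gcongr
          exact min_le_left _ _
      _ = 5 * K * U * t ^ 2 * (q * t ^ 6) := by field_simp
      _ ≤ 5 * K * U * t ^ 2 * (U ^ 2 * M ^ 2) := by gcongr
      _ = 5 * K * t ^ 2 * M / U * (U ^ 4 * M) := by field_simp
      _ ≤ 5 * K * t ^ 2 * M / U * t ^ 4 := by gcongr
      _ = 5 * K * V := by rw [hV]; field_simp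
      _ ≤ 13 * K ^ 8 * V := by gcongr; norm_num

set_option maxHeartbeats 1000000 in
/-- The optimisation for the shorter range of differences. -/
theorem short_range_bound {K U M κ t q s X Z L : ℝ} (hK : 1 ≤ K) (hU : 0 < U) (hUK : U ≤ K)
    (hM : 0 < M) (hMt : 2 * M ≤ t ^ 5) (ht : 1 ≤ t) (hUM : t ^ 3 ≤ U * M) (hκ : 0 < κ)
    (hκK : κ ≤ K) (hq : 1 ≤ q) (hqt : q * t ^ 6 ≤ U ^ 2 * M ^ 2)
    (hcase : U ^ 4 ≤ κ * t ^ 10 ∨ U ^ 4 * M ≤ t ^ 4) (hs : 0 < s)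
    (hsl : s ^ 2 = t ^ 8 * q * κ / (64 * K ^ 4 * M ^ 4)) (hX : t ^ 8 ≤ 2 * K * X)
    (hX' : 2 * X ≤ K * t ^ 8) (hZ : 1 ≤ Z) (hLZ : L ≤ Z) :
    L * (32 * M + 12 * M ^ 3 / (X * q)) * (1 + 5 * U * M ^ 2 * s) + 2 * X * q / M ^ 2 *
      min (5 * U * M ^ 2) (5 * U * M ^ 2 * s + 1 / s) ≤ 103 * K ^ 8 * Z * (M * t ^ 6 / U) := by
  have hK0 : 0 < K := by linarith
  have ht0 : 0 < t := by linarith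
  have hq0 : 0 < q := by linarith
  have hX0 : 0 < X := by
    have : 0 < t ^ 8 := by positivity
    by_contra hc
    push Not at hc
    nlinarith
  set V := M * t ^ 6 / U with hV
  have hV0 : 0 < V := by positivity
  set w := 5 * U * M ^ 2 * s with hw
  have hw0 : 0 < w := by positivity
  have hwsq : w ^ 2 = 25 / 64 * (U ^ 2 * t ^ 8 * q * κ / K ^ 4) := by
    rw [hw, mul_pow, hsl]; field_simp; ring
  have hdiv : U ^ 2 * t ^ 8 * q * κ / K ^ 4 ≤ K * (U ^ 2 * t ^ 8 * q) := by
    rw [div_le_iff₀ (by positivity)]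
    have : (1 : ℝ) ≤ K ^ 4 := one_le_pow₀ hK
    calc U ^ 2 * t ^ 8 * q * κ ≤ U ^ 2 * t ^ 8 * q * K := by gcongr
      _ ≤ U ^ 2 * t ^ 8 * q * K * K ^ 4 := le_mul_of_one_le_right (by positivity) this
      _ = _ := by ring
  have hwsq' : w ^ 2 ≤ K * (U ^ 2 * t ^ 8 * q) := by
    have : 0 ≤ U ^ 2 * t ^ 8 * q * κ / K ^ 4 := by positivity
    rw [hwsq]; linarith
  have hKsq : K ≤ K ^ 2 := by nlinarith
  have w1 : w ≤ K * U ^ 2 * t ^ 6 := by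
    refine le_of_sq_le (by positivity) (hwsq'.trans ?_)
    calc K * (U ^ 2 * t ^ 8 * q) = K * U ^ 2 * t ^ 2 * (q * t ^ 6) := by ring
      _ ≤ K * U ^ 2 * t ^ 2 * (U ^ 2 * M ^ 2) := by gcongr
      _ ≤ K * U ^ 2 * t ^ 2 * (U ^ 2 * (t ^ 5) ^ 2) := by
          gcongr
          linarith
      _ = K * (U ^ 2 * t ^ 6) ^ 2 := by ring
      _ ≤ K ^ 2 * (U ^ 2 * t ^ 6) ^ 2 := by gcongr
      _ = _ := by ring
  have w2 : w ≤ K * U * t ^ 4 * q := by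
    refine le_of_sq_le (by positivity) (hwsq'.trans ?_)
    calc K * (U ^ 2 * t ^ 8 * q) ≤ K ^ 2 * (U ^ 2 * t ^ 8 * (q * q)) := by
          gcongr
          nlinarith
      _ = _ := by ring
  have hMV : M ≤ K * V := by
    have : U ≤ K * t ^ 6 := hUK.trans (le_mul_of_one_le_right hK0.le (one_le_pow₀ ht))
    calc M = M / U * U := by field_simp
      _ ≤ M / U * (K * t ^ 6) := by gcongr
      _ = _ := by rw [hV]; ring
  have hMw : M * w ≤ K ^ 4 * V := by
    calc M * w ≤ M * (K * U ^ 2 * t ^ 6) := by gcongr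
      _ = K * U ^ 3 * V := by rw [hV]; field_simp
      _ ≤ K * K ^ 3 * V := by gcongr
      _ = _ := by ring
  have hM2 : M ^ 2 ≤ t ^ 10 / 4 := by nlinarith
  have hM3X : M ^ 3 / X ≤ K * (M * t ^ 2) := by
    rw [div_le_iff₀ hX0]
    calc M ^ 3 = M ^ 2 * M := by ring
      _ ≤ t ^ 10 / 4 * M := by gcongr
      _ = M * t ^ 2 / 4 * t ^ 8 := by ring
      _ ≤ M * t ^ 2 / 4 * (2 * K * X) := by gcongr
      _ = K * (M * t ^ 2) * X / 2 := by ring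
      _ ≤ K * (M * t ^ 2) * X := half_le_self (by positivity)
  have hM3a : M ^ 3 / (X * q) ≤ K ^ 2 * V := by
    calc M ^ 3 / (X * q) ≤ M ^ 3 / X := by
          rw [← div_div]
          exact div_le_self (by positivity) hq
      _ ≤ K * (M * t ^ 2) := hM3X
      _ = K * (M * t ^ 2 / U * U) := by field_simp
      _ ≤ K * (M * t ^ 6 / U * K) := by
          gcongr
          norm_num
      _ = _ := by rw [hV]; ring
  have hM3b : M ^ 3 / (X * q) * w ≤ K ^ 4 * V := by
    calc M ^ 3 / (X * q) * w ≤ M ^ 3 / (X * q) * (K * U * t ^ 4 * q) := by gcongr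
      _ = M ^ 3 / X * (K * U * t ^ 4) := by field_simp
      _ ≤ K * (M * t ^ 2) * (K * U * t ^ 4) := by gcongr
      _ = K ^ 2 * U ^ 2 * V := by rw [hV]; field_simp
      _ ≤ K ^ 2 * K ^ 2 * V := by gcongr
      _ = _ := by ring
  have p2 : K ^ 2 ≤ K ^ 8 := pow_le_pow_right₀ hK (by norm_num)
  have p1 : K ≤ K ^ 8 := by simpa using pow_le_pow_right₀ hK (by norm_num : 1 ≤ 8)
  have p3 : K ^ 3 ≤ K ^ 8 := pow_le_pow_right₀ hK (by norm_num)
  have p4 : K ^ 4 ≤ K ^ 8 := pow_le_pow_right₀ hK (by norm_num)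
  have hfirst : (32 * M + 12 * M ^ 3 / (X * q)) * (1 + w) ≤ 88 * K ^ 8 * V := by
    have e1 : (32 * M + 12 * M ^ 3 / (X * q)) * (1 + w) = 32 * M + 32 * (M * w) +
        12 * (M ^ 3 / (X * q)) + 12 * (M ^ 3 / (X * q) * w) := by ring
    rw [e1]
    have v1 : K * V ≤ K ^ 8 * V := by gcongr
    have v2 : K ^ 2 * V ≤ K ^ 8 * V := by gcongr
    have v4 : K ^ 4 * V ≤ K ^ 8 * V := by gcongr
    linarith
  have hsecond : 2 * X * q / M ^ 2 * min (5 * U * M ^ 2) (w + 1 / s) ≤ 13 * K ^ 8 * V :=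
    short_range_second hK hU hUK hM ht hUM hκ hq hqt hcase hs hsl hX' hw0 hMw
  have hA0 : 0 ≤ (32 * M + 12 * M ^ 3 / (X * q)) * (1 + w) := by positivity
  calc L * (32 * M + 12 * M ^ 3 / (X * q)) * (1 + w) + 2 * X * q / M ^ 2 *
        min (5 * U * M ^ 2) (w + 1 / s)
      = L * ((32 * M + 12 * M ^ 3 / (X * q)) * (1 + w)) + 2 * X * q / M ^ 2 *
        min (5 * U * M ^ 2) (w + 1 / s) := by ring
    _ ≤ Z * (88 * K ^ 8 * V) + 13 * K ^ 8 * V := by gcongr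
    _ ≤ _ := by
        have : 0 < K ^ 8 * V := by positivity
        nlinarith

/-- The facts on the precision of the rational approximation used for the longer range of
differences. -/
theorem long_range_precision {K U M κ t D s μ : ℝ} (hK : 1 ≤ K) (hU : 0 < U) (hUK : U ≤ K)
    (hM : 0 < M) (hM1 : 1 ≤ 2 * M) (ht : 1 ≤ t) (hUM : t ^ 3 ≤ U * M)
    (hκ : 0 < κ) (hD : 1 ≤ D) (hDU : D ≤ U * M)
    (hcase : κ * t ^ 10 ≤ U ^ 4) (hs : 0 < s)
    (hsl : s ^ 2 = t ^ 8 * D * κ / (64 * K ^ 4 * M ^ 4)) (hμ : μ = min (5 * U * M ^ 2) (1 / s)) :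
    t ^ 2 * U ≤ K ^ 2 * M ∧ t ^ 2 * U * D ≤ K ^ 3 * μ ∧
      min (5 * U * M ^ 2) (5 * U * M ^ 2 * s + 1 / s) ≤ 3 * K ^ 6 * μ ∧
      (1 + 5 * U * M ^ 2 * s) * μ ≤ 2 * (5 * U * M ^ 2) ∧
      1 + 5 * U * M ^ 2 * s ≤ 4 * K ^ 4 * M := by
  have hK0 : 0 < K := by linarith
  have ht0 : 0 < t := by linarith
  have hD0 : 0 < D := by linarith
  set N := 5 * U * M ^ 2 with hN
  have hN0 : 0 < N := by positivity
  have hμ0 : 0 < μ := by rw [hμ]; positivity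
  have p26 : K ^ 2 ≤ K ^ 3 := pow_le_pow_right₀ hK (by norm_num)
  have g1 : t ^ 2 * U ≤ K ^ 2 * M := by
    calc t ^ 2 * U ≤ t ^ 3 * U := by
          gcongr
          norm_num
      _ ≤ U * M * U := by gcongr
      _ = U ^ 2 * M := by ring
      _ ≤ _ := by gcongr
  have g2 : t ^ 2 * U * D ≤ K ^ 3 * N := by
    calc t ^ 2 * U * D ≤ K ^ 2 * M * (U * M) := by gcongr
      _ = K ^ 2 * (U * M ^ 2) := by ring
      _ ≤ K ^ 3 * N := by
          rw [hN]
          have : 0 < U * M ^ 2 := by positivity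
          gcongr
          linarith
  have hDcube : D ^ 3 ≤ (U * M) ^ 3 := by gcongr
  -- With `g2` this keeps the Dirichlet parameter `μ / (t² U D)` bounded below, so rounding it up
  -- later costs only a constant. The condition `κ t¹⁰ ≤ U⁴` is needed for it.
  have g3 : t ^ 2 * U * D * s ≤ K ^ 3 := by
    refine le_of_sq_le (by positivity) ?_
    have h64 : (1 : ℝ) ≤ 64 * K ^ 4 := by have := one_le_pow₀ (n := 4) hK; linarith
    calc (t ^ 2 * U * D * s) ^ 2 = t ^ 12 * U ^ 2 * κ / (64 * K ^ 4 * M ^ 4) * D ^ 3 := by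
          rw [mul_pow _ s, hsl]; field_simp
      _ ≤ t ^ 12 * U ^ 2 * κ / (64 * K ^ 4 * M ^ 4) * (U * M) ^ 3 := by gcongr
      _ = t ^ 2 * U ^ 5 * (κ * t ^ 10) / M / (64 * K ^ 4) := by field_simp
      _ ≤ t ^ 2 * U ^ 5 * U ^ 4 / M / (64 * K ^ 4) := by gcongr
      _ = (t ^ 2 * U) * U ^ 8 / M / (64 * K ^ 4) := by ring
      _ ≤ (K ^ 2 * M) * K ^ 8 / M / (64 * K ^ 4) := by gcongr
      _ = (K ^ 3) ^ 2 / 64 := by field_simp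
      _ ≤ (K ^ 3) ^ 2 := div_le_self (by positivity) (by norm_num)
  have g3' : t ^ 2 * U * D ≤ K ^ 3 * (1 / s) := by
    rw [mul_one_div, le_div_iff₀ hs]; exact g3
  have g23 : t ^ 2 * U * D ≤ K ^ 3 * μ := by
    rw [hμ, mul_min_of_nonneg _ _ (by positivity)]
    exact le_min g2 g3'
  have g4 : N * s ≤ 2 * K ^ 6 * (1 / s) := by
    have : N * s * s ≤ 2 * K ^ 6 := by
      have h64 : (5 : ℝ) ≤ 64 * K ^ 4 := by have := one_le_pow₀ (n := 4) hK; linarith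
      calc N * s * s = N * s ^ 2 := by ring
        _ = 5 / (64 * K ^ 4) * (U * t ^ 8 * D * κ / M ^ 2) := by rw [hsl, hN]; field_simp
        _ ≤ 1 * (U * t ^ 8 * D * κ / M ^ 2) := by
            gcongr
            exact (div_le_one (by positivity)).2 h64
        _ ≤ 1 * (U * t ^ 8 * (U * M) * κ / M ^ 2) := by gcongr
        _ = U ^ 2 * (κ * t ^ 10) / (t ^ 2 * M) := by field_simp
        _ ≤ U ^ 2 * U ^ 4 / (1 * (1 / 2)) := by
            gcongr
            · exact one_le_pow₀ ht
            · linarith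
        _ = 2 * U ^ 6 := by ring
        _ ≤ _ := by gcongr
    rw [mul_one_div, le_div_iff₀ hs]; exact this
  refine ⟨g1, g23, ?_, ?_, ?_⟩
  · have hK6 : (1 : ℝ) ≤ K ^ 6 := one_le_pow₀ hK
    rw [hμ, mul_min_of_nonneg _ _ (by positivity)]
    refine le_min ((min_le_left _ _).trans (by nlinarith)) ((min_le_right _ _).trans ?_)
    have : 0 < 1 / s := by positivity
    nlinarith
  · have h1 : μ ≤ N := by rw [hμ]; exact min_le_left _ _
    have h2 : N * s * μ ≤ N * s * (1 / s) := by gcongr; rw [hμ]; exact min_le_right _ _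
    have h3 : N * s * (1 / s) = N := by field_simp
    linarith
  · have h1 : N * s ≤ 2 * K ^ 4 * M := by
      refine le_of_sq_le (by positivity) ?_
      have h64 : (25 : ℝ) ≤ 64 * K ^ 4 := by have := one_le_pow₀ (n := 4) hK; linarith
      calc (N * s) ^ 2 = 25 / (64 * K ^ 4) * (U ^ 2 * t ^ 8 * D * κ) := by
            rw [mul_pow, hsl, hN]; field_simp; ring
        _ ≤ 1 * (U ^ 2 * t ^ 8 * D * κ) := by
            gcongr
            exact (div_le_one (by positivity)).2 h64
        _ ≤ 1 * (U ^ 2 * t ^ 8 * (U * M) * κ) := by gcongr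
        _ = U ^ 3 * M * (κ * t ^ 10) / t ^ 2 := by field_simp
        _ ≤ U ^ 3 * M * (κ * t ^ 10) := div_le_self (by positivity) (one_le_pow₀ ht)
        _ ≤ U ^ 3 * M * U ^ 4 := by gcongr
        _ = U ^ 7 * M := by ring
        _ ≤ K ^ 7 * M := by gcongr
        _ ≤ K ^ 8 * (M * (2 * M)) := by
            have : K ^ 7 ≤ K ^ 8 := pow_le_pow_right₀ hK (by norm_num)
            gcongr
            nlinarith
        _ ≤ (2 * K ^ 4 * M) ^ 2 := by
            have : 0 < K ^ 8 * M ^ 2 := by positivity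
            nlinarith
    have hK4 : (1 : ℝ) ≤ K ^ 4 := one_le_pow₀ hK
    nlinarith

set_option maxHeartbeats 1000000 in
/-- The optimisation for the longer range of differences. -/
theorem long_range_bound {K U M κ t D s μ X n b Δ L Z : ℝ} (hK : 1 ≤ K) (hU : 0 < U) (hUK : U ≤ K)
    (hM : 0 < M) (hM1 : 1 ≤ 2 * M) (hMt : 2 * M ≤ t ^ 5) (ht : 1 ≤ t) (hUM : t ^ 3 ≤ U * M)
    (hκ : 0 < κ) (hD : 1 ≤ D) (hDU : D ≤ U * M)
    (hcase : κ * t ^ 10 ≤ U ^ 4) (hcase' : t ^ 4 ≤ U ^ 4 * M) (hs : 0 < s)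
    (hsl : s ^ 2 = t ^ 8 * D * κ / (64 * K ^ 4 * M ^ 4)) (hμ : μ = min (5 * U * M ^ 2) (1 / s))
    (hX : t ^ 8 ≤ 2 * K * X) (hX' : 2 * X ≤ K * t ^ 8)
    (hn : μ / (t ^ 2 * U * D) ≤ n) (hn' : n ≤ μ / (t ^ 2 * U * D) + 1) (hb : 0 ≤ b) (hbn : b ≤ n)
    (hΔ : 0 ≤ Δ) (hΔZ : Δ ≤ Z) (hLZ : L ≤ Z) (hZ : 1 ≤ Z) :
    L * (12 * M ^ 3 / X + 64 * Δ * X * D * b) * (1 + 5 * U * M ^ 2 * s) +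
      8 * Δ * (X * D / M ^ 2) * (4 * D / n + 1) *
        min (5 * U * M ^ 2) (5 * U * M ^ 2 * s + 1 / s) ≤
          804 * K ^ 15 * Z ^ 2 * (M ^ 2 * t ^ 6) := by
  obtain ⟨g1, g2, g3, g4, g5⟩ := long_range_precision hK hU hUK hM hM1 ht hUM hκ hD hDU hcase hs
    hsl hμ
  have hK0 : 0 < K := by linarith
  have ht0 : 0 < t := by linarith
  have hD0 : 0 < D := by linarith
  have hZ0 : 0 < Z := by linarith
  have hμ0 : 0 < μ := by rw [hμ]; positivity
  have hX0 : 0 < X := by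
    have : 0 < t ^ 8 := by positivity
    by_contra hc
    push Not at hc
    nlinarith
  have hn0 : 0 < n := lt_of_lt_of_le (by positivity) hn
  set N := 5 * U * M ^ 2 with hN
  have hN0 : 0 < N := by positivity
  set ρ := min N (N * s + 1 / s) with hρ
  have hρ0 : 0 < ρ := by positivity
  set Y := M ^ 2 * t ^ 6 with hY
  have hY0 : 0 < Y := by positivity
  have hnu : n ≤ 2 * K ^ 3 * (μ / (t ^ 2 * U * D)) := by
    have : 1 ≤ K ^ 3 * (μ / (t ^ 2 * U * D)) := by
      rw [← mul_div_assoc, one_le_div (by positivity)]; exact g2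
    have hK3 : (1 : ℝ) ≤ K ^ 3 := one_le_pow₀ hK
    have : 0 < μ / (t ^ 2 * U * D) := by positivity
    nlinarith
  have hfac : 0 < 1 + N * s := by positivity
  have t1 : M ^ 3 / X * (1 + N * s) ≤ 8 * K ^ 5 * Y := by
    calc M ^ 3 / X * (1 + N * s) ≤ M ^ 3 / X * (4 * K ^ 4 * M) := by gcongr
      _ = M ^ 2 * M ^ 2 * (4 * K ^ 4) / X := by ring
      _ ≤ (t ^ 5) ^ 2 * M ^ 2 * (4 * K ^ 4) / X := by
          gcongr
          linarith
      _ = t ^ 8 / X * (t ^ 2 * M ^ 2 * (4 * K ^ 4)) := by ring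
      _ ≤ 2 * K * (t ^ 6 * M ^ 2 * (4 * K ^ 4)) := by
          gcongr
          · rw [div_le_iff₀ hX0]; exact hX
          · norm_num
      _ = _ := by rw [hY]; ring
  -- The order of approximation `n ≍ μ / (t² U D)` is the largest for which this term stays of size
  -- `M² t⁶`.
  have t2 : X * D * b * (1 + N * s) ≤ 10 * K ^ 4 * Y := by
    calc X * D * b * (1 + N * s) ≤ K * t ^ 8 / 2 * D * (2 * K ^ 3 * (μ / (t ^ 2 * U * D))) *
          (1 + N * s) := by
          gcongr
          · linarith
          · exact hbn.trans hnu
      _ = K ^ 4 * t ^ 6 / U * ((1 + N * s) * μ) := by field_simp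
      _ ≤ K ^ 4 * t ^ 6 / U * (2 * N) := by gcongr
      _ = _ := by rw [hY, hN]; field_simp; norm_num
  -- The error of the rational approximation; it is acceptable because of `t⁴ ≤ U⁴ M`.
  have t3 : X * D / M ^ 2 * (4 * D / n) * ρ ≤ 6 * K ^ 15 * Y := by
    calc X * D / M ^ 2 * (4 * D / n) * ρ
        ≤ K * t ^ 8 / 2 * D / M ^ 2 * (4 * D / (μ / (t ^ 2 * U * D))) * (3 * K ^ 6 * μ) := by
          gcongr
          linarith
      _ = 6 * K ^ 7 * t ^ 10 * U * D ^ 3 / M ^ 2 := by field_simp; ring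
      _ ≤ 6 * K ^ 7 * t ^ 10 * U * (U * M) ^ 3 / M ^ 2 := by gcongr
      _ = 6 * K ^ 7 * t ^ 6 * U ^ 4 * M * t ^ 4 := by field_simp
      _ ≤ 6 * K ^ 7 * t ^ 6 * U ^ 4 * M * (U ^ 4 * M) := by gcongr
      _ = 6 * K ^ 7 * U ^ 8 * Y := by rw [hY]; ring
      _ ≤ 6 * K ^ 7 * K ^ 8 * Y := by gcongr
      _ = _ := by ring
  have t4 : X * D / M ^ 2 * ρ ≤ 5 / 2 * K ^ 4 * Y := by
    calc X * D / M ^ 2 * ρ ≤ K * t ^ 8 / 2 * (U * M) / M ^ 2 * N := by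
          gcongr
          · linarith
          · exact min_le_left _ _
      _ = 5 / 2 * K * t ^ 6 * U * M * (t ^ 2 * U) := by rw [hN]; field_simp
      _ ≤ 5 / 2 * K * t ^ 6 * K * M * (K ^ 2 * M) := by gcongr
      _ = _ := by rw [hY]; ring
  have p5 : K ^ 5 ≤ K ^ 15 := pow_le_pow_right₀ hK (by norm_num)
  have p4 : K ^ 4 ≤ K ^ 15 := pow_le_pow_right₀ hK (by norm_num)
  have q1 : 8 * K ^ 5 * Y ≤ 8 * K ^ 15 * Y := by gcongr
  have q2 : 10 * K ^ 4 * Y ≤ 10 * K ^ 15 * Y := by gcongr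
  have q4 : 5 / 2 * K ^ 4 * Y ≤ 5 / 2 * K ^ 15 * Y := by gcongr
  have hW0 : 0 < K ^ 15 * Y := by positivity
  calc L * (12 * M ^ 3 / X + 64 * Δ * X * D * b) * (1 + N * s) +
      8 * Δ * (X * D / M ^ 2) * (4 * D / n + 1) * ρ
      = L * (12 * (M ^ 3 / X * (1 + N * s)) + 64 * Δ * (X * D * b * (1 + N * s))) +
        8 * Δ * (X * D / M ^ 2 * (4 * D / n) * ρ + X * D / M ^ 2 * ρ) := by ring
    _ ≤ Z * (12 * (8 * K ^ 15 * Y) + 64 * Z * (10 * K ^ 15 * Y)) +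
        8 * Z * (6 * K ^ 15 * Y + 5 / 2 * K ^ 15 * Y) := by
        have e1 := t1.trans q1
        have e2 := t2.trans q2
        have e4 := t4.trans q4
        have f2 : 64 * Δ * (X * D * b * (1 + N * s)) ≤ 64 * Z * (10 * K ^ 15 * Y) :=
          mul_le_mul (by linarith) e2 (by positivity) (by positivity)
        have f1 : 0 ≤ 12 * (M ^ 3 / X * (1 + N * s)) + 64 * Δ * (X * D * b * (1 + N * s)) := by
          positivity
        have f3 : 0 ≤ X * D / M ^ 2 * (4 * D / n) * ρ + X * D / M ^ 2 * ρ := by positivity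
        exact add_le_add (mul_le_mul hLZ (by linarith) f1 hZ0.le)
          (mul_le_mul (by linarith) (by linarith) f3 (by positivity))
    _ = (164 * Z + 640 * Z ^ 2) * (K ^ 15 * Y) := by ring
    _ ≤ (804 * Z ^ 2) * (K ^ 15 * Y) := by
        gcongr
        nlinarith
    _ = _ := by ring

end RevolutionBody

/-! ### The exponential sum on a block -/

namespace RevolutionBody

theorem sum_Ico_two_pow_le {F : ℕ → ℝ} {A : ℝ} (J : ℕ)
    (h : ∀ i < J, ∑ q ∈ Finset.Ico (2 ^ i) (2 * 2 ^ i), F q ≤ A) :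
    ∑ q ∈ Finset.Ico 1 (2 ^ J), F q ≤ J * A := by
  induction J with
  | zero => simp
  | succ J ih =>
    rw [← Finset.sum_Ico_consecutive F (Nat.one_le_two_pow (n := J))
      (Nat.pow_le_pow_right two_pos J.le_succ)]
    have h1 := ih fun i hi => h i (by omega)
    have h2 := h J (by omega)
    rw [pow_succ' 2 J]
    push_cast
    linarith

/-- The number of dyadic blocks is the least possible, so that each of them starts below `B` and the
hypothesis applies to it. -/
theorem sum_Ico_le_clog_mul {F : ℕ → ℝ} {A B : ℝ} (hF : ∀ q, 0 ≤ F q) (hA : 0 ≤ A) {I : ℕ}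
    (hI : B ≤ 2 ^ I)
    (h : ∀ D : ℕ, 1 ≤ D → (D : ℝ) < B → ∑ q ∈ Finset.Ico D (2 * D), F q ≤ A) :
    ∑ q ∈ Finset.Ico 1 ⌈B⌉₊, F q ≤ I * A := by
  have hQ : ⌈B⌉₊ ≤ 2 ^ I := Nat.ceil_le.2 (by exact_mod_cast hI)
  set J := Nat.clog 2 ⌈B⌉₊ with hJ
  have h1 : J ≤ I := Nat.clog_le_of_le_pow hQ
  have h2 : ⌈B⌉₊ ≤ 2 ^ J := Nat.le_pow_clog one_lt_two _
  calc ∑ q ∈ Finset.Ico 1 ⌈B⌉₊, F q ≤ ∑ q ∈ Finset.Ico 1 (2 ^ J), F q :=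
        Finset.sum_le_sum_of_subset_of_nonneg (Finset.Ico_subset_Ico_right h2)
          fun q _ _ => hF q
    _ ≤ J * A := by
        refine sum_Ico_two_pow_le J fun i hi => h _ Nat.one_le_two_pow ?_
        by_contra hc
        push Not at hc
        have : ⌈B⌉₊ ≤ 2 ^ i := Nat.ceil_le.2 (by exact_mod_cast hc)
        have := Nat.clog_le_of_le_pow this
        omega
    _ ≤ I * A := by gcongr

theorem card_divisors_two_pow (I : ℕ) : (2 ^ I).divisors.card = I + 1 := by
  rw [Nat.divisors_prime_pow Nat.prime_two]; simp

theorem denominator_le {K U M t D μ n : ℝ} (hK : 1 ≤ K) (hU : 0 < U) (hM : 0 < M)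
    (hMt : 2 * M ≤ t ^ 5) (hD : 1 ≤ D) (ht : 0 < t) (hμ : μ ≤ 5 * U * M ^ 2)
    (hμ' : t ^ 2 * U * D ≤ K ^ 3 * μ) (hn : n ≤ μ / (t ^ 2 * U * D) + 1) :
    n ≤ 5 * K ^ 3 * t ^ 8 := by
  have hD0 : 0 < D := by linarith
  have hK3 : (1 : ℝ) ≤ K ^ 3 := one_le_pow₀ hK
  set ν := μ / (t ^ 2 * U * D) with hν
  have e1 : 1 ≤ K ^ 3 * ν := by
    rw [hν, ← mul_div_assoc, one_le_div (by positivity)]; exact hμ'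
  have e2 : ν ≤ 5 / 4 * t ^ 8 := by
    rw [hν, div_le_iff₀ (by positivity)]
    have e4 : M ^ 2 ≤ t ^ 10 / 4 := by nlinarith
    calc μ ≤ 5 * U * M ^ 2 := hμ
      _ ≤ 5 * U * (t ^ 10 / 4) := by gcongr
      _ ≤ 5 * U * (t ^ 10 / 4) * D := le_mul_of_one_le_right (by positivity) hD
      _ = _ := by ring
  have e3 : 0 < ν := by
    by_contra hc
    push Not at hc
    nlinarith
  have e5 : K ^ 3 * ν ≤ K ^ 3 * (5 / 4 * t ^ 8) := by gcongr
  have e6 : ν ≤ K ^ 3 * ν := le_mul_of_one_le_left e3.le hK3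
  have : 0 < K ^ 3 * t ^ 8 := by positivity
  linarith

/-- Keeps `b k w - p²` polynomially bounded in `t`, so that a single divisor bound `Z` serves
everywhere. -/
theorem discriminant_le {K t X b : ℝ} (hK : 0 < K) (ht : 0 < t) (hX : 0 ≤ X)
    (hX' : 2 * X ≤ K * t ^ 8) (hb : 0 ≤ b) (hb' : b ≤ 5 * K ^ 3 * t ^ 8) :
    8 * b ^ 2 * X ^ 2 ≤ 200 * K ^ 8 * t ^ 32 := by
  have : X ≤ K * t ^ 8 / 2 := by linarith
  calc 8 * b ^ 2 * X ^ 2 ≤ 8 * (5 * K ^ 3 * t ^ 8) ^ 2 * (K * t ^ 8 / 2) ^ 2 := by gcongr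
    _ = 50 * (K ^ 8 * t ^ 32) := by ring
    _ ≤ 200 * (K ^ 8 * t ^ 32) := by
        have : 0 < K ^ 8 * t ^ 32 := by positivity
        linarith
    _ = _ := by ring

section core

variable {K α σ U₁ U W κ : ℝ} {h : ℝ → ℝ → ℝ} {r r' r'' : ℝ → ℝ} {M t Z : ℝ}

namespace PhaseBlock

theorem add_le (H : PhaseBlock K α σ U₁ U W κ h r r' r'') : U₁ + U ≤ K ^ 4 := by
  have hK := H.one_le
  have hW := H.W_le
  have hU := H.U_pos
  have hU1 := H.U₁_pos
  have h1 : √(U₁ + U) ≤ K * K := H.upper.trans (by gcongr)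
  have h2 := (Real.sqrt_le_left (by positivity)).1 h1
  calc U₁ + U ≤ (K * K) ^ 2 := h2
    _ = _ := by ring

theorem sum_diffNorm_fixed_le (H : PhaseBlock K α σ U₁ U W κ h r r' r'') (hM : 0 < M)
    (hMt : 2 * M ≤ t ^ 5) (ht : 1 ≤ t) (hUM : t ^ 3 ≤ U * M) (hUM' : 1 ≤ U * M ^ 2)
    (hcase : U ^ 4 ≤ κ * t ^ 10 ∨ U ^ 4 * M ≤ t ^ 4) (hZ : 1 ≤ Z) {I : ℕ}
    (hI : 5 * U * M ^ 2 ≤ 2 ^ I) (hIZ : (I + 1 : ℝ) ≤ Z) {q : ℕ} (hq : 1 ≤ q)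
    (hqt : q * t ^ 6 ≤ U ^ 2 * M ^ 2) :
    ∑ m ∈ dyadicRange M with m + q ∈ dyadicRange M, diffNorm h (t ^ 8) U₁ U m q ≤
      99840 * K ^ 13 * (103 * K ^ 8 * Z * (M * t ^ 6 / U)) := by
  have hK := H.one_le
  have hK0 : 0 < K := by linarith
  have hU := H.U_pos
  have hκ := H.κ_pos
  have hα := H.α_pos
  have ht0 : 0 < t := by linarith
  have hq1 : (1 : ℝ) ≤ q := by exact_mod_cast hq
  have hq0 : (0 : ℝ) < q := by linarith
  set X := t ^ 8 * α / 2 with hX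
  have hX0 : 0 < X := by positivity
  set l := t ^ 8 * q * κ / (64 * K ^ 4 * M ^ 4) with hl
  have hl0 : 0 < l := by positivity
  set P := ({m ∈ dyadicRange M | m + q ∈ dyadicRange M}).map
    ⟨fun m => (m, q), fun a b hab => by simpa using hab⟩ with hP
  have key := H.sum_diffNorm_le (R := t ^ 8) (M := M) (D := q) (by positivity) hM hq0 hUM' hl rfl P
    (A := 32 * M + 12 * M ^ 3 / (X * q)) (B := 2 * X * q / M ^ 2) ?_ (by positivity) (by positivity)
    ?_ hI
  · rw [hP, Finset.sum_map] at key
    refine key.trans ?_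
    gcongr
    refine short_range_bound hK hU H.U_le hM hMt ht hUM hκ H.κ_le hq1 hqt hcase
      (Real.sqrt_pos.2 hl0) (Real.sq_sqrt hl0.le) ?_ ?_ hZ hIZ
    · have := H.α_ge
      have h8 : 0 < t ^ 8 := by positivity
      rw [hX]
      nlinarith
    · have := H.α_le
      have h8 : 0 < t ^ 8 := by positivity
      rw [hX]
      nlinarith
  · intro x hx
    obtain ⟨m, hm, rfl⟩ := Finset.mem_map.1 hx
    obtain ⟨h1, h2⟩ := Finset.mem_filter.1 hm
    exact ⟨h1, h2, le_rfl, (le_mul_of_one_le_left hq0.le one_le_two)⟩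
  · intro s hs _
    refine le_trans ?_ (card_distInt_modelSlope_le hM hX0 hq hs)
    rw [hP, Finset.filter_map, Finset.card_map]
    rfl

set_option maxHeartbeats 1000000 in
theorem sum_diffNorm_dyadic_le (H : PhaseBlock K α σ U₁ U W κ h r r' r'') (hM : 0 < M)
    (hM1 : 1 ≤ 2 * M) (hMt : 2 * M ≤ t ^ 5) (ht : 1 ≤ t) (hUM : t ^ 3 ≤ U * M)
    (hUM' : 1 ≤ U * M ^ 2) (hKt : 256 * K ≤ t ^ 3)
    (hcase : κ * t ^ 10 ≤ U ^ 4) (hcase' : t ^ 4 ≤ U ^ 4 * M) (hZ : 1 ≤ Z) {I : ℕ}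
    (hI : 5 * U * M ^ 2 ≤ 2 ^ I) (hIZ : (I + 1 : ℝ) ≤ Z)
    (hdiv : ∀ n : ℕ, n ≠ 0 → (n : ℝ) ≤ 200 * K ^ 8 * t ^ 32 → (n.divisors.card : ℝ) ≤ Z)
    {D : ℕ} (hD : 1 ≤ D) (hDU : (D : ℝ) ≤ U * M) :
    ∑ q ∈ Finset.Ico D (2 * D),
      ∑ m ∈ dyadicRange M with m + q ∈ dyadicRange M, diffNorm h (t ^ 8) U₁ U m q ≤
      99840 * K ^ 13 * (804 * K ^ 15 * Z ^ 2 * (M ^ 2 * t ^ 6)) := by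
  have hK := H.one_le
  have hK0 : 0 < K := by linarith
  have hU := H.U_pos
  have hUK := H.U_le
  have hκ := H.κ_pos
  have hα := H.α_pos
  have ht0 : 0 < t := by linarith
  have hD1 : (1 : ℝ) ≤ D := by exact_mod_cast hD
  have hD0 : (0 : ℝ) < D := by linarith
  -- Differences inside a dyadic range are below `M`, so for `D > M` the sum is empty.
  rcases lt_or_ge M D with hMD | hDM
  · refine le_trans (le_of_eq ?_) (by positivity : (0 : ℝ) ≤ _)
    refine Finset.sum_eq_zero fun q hq => Finset.sum_eq_zero fun m hm => ?_
    rw [Finset.mem_filter] at hm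
    have h1 := (dyadic_pair_bounds hm.1 hm.2).2.2.2.2
    have h2 : (D : ℝ) ≤ q := by exact_mod_cast (Finset.mem_Ico.1 hq).1
    linarith
  set X := t ^ 8 * α / 2 with hX
  have hX0 : 0 < X := by positivity
  have h8 : 0 < t ^ 8 := by positivity
  have hXl : t ^ 8 ≤ 2 * K * X := by
    have := H.α_ge
    rw [hX]
    nlinarith
  have hXu : 2 * X ≤ K * t ^ 8 := by
    have := H.α_le
    rw [hX]
    nlinarith
  -- The assumption `256 K ≤ t³` serves to make `X` large compared with `D ≤ M ≤ t⁵ / 2`, as the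
  -- counting bound requires.
  have hX5 : 128 * t ^ 5 ≤ X := by
    have : 2 * K * (128 * t ^ 5) ≤ 2 * K * X := by
      calc 2 * K * (128 * t ^ 5) = 256 * K * t ^ 5 := by ring
        _ ≤ t ^ 3 * t ^ 5 := by gcongr
        _ = t ^ 8 := by ring
        _ ≤ _ := hXl
    exact le_of_mul_le_mul_left this (by positivity)
  set l := t ^ 8 * D * κ / (64 * K ^ 4 * M ^ 4) with hl
  have hl0 : 0 < l := by positivity
  set μ := min (5 * U * M ^ 2) (1 / √l) with hμ
  have hs0 : 0 < √l := Real.sqrt_pos.2 hl0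
  have hμ0 : 0 < μ := by rw [hμ]; positivity
  have g2 := (long_range_precision hK hU hUK hM hM1 ht hUM hκ hD1 hDU hcase hs0
    (Real.sq_sqrt hl0.le) hμ).2.1
  set n := ⌈μ / (t ^ 2 * U * D)⌉₊ with hn
  have hn0 : 0 < n := Nat.ceil_pos.2 (by positivity)
  have hn1 : (1 : ℝ) ≤ n := by exact_mod_cast hn0
  have hnl : μ / (t ^ 2 * U * D) ≤ n := Nat.le_ceil _
  have hnu : (n : ℝ) ≤ μ / (t ^ 2 * U * D) + 1 := (Nat.ceil_lt_add_one (by positivity)).le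
  have hn8 : (n : ℝ) ≤ 5 * K ^ 3 * t ^ 8 :=
    denominator_le hK hU hM hMt hD1 ht0 (min_le_left _ _) g2 hnu
  -- Dirichlet's theorem: `1 ≤ b ≤ n` and `|b X - p| ≤ 1 / (n + 1)`.
  obtain ⟨p, b, hb, hbn, hbp⟩ := Real.exists_int_int_abs_mul_sub_le X hn0
  have hbn' : (b : ℝ) ≤ n := by exact_mod_cast hbn
  have hb0 : (0 : ℝ) < b := by exact_mod_cast hb
  have hZ0 : 0 ≤ Z := by linarith
  have hΔ : ∀ T : ℤ, T ≠ 0 → |(T : ℝ)| ≤ 8 * b ^ 2 * X ^ 2 → T.natAbs.divisors.card ≤ ⌊Z⌋₊ := by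
    intro T hT hTb
    refine Nat.le_floor (hdiv _ (Int.natAbs_ne_zero.2 hT) ?_)
    rw [Nat.cast_natAbs, Int.cast_abs]
    exact hTb.trans (discriminant_le hK0 ht0 hX0.le hXu hb0.le (hbn'.trans hn8))
  set Δ : ℝ := (⌊Z⌋₊ : ℝ) with hΔd
  have hΔ0 : 0 ≤ Δ := Nat.cast_nonneg _
  have hΔZ : Δ ≤ Z := Nat.floor_le hZ0
  set P := {x ∈ dyadicRange M ×ˢ Finset.Ico D (2 * D) | x.1 + x.2 ∈ dyadicRange M} with hP
  have hsum : ∑ q ∈ Finset.Ico D (2 * D),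
      ∑ m ∈ dyadicRange M with m + q ∈ dyadicRange M, diffNorm h (t ^ 8) U₁ U m q =
      ∑ x ∈ P, diffNorm h (t ^ 8) U₁ U x.1 x.2 := by
    rw [hP, Finset.sum_filter, Finset.sum_product_right]
    simp only [Finset.sum_filter]
  have hb1 : (1 : ℤ) ≤ b := hb
  have key := H.sum_diffNorm_le (R := t ^ 8) (M := M) (D := D) (by positivity) hM hD0 hUM' hl rfl P
    (A := 12 * M ^ 3 / X + 64 * Δ * X * D * b) (B := 8 * Δ * (X * D / M ^ 2) * (4 * D / n + 1))
    ?_ (by positivity) (by positivity) ?_ hI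
  · rw [hsum]
    refine key.trans ?_
    gcongr
    exact long_range_bound hK hU hUK hM hM1 hMt ht hUM hκ hD1 hDU hcase hcase' hs0
      (Real.sq_sqrt hl0.le) hμ hXl hXu hnl hnu hb0.le hbn' hΔ0 hΔZ hIZ hZ
  · intro x hx
    simp only [hP, Finset.mem_filter, Finset.mem_product, Finset.mem_Ico] at hx
    refine ⟨hx.1.1, hx.2, by exact_mod_cast hx.1.2.1, by exact_mod_cast hx.1.2.2.le⟩
  · intro s hs hs1
    refine card_distInt_modelSlope_block_le hM ?_ hD ?_ hDM hs hs1 hb1 hn1 (hbp.trans ?_) hΔ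
    · have : 1 ≤ t ^ 5 := one_le_pow₀ ht
      linarith
    · linarith
    · gcongr
      linarith

end PhaseBlock
end core
end RevolutionBody

/-! ### The exponential sum on a block: conclusion -/

namespace RevolutionBody

/-- Both contributions become `M⁴ t⁶` up to powers of `K` and `Z`: the diagonal `(U M³)² / Q` by the
choice of `Q`, the rest because the number of `q` cancels the division by `Q`. -/
theorem differencing_bound_short {K U M t Z S Q Y : ℝ} (hK : 1 ≤ K) (hU : 0 < U) (hM : 0 < M)
    (hZ : 1 ≤ Z) (ht : 1 ≤ t) (hQ0 : 0 < Q) (hQ : U ^ 2 * M ^ 2 / t ^ 6 ≤ Q)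
    (hY : Y ≤ Q * (99840 * K ^ 13 * (103 * K ^ 8 * Z * (M * t ^ 6 / U))))
    (hS : S ^ 2 ≤ 24 * K ^ 5 * Z ^ 2 * (U * M ^ 3 / Q) * (15 * (U * M ^ 3) + 2 * Y)) :
    S ≤ 10 ^ 5 * K ^ 17 * Z ^ 3 * (M ^ 2 * t ^ 3) := by
  have hK0 : 0 < K := by linarith
  have hZ0 : 0 < Z := by linarith
  have ht0 : 0 < t := by linarith
  refine le_of_sq_le (by positivity) (hS.trans ?_)
  have hQ' : U ^ 2 * M ^ 2 ≤ Q * t ^ 6 := (div_le_iff₀ (by positivity)).1 hQ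
  set Y₀ := M ^ 4 * t ^ 6 with hY₀
  have hY₀0 : 0 < Y₀ := by positivity
  have e1 : U * M ^ 3 / Q * (15 * (U * M ^ 3)) ≤ 15 * Y₀ := by
    calc U * M ^ 3 / Q * (15 * (U * M ^ 3)) = 15 * M ^ 4 / Q * (U ^ 2 * M ^ 2) := by ring
      _ ≤ 15 * M ^ 4 / Q * (Q * t ^ 6) := by gcongr
      _ = _ := by rw [hY₀]; field_simp
  have e2 : U * M ^ 3 / Q * (2 * Y) ≤ 20567040 * K ^ 21 * Z * Y₀ := by
    calc U * M ^ 3 / Q * (2 * Y) ≤ U * M ^ 3 / Q *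
          (2 * (Q * (99840 * K ^ 13 * (103 * K ^ 8 * Z * (M * t ^ 6 / U))))) := by gcongr
      _ = _ := by rw [hY₀]; field_simp; norm_num
  have hKZ : 1 ≤ K ^ 21 * Z := one_le_mul_of_one_le_of_one_le (one_le_pow₀ hK) hZ
  calc 24 * K ^ 5 * Z ^ 2 * (U * M ^ 3 / Q) * (15 * (U * M ^ 3) + 2 * Y)
      = 24 * K ^ 5 * Z ^ 2 * (U * M ^ 3 / Q * (15 * (U * M ^ 3)) + U * M ^ 3 / Q * (2 * Y)) := by
        ring
    _ ≤ 24 * K ^ 5 * Z ^ 2 * (15 * Y₀ + 20567040 * K ^ 21 * Z * Y₀) := by gcongr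
    _ ≤ 24 * K ^ 5 * Z ^ 2 * (15 * (K ^ 21 * Z * Y₀) + 20567040 * (K ^ 21 * Z * Y₀)) := by
        have : Y₀ ≤ K ^ 21 * Z * Y₀ := le_mul_of_one_le_left hY₀0.le hKZ
        have e : 20567040 * K ^ 21 * Z * Y₀ = 20567040 * (K ^ 21 * Z * Y₀) := by ring
        rw [e]
        gcongr
    _ = 493609320 * (K ^ 26 * Z ^ 3 * Y₀) := by ring
    _ ≤ 10 ^ 10 * (K ^ 34 * Z ^ 6 * Y₀) := by
        gcongr
        · norm_num
        · norm_num
        · norm_num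
    _ = _ := by rw [hY₀]; ring

/-- Here `Q ≥ U M` turns the factor `U M³ / Q` into `M²`, and the diagonal `U M³` is below `K M² t⁶`
since `M ≤ t⁵`. -/
theorem differencing_bound_long {K U M t Z S Q Y : ℝ} (hK : 1 ≤ K) (hU : 0 < U) (hUK : U ≤ K)
    (hM : 0 < M) (hMt : 2 * M ≤ t ^ 5) (hZ : 1 ≤ Z) (ht : 1 ≤ t) (hQ0 : 0 < Q) (hQ : U * M ≤ Q)
    (hY : Y ≤ Z * (99840 * K ^ 13 * (804 * K ^ 15 * Z ^ 2 * (M ^ 2 * t ^ 6))))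
    (hS : S ^ 2 ≤ 24 * K ^ 5 * Z ^ 2 * (U * M ^ 3 / Q) * (15 * (U * M ^ 3) + 2 * Y)) :
    S ≤ 10 ^ 5 * K ^ 17 * Z ^ 3 * (M ^ 2 * t ^ 3) := by
  have hK0 : 0 < K := by linarith
  have hZ0 : 0 < Z := by linarith
  have ht0 : 0 < t := by linarith
  refine le_of_sq_le (by positivity) (hS.trans ?_)
  set Y₀ := M ^ 2 * t ^ 6 with hY₀
  have hY₀0 : 0 < Y₀ := by positivity
  have e0 : U * M ^ 3 / Q ≤ M ^ 2 := by
    rw [div_le_iff₀ hQ0]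
    calc U * M ^ 3 = M ^ 2 * (U * M) := by ring
      _ ≤ _ := by gcongr
  have e1 : U * M ^ 3 ≤ K * Y₀ := by
    have : M ≤ t ^ 6 := by
      have : t ^ 5 ≤ t ^ 6 := pow_le_pow_right₀ ht (by norm_num)
      linarith
    calc U * M ^ 3 = U * M ^ 2 * M := by ring
      _ ≤ K * M ^ 2 * t ^ 6 := by gcongr
      _ = _ := by rw [hY₀]; ring
  have h1 : 1 ≤ K ^ 27 * Z ^ 3 := one_le_mul_of_one_le_of_one_le (one_le_pow₀ hK) (one_le_pow₀ hZ)
  have e2 : K * Y₀ ≤ K ^ 28 * Z ^ 3 * Y₀ := by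
    calc K * Y₀ = 1 * (K * Y₀) := by ring
      _ ≤ K ^ 27 * Z ^ 3 * (K * Y₀) := by gcongr
      _ = _ := by ring
  have e3 : 15 * (U * M ^ 3) + 2 * Y ≤ 160542735 * (K ^ 28 * Z ^ 3 * Y₀) := by
    have : Z * (99840 * K ^ 13 * (804 * K ^ 15 * Z ^ 2 * Y₀)) =
      80271360 * (K ^ 28 * Z ^ 3 * Y₀) := by ring
    linarith
  calc 24 * K ^ 5 * Z ^ 2 * (U * M ^ 3 / Q) * (15 * (U * M ^ 3) + 2 * Y)
      ≤ 24 * K ^ 5 * Z ^ 2 * (U * M ^ 3 / Q) * (160542735 * (K ^ 28 * Z ^ 3 * Y₀)) := by gcongr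
    _ ≤ 24 * K ^ 5 * Z ^ 2 * M ^ 2 * (160542735 * (K ^ 28 * Z ^ 3 * Y₀)) := by gcongr
    _ = 3853025640 * (K ^ 33 * Z ^ 5 * (M ^ 2 * Y₀)) := by ring
    _ ≤ 10 ^ 10 * (K ^ 34 * Z ^ 6 * (M ^ 2 * Y₀)) := by
        gcongr
        · norm_num
        · norm_num
        · norm_num
    _ = _ := by rw [hY₀]; ring

section core

variable {K α σ U₁ U W κ : ℝ} {h : ℝ → ℝ → ℝ} {r r' r'' : ℝ → ℝ} {M t Z : ℝ}

namespace PhaseBlock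

theorem norm_phaseSum_le_of_large (H : PhaseBlock K α σ U₁ U W κ h r r' r'') (hM : 0 < M)
    (hMt : 2 * M ≤ t ^ 5) (ht : 1 ≤ t) (hUM : t ^ 3 ≤ U * M) (hKt : 256 * K ≤ t ^ 3) (hZ : 1 ≤ Z)
    (hr2 : ∀ n : ℕ, n ≠ 0 → (n : ℝ) ≤ 4 * (U₁ + U) * M ^ 2 → (r2 n : ℝ) ≤ Z)
    (hdiv : ∀ n : ℕ, n ≠ 0 → (n : ℝ) ≤ 200 * K ^ 8 * t ^ 32 → (n.divisors.card : ℝ) ≤ Z) :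
    ‖phaseSum h (t ^ 8) U₁ U M‖ ≤ 10 ^ 5 * K ^ 17 * Z ^ 3 * (M ^ 2 * t ^ 3) := by
  have hK := H.one_le
  have hK0 : 0 < K := by linarith
  have hU := H.U_pos
  have hUK := H.U_le
  have ht0 : 0 < t := by linarith
  have hUM0 : 0 < U * M := by positivity
  have hM1 : 1 ≤ M := by
    by_contra hc
    push Not at hc
    nlinarith
  have hM2 : 1 ≤ 2 * M := by linarith
  have hUM1 : 1 ≤ U * M := (one_le_pow₀ ht).trans hUM
  have hUM2 : 1 ≤ U * M ^ 2 := by nlinarith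
  obtain ⟨I, hI, hI'⟩ := exists_nat_pow_near (x := 5 * U * M ^ 2) (y := 2) (by linarith)
    one_lt_two
  -- Logarithmic factors are absorbed in the divisor bound: `2^(I + 1)` has `I + 2` divisors.
  have hIZ : (((I + 1 : ℕ) : ℝ) + 1) ≤ Z := by
    have := hdiv (2 ^ (I + 1)) (by positivity) ?_
    · rw [card_divisors_two_pow] at this
      exact_mod_cast this
    · push_cast
      rw [pow_succ]
      have e4 : M ^ 2 ≤ t ^ 10 / 4 := by nlinarith
      have e5 : U * M ^ 2 ≤ K * (t ^ 10 / 4) := by gcongr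
      have e6 : K * t ^ 10 ≤ K ^ 8 * t ^ 32 := by
        gcongr
        · exact le_self_pow₀ hK (by norm_num)
        · norm_num
      have : 0 < K ^ 8 * t ^ 32 := by positivity
      nlinarith
  have hF : ∀ q, 0 ≤ ∑ m ∈ dyadicRange M with m + q ∈ dyadicRange M,
      diffNorm h (t ^ 8) U₁ U m q :=
    fun q => Finset.sum_nonneg fun m _ => diffNorm_nonneg _ _ _ _ _ _
  have hUMt : U * M ≤ K * t ^ 6 := by
    have : t ^ 5 ≤ t ^ 6 := pow_le_pow_right₀ ht (by norm_num)
    gcongr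
    linarith
  by_cases hcase : U ^ 4 ≤ κ * t ^ 10 ∨ U ^ 4 * M ≤ t ^ 4
  -- Taking `Q = ⌈x⌉` makes the diagonal contribution `(U M³)² / Q` at most `M⁴ t⁶`; each `q` is
  -- then treated separately.
  · set x := U ^ 2 * M ^ 2 / t ^ 6 with hx
    have hx1 : 1 ≤ x := by
      rw [hx, one_le_div (by positivity)]
      calc t ^ 6 = (t ^ 3) ^ 2 := by ring
        _ ≤ (U * M) ^ 2 := by gcongr
        _ = _ := by ring
    have hQ0 : 0 < ⌈x⌉₊ := Nat.ceil_pos.2 (by linarith)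
    have hQl : x ≤ ⌈x⌉₊ := Nat.le_ceil _
    have hQu : (⌈x⌉₊ : ℝ) ≤ 2 * K * U * M := by
      have h1 : (⌈x⌉₊ : ℝ) < x + 1 := Nat.ceil_lt_add_one (by linarith)
      have h2 : x ≤ K * (U * M) := by
        rw [hx, div_le_iff₀ (by positivity)]
        calc U ^ 2 * M ^ 2 = U * M * (U * M) := by ring
          _ ≤ U * M * (K * t ^ 6) := by gcongr
          _ = _ := by ring
      linarith
    refine differencing_bound_short hK hU hM hZ ht (by exact_mod_cast hQ0) hQl ?_
      (H.norm_phaseSum_sq_le hM hQ0 hQu hUM2 hr2)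
    refine (Finset.sum_le_card_nsmul _ _
      (99840 * K ^ 13 * (103 * K ^ 8 * Z * (M * t ^ 6 / U))) fun q hq => ?_).trans ?_
    · rw [Finset.mem_Ico] at hq
      refine H.sum_diffNorm_fixed_le hM hMt ht hUM hUM2 hcase hZ hI'.le hIZ hq.1 ?_
      have := Nat.lt_ceil.1 hq.2
      exact ((le_div_iff₀ (by positivity)).1 this.le)
    · rw [nsmul_eq_mul, Nat.card_Ico]
      gcongr
      exact Nat.sub_le _ _
  · push Not at hcase
    -- Now `Q = ⌈U M⌉`, the largest useful length up to constants, and the differences are grouped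
    -- dyadically.
    have hQ0 : 0 < ⌈U * M⌉₊ := Nat.ceil_pos.2 hUM0
    have hQu : (⌈U * M⌉₊ : ℝ) ≤ 2 * K * U * M := by
      have h1 : (⌈U * M⌉₊ : ℝ) < U * M + 1 := Nat.ceil_lt_add_one hUM0.le
      nlinarith
    refine differencing_bound_long hK hU hUK hM hMt hZ ht (by exact_mod_cast hQ0)
      (Nat.le_ceil _) ?_ (H.norm_phaseSum_sq_le hM hQ0 hQu hUM2 hr2)
    refine (sum_Ico_le_clog_mul hF (I := I + 1) (by positivity) ?_ fun D hD hDU =>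
      H.sum_diffNorm_dyadic_le hM hM2 hMt ht hUM hUM2 hKt hcase.1.le hcase.2.le hZ hI'.le hIZ hdiv
        hD hDU.le).trans ?_
    · refine le_trans ?_ hI'.le
      nlinarith
    · gcongr
      linarith

theorem norm_phaseSum_le (H : PhaseBlock K α σ U₁ U W κ h r r' r'') (hM : 0 < M)
    (hMt : 2 * M ≤ t ^ 5) (ht : 1 ≤ t)
    (hdiv : ∀ n : ℕ, n ≠ 0 → (n : ℝ) ≤ 200 * K ^ 8 * t ^ 32 → 9 * (n.divisors.card : ℝ) ≤ Z) :
    ‖phaseSum h (t ^ 8) U₁ U M‖ ≤ 10 ^ 5 * K ^ 17 * Z ^ 3 * (M ^ 2 * t ^ 3) := by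
  have hK := H.one_le
  have hK0 : 0 < K := by linarith
  have hU := H.U_pos
  have hUK := H.U_le
  have ht0 : 0 < t := by linarith
  have hKt1 : 1 ≤ K ^ 8 * t ^ 32 := one_le_mul_of_one_le_of_one_le (one_le_pow₀ hK) (one_le_pow₀ ht)
  have hZ9 : 9 ≤ Z := by
    have := hdiv 1 one_ne_zero (by push_cast; linarith)
    simpa using this
  have hZ1 : 1 ≤ Z := by linarith
  have hZ0 : 0 < Z := by linarith
  have hr2 : ∀ n : ℕ, n ≠ 0 → (n : ℝ) ≤ 4 * (U₁ + U) * M ^ 2 → (r2 n : ℝ) ≤ Z := by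
    intro n hn hnu
    have h1 : (r2 n : ℝ) ≤ 9 * n.divisors.card := by exact_mod_cast r2_le_card_divisors hn
    refine h1.trans (hdiv n hn (hnu.trans ?_))
    have e4 : M ^ 2 ≤ t ^ 10 / 4 := by nlinarith
    have hadd := H.add_le
    have hU1 := H.U₁_pos
    calc 4 * (U₁ + U) * M ^ 2 ≤ 4 * K ^ 4 * (t ^ 10 / 4) := by gcongr
      _ = 1 * K ^ 4 * t ^ 10 := by ring
      _ ≤ _ := by
          gcongr
          · norm_num
          · norm_num
          · norm_num
  rcases (dyadicRange M).eq_empty_or_nonempty with hemp | ⟨m, hm⟩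
  · rw [phaseSum, hemp, Finset.sum_empty, norm_zero]
    positivity
  have hM1 := half_le_of_mem_dyadicRange hM hm
  by_cases hlarge : t ^ 3 ≤ U * M ∧ 256 * K ≤ t ^ 3
  · refine H.norm_phaseSum_le_of_large hM hMt ht hlarge.1 hlarge.2 hZ1 hr2 fun n hn hnu => ?_
    have := hdiv n hn hnu
    have : (0 : ℝ) ≤ n.divisors.card := Nat.cast_nonneg _
    linarith
  -- Outside the main range the trivial bound `M (U M² + 1)` is of size `M² t³`; `M > 1/2` takes
  -- care of the term `M`.
  · have hUM : U * M ≤ 256 * K ^ 2 * t ^ 3 := by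
      rw [not_and_or, not_le, not_le] at hlarge
      have hK2 : 1 ≤ K ^ 2 := one_le_pow₀ hK
      have ht3 : 0 < t ^ 3 := by positivity
      rcases hlarge with h1 | h1
      · nlinarith
      · have : t ^ 2 ≤ t ^ 3 := pow_le_pow_right₀ ht (by norm_num)
        calc U * M ≤ K * t ^ 5 := by
              gcongr
              linarith
          _ = K * t ^ 2 * t ^ 3 := by ring
          _ ≤ K * (256 * K) * t ^ 3 := by
              gcongr
              linarith
          _ = _ := by ring
    have hU1 := H.U₁_pos
    refine (norm_phaseSum_le_trivial hM hU1 hU.le hZ0.le hr2).trans ?_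
    have hY : M ≤ 2 * (K ^ 2 * t ^ 3 * M ^ 2) := by
      have : 1 ≤ K ^ 2 * t ^ 3 :=
        one_le_mul_of_one_le_of_one_le (one_le_pow₀ hK) (one_le_pow₀ ht)
      nlinarith
    calc 3 * M * ((4 * U * M ^ 2 + 1) * Z) = 3 * Z * (4 * M ^ 2 * (U * M) + M) := by ring
      _ ≤ 3 * Z * (4 * M ^ 2 * (256 * K ^ 2 * t ^ 3) + 2 * (K ^ 2 * t ^ 3 * M ^ 2)) := by gcongr
      _ = 3078 * K ^ 2 * Z * (M ^ 2 * t ^ 3) := by ring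
      _ ≤ _ := by
          gcongr
          · norm_num
          · norm_num
          · exact le_self_pow₀ hZ1 (by norm_num)

end PhaseBlock

/-- Exponential sums over blocks are uniformly bounded. -/
theorem exists_norm_phaseSum_le {K ε : ℝ} (hK : 1 ≤ K) (hε : 0 < ε) : ∃ C : ℝ, 0 ≤ C ∧
    ∀ (α σ U₁ U W κ : ℝ) (h : ℝ → ℝ → ℝ) (r r' r'' : ℝ → ℝ),
      PhaseBlock K α σ U₁ U W κ h r r' r'' → ∀ R M : ℝ, 1 < R → 0 < M →
        2 * M ≤ R ^ (5 / 8 : ℝ) → ‖phaseSum h R U₁ U M‖ ≤ C * (M ^ 2 * R ^ (3 / 8 + ε)) := by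
  -- The integers involved reach `t³² = R⁴` up to constants and the bound enters cubed, whence `4 ·
  -- 3 · (ε / 12) = ε`.
  obtain ⟨C, hC1, hC⟩ := exists_card_divisors_le_rpow (ε := ε / 12) (by positivity)
  have hC0 : 0 ≤ C := by linarith
  have hK0 : 0 < K := by linarith
  refine ⟨10 ^ 5 * K ^ 17 * (9 * (C * (200 * K ^ 8) ^ (ε / 12))) ^ 3, by positivity, ?_⟩
  intro α σ U₁ U W κ h r r' r'' H R M hR hM hMR
  have hR0 : 0 < R := by linarith
  set t := R ^ (1 / 8 : ℝ) with ht
  have ht1 : 1 ≤ t := Real.one_le_rpow hR.le (by norm_num)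
  have htn : ∀ n : ℕ, t ^ n = R ^ ((n : ℝ) / 8) := by
    intro n
    rw [ht, ← Real.rpow_natCast, ← Real.rpow_mul hR0.le]
    congr 1
    ring
  have h8 : t ^ 8 = R := by rw [htn]; norm_num
  have h5 : t ^ 5 = R ^ (5 / 8 : ℝ) := by rw [htn]; norm_num
  have h3 : t ^ 3 = R ^ (3 / 8 : ℝ) := by rw [htn]; norm_num
  have h32 : t ^ 32 = R ^ 4 := by rw [← h8]; ring
  have key := H.norm_phaseSum_le (t := t) (Z := 9 * (C * (200 * K ^ 8) ^ (ε / 12) * R ^ (ε / 3)))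
    hM (by rw [h5]; exact hMR) ht1 ?_
  · rw [h8, h3] at key
    refine key.trans (le_of_eq ?_)
    have e1 : (R ^ (ε / 3)) ^ 3 = R ^ ε := by
      rw [← Real.rpow_natCast, ← Real.rpow_mul hR0.le]
      congr 1
      push_cast
      ring
    rw [Real.rpow_add hR0, ← e1]
    ring
  · intro n hn hnu
    rw [h32] at hnu
    refine mul_le_mul_of_nonneg_left ((hC n hn).trans ?_) (by norm_num)
    have : (n : ℝ) ^ (ε / 12) ≤ (200 * K ^ 8 * R ^ 4) ^ (ε / 12) := by gcongr
    rw [Real.mul_rpow (by positivity) (by positivity), ← Real.rpow_natCast R,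
      ← Real.rpow_mul hR0.le] at this
    have e1 : ((4 : ℕ) : ℝ) * (ε / 12) = ε / 3 := by push_cast; ring
    rw [e1] at this
    calc C * (n : ℝ) ^ (ε / 12) ≤ C * ((200 * K ^ 8) ^ (ε / 12) * R ^ (ε / 3)) := by gcongr
      _ = _ := by ring

end core
end RevolutionBody

/-! ### The profile curve of a body of revolution -/

namespace RevolutionBody

open Filter Topology

/-- The `i`-th vector of the standard basis. -/
noncomputable def axis (i : Fin 3) : E3 := EuclideanSpace.single i 1

/-- The plane `y = 0`. -/
noncomputable def meridian : ℝ × ℝ →L[ℝ] E3 :=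
  (ContinuousLinearMap.fst ℝ ℝ ℝ).smulRight (axis 0) +
    (ContinuousLinearMap.snd ℝ ℝ ℝ).smulRight (axis 2)

theorem meridian_apply (a z : ℝ) : meridian (a, z) = a • axis 0 + z • axis 2 := rfl

theorem meridian_zero (a z : ℝ) : meridian (a, z) 0 = a := by simp [meridian_apply, axis]

theorem meridian_one (a z : ℝ) : meridian (a, z) 1 = 0 := by simp [meridian_apply, axis]

theorem meridian_two (a z : ℝ) : meridian (a, z) 2 = z := by simp [meridian_apply, axis]

theorem eq_sum_axis (p : E3) : p = p 0 • axis 0 + p 1 • axis 1 + p 2 • axis 2 := by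
  ext i
  fin_cases i <;> simp [axis]

section body

variable {E : Set E3} {f₁ f₂ : ℝ → ℝ} {ρ : ℝ}

namespace IsBodyOfRevolution

theorem mem_iff (h : IsBodyOfRevolution E f₁ f₂ ρ) (p : E3) :
    p ∈ E ↔ √(p 0 ^ 2 + p 1 ^ 2) ≤ ρ ∧ f₂ √(p 0 ^ 2 + p 1 ^ 2) ≤ p 2 ∧
      p 2 ≤ f₁ √(p 0 ^ 2 + p 1 ^ 2) := by
  conv_lhs => rw [h.eq]
  rfl

theorem meridian_mem_iff (h : IsBodyOfRevolution E f₁ f₂ ρ) (a z : ℝ) :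
    meridian (a, z) ∈ E ↔ |a| ≤ ρ ∧ f₂ |a| ≤ z ∧ z ≤ f₁ |a| := by
  rw [h.mem_iff, meridian_zero, meridian_one, meridian_two]
  simp [Real.sqrt_sq_eq_abs]

theorem top_mem (h : IsBodyOfRevolution E f₁ f₂ ρ) {a : ℝ} (ha : |a| ≤ ρ) :
    meridian (a, f₁ |a|) ∈ E :=
  (h.meridian_mem_iff _ _).2 ⟨ha, h.le _ ⟨abs_nonneg a, ha⟩, le_rfl⟩

theorem pos (h : IsBodyOfRevolution E f₁ f₂ ρ) (hE : (interior E).Nonempty) : 0 < ρ := by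
  obtain ⟨p, hp⟩ := hE
  have hcont : Continuous fun t : ℝ => p + t • axis 0 := by fun_prop
  have h0 : ∀ᶠ t : ℝ in 𝓝 0, p + t • axis 0 ∈ interior E :=
    hcont.continuousAt.eventually (by simpa using isOpen_interior.mem_nhds hp)
  obtain ⟨δ, hδ, hball⟩ := Metric.eventually_nhds_iff.1 h0
  have hmem : ∀ t : ℝ, |t| < δ → |p 0 + t| ≤ ρ := by
    intro t ht
    have h1 := ((h.mem_iff _).1 (interior_subset (hball (y := t) (by simpa using ht)))).1
    refine le_trans ?_ h1
    have : (p + t • axis 0) 0 = p 0 + t := by simp [axis]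
    rw [this]
    exact Real.abs_le_sqrt (by nlinarith [sq_nonneg ((p + t • axis 0) 1)])
  have h1 := abs_le.1 (hmem (δ / 2) (by rw [abs_of_pos (by linarith)]; linarith))
  have h2 := abs_le.1 (hmem (-(δ / 2)) (by rw [abs_neg, abs_of_pos (by linarith)]; linarith))
  linarith [h1.2, h2.1]

/-- The function is the upper boundary of the section of the convex body by the plane `y = 0`. -/
theorem concaveOn (h : IsBodyOfRevolution E f₁ f₂ ρ) (hE : Convex ℝ E) :
    ConcaveOn ℝ (Set.Icc (-ρ) ρ) fun x => f₁ |x| := by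
  refine ⟨convex_Icc _ _, fun x hx y hy a b ha hb hab => ?_⟩
  have h1 := hE (h.top_mem (abs_le.2 hx)) (h.top_mem (abs_le.2 hy)) ha hb hab
  rw [← map_smul, ← map_smul, ← map_add] at h1
  exact ((h.meridian_mem_iff _ _).1 h1).2.2

theorem top_mem_frontier (h : IsBodyOfRevolution E f₁ f₂ ρ) {a : ℝ} (ha : |a| ≤ ρ) :
    meridian (a, f₁ |a|) ∈ frontier E := by
  refine ⟨subset_closure (h.top_mem ha), fun hint => ?_⟩
  have hcont : Continuous fun t : ℝ => meridian (a, f₁ |a| + t) := by fun_prop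
  have h0 : ∀ᶠ t : ℝ in 𝓝 0, meridian (a, f₁ |a| + t) ∈ interior E :=
    hcont.continuousAt.eventually (by simpa using isOpen_interior.mem_nhds hint)
  obtain ⟨δ, hδ, hball⟩ := Metric.eventually_nhds_iff.1 h0
  have h1 := interior_subset
    (hball (y := δ / 2) (by rw [Real.dist_0_eq_abs, abs_of_pos (by linarith)]; linarith))
  have h2 := ((h.meridian_mem_iff _ _).1 h1).2.2
  linarith

end IsBodyOfRevolution

/-! ### Supporting functionals and normals of the boundary. -/

theorem exists_support_functional (hE : IsSmoothConvexBody E) {p : E3} (hp : p ∈ frontier E) :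
    ∃ ℓ : StrongDual ℝ E3, ℓ ≠ 0 ∧ ∀ x ∈ E, ℓ x ≤ ℓ p := by
  obtain ⟨ℓ, hℓ⟩ := geometric_hahn_banach_open_point hE.convex.interior isOpen_interior hp.2
  refine ⟨ℓ, ?_, fun x hx => ?_⟩
  · rintro rfl
    obtain ⟨q, hq⟩ := hE.interior_nonempty
    simpa using hℓ q hq
  · have h1 : x ∈ closure (interior E) := by
      rw [hE.convex.closure_interior_eq_closure_of_nonempty_interior hE.interior_nonempty]
      exact subset_closure hx
    exact closure_minimal (fun y hy => (hℓ y hy).le) (isClosed_le ℓ.continuous continuous_const) h1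

theorem contDiffAt_of_contDiffOn_open {Φ : E3 → ℝ} {V : Set E3} {p : E3} (hV : IsOpen V)
    (hp : p ∈ V) (h : ContDiffOn ℝ ∞ Φ V) : ContDiffAt ℝ ∞ Φ p :=
  h.contDiffAt (hV.mem_nhds hp)

/-- A supporting functional is a multiple of the differential of a defining function. -/
theorem exists_eq_smul_fderiv (hE : IsSmoothConvexBody E) {p : E3} {V : Set E3} {Φ : E3 → ℝ}
    (hV : IsOpen V) (hpV : p ∈ V) (hΦ : ContDiffOn ℝ ∞ Φ V)
    (hlevel : frontier E ∩ V = {x ∈ V | Φ x = 0}) (hd : fderiv ℝ Φ p ≠ 0) (hp : p ∈ frontier E)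
    {ℓ : StrongDual ℝ E3} (hmax : ∀ x ∈ E, ℓ x ≤ ℓ p) : ∃ c : ℝ, ℓ = c • fderiv ℝ Φ p := by
  have hp0 : Φ p = 0 := (hlevel ▸ (⟨hp, hpV⟩ : p ∈ frontier E ∩ V) : p ∈ {x ∈ V | Φ x = 0}).2
  -- Near `p` the level set of `Φ` is the boundary, on which `ℓ` is largest at `p`; Lagrange
  -- multipliers apply.
  have hext : IsLocalExtrOn ℓ {x | Φ x = Φ p} p := by
    refine Or.inr ?_
    have : ∀ᶠ x in 𝓝[{x | Φ x = Φ p}] p, x ∈ V ∧ Φ x = Φ p :=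
      Filter.Eventually.and (mem_nhdsWithin_of_mem_nhds (hV.mem_nhds hpV)) self_mem_nhdsWithin
    filter_upwards [this] with x hx
    have hx' : x ∈ frontier E ∩ V := by
      rw [hlevel]
      exact ⟨hx.1, hx.2.trans hp0⟩
    exact hmax x (hE.isCompact.isClosed.frontier_subset hx'.1)
  have hs : HasStrictFDerivAt Φ (fderiv ℝ Φ p) p :=
    (contDiffAt_of_contDiffOn_open hV hpV hΦ).hasStrictFDerivAt (by simp)
  obtain ⟨a, b, hab, h0⟩ := hext.exists_multipliers_of_hasStrictFDerivAt_1d hs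
    ℓ.hasStrictFDerivAt
  have hb : b ≠ 0 := by
    rintro rfl
    rw [zero_smul, add_zero, smul_eq_zero] at h0
    rcases h0 with h0 | h0
    · exact hab (by rw [h0]; rfl)
    · exact hd h0
  refine ⟨-(a / b), ?_⟩
  have h2 : b • ℓ = -(a • fderiv ℝ Φ p) := eq_neg_of_add_eq_zero_right h0
  calc ℓ = b⁻¹ • (b • ℓ) := by rw [smul_smul, inv_mul_cancel₀ hb, one_smul]
    _ = _ := by rw [h2, smul_neg, smul_smul, neg_smul, div_eq_inv_mul]

/-- The boundary is not vertical above the interior of the projection. -/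
theorem support_axis_ne_zero (h : IsBodyOfRevolution E f₁ f₂ ρ) {x : ℝ} (hx : |x| < ρ)
    {ℓ : StrongDual ℝ E3} (hℓ : ℓ ≠ 0) (hmax : ∀ q ∈ E, ℓ q ≤ ℓ (meridian (x, f₁ |x|))) :
    ℓ (axis 2) ≠ 0 := by
  intro h2
  refine hℓ ?_
  set A := ℓ (axis 0) with hA
  set B := ℓ (axis 1) with hB
  have hval : ∀ p : E3, ℓ p = p 0 * A + p 1 * B := by
    intro p
    conv_lhs => rw [eq_sum_axis p]
    simp [h2, hA, hB]
  -- A horizontal functional could be increased: a small move in the direction `(A, B)` stays over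
  -- the open disc of radius `ρ`, hence under some point of the upper boundary, and raises `ℓ` by `δ
  -- / 2 * (A² + B²)`.
  have hcont : Continuous fun t : ℝ => √((x + t * A) ^ 2 + (t * B) ^ 2) := by fun_prop
  have h0 : ∀ᶠ t : ℝ in 𝓝 0, √((x + t * A) ^ 2 + (t * B) ^ 2) < ρ := by
    refine hcont.continuousAt.eventually (Iio_mem_nhds ?_)
    simpa [Real.sqrt_sq_eq_abs] using hx
  obtain ⟨δ, hδ, hball⟩ := Metric.eventually_nhds_iff.1 h0
  have h1 := hball (y := δ / 2)
    (by rw [Real.dist_0_eq_abs, abs_of_pos (by linarith)]; linarith)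
  set s := √((x + δ / 2 * A) ^ 2 + (δ / 2 * B) ^ 2) with hs
  have hq : (!₂[x + δ / 2 * A, δ / 2 * B, f₁ s] : E3) ∈ E := by
    rw [h.mem_iff]
    simp only [Matrix.cons_val_zero, Matrix.cons_val_one, Matrix.cons_val]
    rw [← hs]
    exact ⟨h1.le, h.le _ ⟨Real.sqrt_nonneg _, h1.le⟩, le_rfl⟩
  have h3 := hmax _ hq
  rw [hval, hval, meridian_zero, meridian_one] at h3
  simp only [Matrix.cons_val_zero, Matrix.cons_val_one] at h3
  have h4 : A ^ 2 + B ^ 2 ≤ 0 := by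
    by_contra hc
    push Not at hc
    nlinarith
  have hA0 : A = 0 := by nlinarith [sq_nonneg A, sq_nonneg B]
  have hB0 : B = 0 := by nlinarith [sq_nonneg A, sq_nonneg B]
  ext p
  rw [hval, hA0, hB0]
  simp

end body
end RevolutionBody

/-! ### Smoothness and strict concavity of the profile -/

namespace RevolutionBody

open Filter Topology

theorem _root_.ContDiffAt.deriv_infty {F : ℝ → ℝ} {x : ℝ} (hF : ContDiffAt ℝ ∞ F x) :
    ContDiffAt ℝ ∞ (deriv F) x :=
  (hF.fderiv_right (m := ∞) le_rfl).clm_apply (contDiffAt_const (c := (1 : ℝ)))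

/-- The implicit function theorem; continuity of `F` puts its graph on the implicit branch. -/
theorem contDiffAt_of_level {Ψ : ℝ × ℝ → ℝ} {F : ℝ → ℝ} {x : ℝ} (hΨ : ContDiffAt ℝ ∞ Ψ (x, F x))
    (hd : fderiv ℝ Ψ (x, F x) (0, 1) ≠ 0) (hF : ContinuousAt F x)
    (h0 : ∀ᶠ a in 𝓝 x, Ψ (a, F a) = Ψ (x, F x)) : ContDiffAt ℝ ∞ F x := by
  have hinv : (fderiv ℝ Ψ (x, F x) ∘L ContinuousLinearMap.inr ℝ ℝ ℝ).IsInvertible := by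
    refine ⟨ContinuousLinearEquiv.unitsEquivAut ℝ (Units.mk0 _ hd), ?_⟩
    ext
    simp
  have h1 := hΨ.eventually_apply_eq_iff_implicitFunction (by simp) hinv
  have hγ : Tendsto (fun a => (a, F a)) (𝓝 x) (𝓝 (x, F x)) :=
    (continuousAt_id.prodMk hF : ContinuousAt (fun a => (a, F a)) x)
  refine (hΨ.contDiffAt_implicitFunction (by simp) hinv).congr_of_eventuallyEq ?_
  filter_upwards [hγ.eventually h1, h0] with a ha ha'
  exact (ha.1 ha').symm

/-- A plane curve in a surface, as a graph, has non-zero second derivative where the surface has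
positive curvature. -/
theorem deriv_deriv_ne_zero_of_curvature {Φ : E3 → ℝ} {F : ℝ → ℝ} {x : ℝ}
    (hΦ : ContDiffAt ℝ ∞ Φ (meridian (x, F x))) (hF : ContDiffAt ℝ ∞ F x)
    (h0 : ∀ᶠ a in 𝓝 x, Φ (meridian (a, F a)) = 0)
    (hd : fderiv ℝ Φ (meridian (x, F x)) (axis 2) ≠ 0)
    (hcurv : ∀ v w : E3, LinearIndependent ℝ ![v, w] → fderiv ℝ Φ (meridian (x, F x)) v = 0 →
      fderiv ℝ Φ (meridian (x, F x)) w = 0 → 0 < gaussianCurvature Φ (meridian (x, F x)) v w) :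
    deriv (deriv F) x ≠ 0 := by
  intro hF2
  set p := meridian (x, F x) with hp
  set γ : ℝ → E3 := fun a => meridian (a, F a) with hγ
  set γ' : ℝ → E3 := fun a => meridian (1, deriv F a) with hγ'
  have hFev : ∀ᶠ a in 𝓝 x, HasDerivAt F (deriv F a) a := by
    have := (hF.of_le (m := 1) (by simp)).eventually (by simp)
    filter_upwards [this] with a ha
    exact (ha.differentiableAt (by simp)).hasDerivAt
  have hγd : ∀ᶠ a in 𝓝 x, HasDerivAt γ (γ' a) a := by
    filter_upwards [hFev] with a ha
    exact (meridian.hasFDerivAt.comp_hasDerivAt a ((hasDerivAt_id a).prodMk ha) :)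
  have hγc : ContinuousAt γ x := hγd.self_of_nhds.continuousAt
  have hΦev : ∀ᶠ q in 𝓝 p, HasFDerivAt Φ (fderiv ℝ Φ q) q := by
    have := (hΦ.of_le (m := 1) (by simp)).eventually (by simp)
    filter_upwards [this] with q hq
    exact (hq.differentiableAt (by simp)).hasFDerivAt
  have htan : ∀ᶠ a in 𝓝 x, fderiv ℝ Φ (γ a) (γ' a) = 0 := by
    filter_upwards [hγd, hγc.eventually hΦev, h0.eventually_nhds] with a h1 h2 h3
    have h4 : HasDerivAt (fun b => Φ (γ b)) (fderiv ℝ Φ (γ a) (γ' a)) a := h2.comp_hasDerivAt a h1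
    exact h4.unique ((hasDerivAt_const a (0 : ℝ)).congr_of_eventuallyEq h3)
  have hF' : HasDerivAt (deriv F) 0 x := by
    have := (hF.deriv_infty.differentiableAt (by simp)).hasDerivAt
    rwa [hF2] at this
  have hγ2 : HasDerivAt γ' 0 x := by
    have h1 : HasDerivAt (fun a => ((1 : ℝ), deriv F a)) (0, 0) x :=
      (hasDerivAt_const x (1 : ℝ)).prodMk hF'
    have h2 := meridian.hasFDerivAt.comp_hasDerivAt x h1
    rw [show ((0 : ℝ), (0 : ℝ)) = 0 from rfl, map_zero] at h2
    exact h2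
  have hD2 : HasFDerivAt (fderiv ℝ Φ) (fderiv ℝ (fderiv ℝ Φ) p) p :=
    ((hΦ.fderiv_right (m := ∞) le_rfl).differentiableAt (by simp)).hasFDerivAt
  have h2 : HasDerivAt (fun a => fderiv ℝ Φ (γ a)) (fderiv ℝ (fderiv ℝ Φ) p (γ' x)) x :=
    HasFDerivAt.comp_hasDerivAt x hD2 hγd.self_of_nhds
  have h3 := h2.clm_apply hγ2
  -- Differentiate `dΦ(γ)(γ') = 0`; the term with `γ''` drops because `F''(x) = 0`. The form then
  -- vanishes on the tangent vector `v`, and the numerator of the curvature is minus a square.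
  have h4 : fderiv ℝ (fderiv ℝ Φ) p (γ' x) (γ' x) = 0 := by
    have := h3.unique ((hasDerivAt_const x (0 : ℝ)).congr_of_eventuallyEq htan)
    simpa using this
  set v := γ' x with hv
  set w := axis 1 - (fderiv ℝ Φ p (axis 1) / fderiv ℝ Φ p (axis 2)) • axis 2 with hw
  have hv0 : v 0 = 1 := meridian_zero _ _
  have hv1 : v 1 = 0 := meridian_one _ _
  have hw0 : w 0 = 0 := by simp [hw, axis]
  have hw1 : w 1 = 1 := by simp [hw, axis]
  have hli : LinearIndependent ℝ ![v, w] := by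
    rw [LinearIndependent.pair_iff]
    intro s t hst
    have e0 := congrArg (fun q : E3 => q 0) hst
    have e1 := congrArg (fun q : E3 => q 1) hst
    simp only [PiLp.add_apply, PiLp.smul_apply, hv0, hv1, hw0, hw1, smul_eq_mul,
      PiLp.zero_apply] at e0 e1
    constructor <;> linarith
  have hDw : fderiv ℝ Φ p w = 0 := by
    rw [hw, map_sub, map_smul, smul_eq_mul, div_mul_cancel₀ _ hd, sub_self]
  have hpos := hcurv v w hli htan.self_of_nhds hDw
  unfold gaussianCurvature secondForm at hpos
  rw [h4] at hpos
  refine absurd hpos (not_lt.2 (div_nonpos_of_nonpos_of_nonneg ?_ ?_))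
  · rw [zero_div, zero_mul, zero_sub]
    exact neg_nonpos.2 (sq_nonneg _)
  · have := real_inner_mul_inner_self_le v w
    rw [sq]
    linarith

/-- The upper profile of a body of revolution, extended to an even function. -/
structure IsProfile (E : Set E3) (F : ℝ → ℝ) (ρ : ℝ) : Prop where
  pos : 0 < ρ
  contDiffAt : ∀ x ∈ Set.Ioo (-ρ) ρ, ContDiffAt ℝ ∞ F x
  deriv_deriv_neg : ∀ x ∈ Set.Ioo (-ρ) ρ, deriv (deriv F) x < 0
  deriv_zero : deriv F 0 = 0
  mem : ∀ x ∈ Set.Ico 0 ρ, meridian (x, F x) ∈ E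
  le_tangent : ∀ p ∈ E, ∀ x ∈ Set.Ico 0 ρ, ∃ y, p 0 ≤ y ∧ p 2 ≤ F x + deriv F x * (y - x)

variable {E : Set E3} {f₁ f₂ : ℝ → ℝ} {ρ : ℝ}

/-- A supporting functional at a boundary point above the open disc is a multiple of `dΦ` and is not
horizontal, so the boundary is a smooth graph there, even across the axis. Curvature gives `F'' ≠
0`, concavity its sign, evenness `F'(0) = 0`. Tangents lie above the graph, at the distance `y` of a
point from the axis. -/
theorem isProfile_of_isBodyOfRevolution (hE : IsSmoothConvexBody E)
    (h : IsBodyOfRevolution E f₁ f₂ ρ) : IsProfile E (fun x => f₁ |x|) ρ := by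
  have hρ := h.pos hE.interior_nonempty
  set F : ℝ → ℝ := fun x => f₁ |x| with hF
  have hconc : ConcaveOn ℝ (Set.Icc (-ρ) ρ) F := h.concaveOn hE.convex
  have hconc' : ConcaveOn ℝ (Set.Ioo (-ρ) ρ) F :=
    hconc.subset Set.Ioo_subset_Icc_self (convex_Ioo _ _)
  have key : ∀ x ∈ Set.Ioo (-ρ) ρ, ContDiffAt ℝ ∞ F x ∧ deriv (deriv F) x ≠ 0 := by
    intro x hx
    have hxρ : |x| < ρ := abs_lt.2 hx
    have hcont : ContinuousAt F x :=
      (hconc'.continuousOn isOpen_Ioo).continuousAt (isOpen_Ioo.mem_nhds hx)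
    have hp := h.top_mem_frontier hxρ.le
    obtain ⟨V, hV, hpV, Φ, hΦ, hlevel, hd, hcurv⟩ := hE.boundary _ hp
    obtain ⟨ℓ, hℓ0, hℓ⟩ := exists_support_functional hE hp
    obtain ⟨c, hc⟩ := exists_eq_smul_fderiv hE hV hpV hΦ hlevel hd hp hℓ
    have h2 := support_axis_ne_zero h hxρ hℓ0 hℓ
    have hd2 : fderiv ℝ Φ (meridian (x, F x)) (axis 2) ≠ 0 := by
      intro h0
      refine h2 ?_
      rw [hc, smul_apply]
      exact (congrArg (c • ·) h0).trans (smul_zero c)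
    have hΦp : ContDiffAt ℝ ∞ Φ (meridian (x, F x)) := contDiffAt_of_contDiffOn_open hV hpV hΦ
    have hγ : ContinuousAt (fun a => meridian (a, F a)) x :=
      meridian.continuous.continuousAt.comp (continuousAt_id.prodMk hcont)
    have h0 : ∀ᶠ a in 𝓝 x, Φ (meridian (a, F a)) = 0 := by
      filter_upwards [hγ.eventually (hV.mem_nhds hpV), isOpen_Ioo.mem_nhds hx] with a ha1 ha2
      have : meridian (a, F a) ∈ frontier E ∩ V := ⟨h.top_mem_frontier (abs_lt.2 ha2).le, ha1⟩
      rw [hlevel] at this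
      exact this.2
    have hFsm : ContDiffAt ℝ ∞ F x := by
      refine contDiffAt_of_level (Ψ := fun u => Φ (meridian u))
        (hΦp.comp (x, F x) meridian.contDiff.contDiffAt) ?_ hcont ?_
      · have h1 : HasFDerivAt (fun u => Φ (meridian u))
            ((fderiv ℝ Φ (meridian (x, F x))).comp meridian) (x, F x) :=
          (hΦp.differentiableAt (by simp)).hasFDerivAt.comp _ meridian.hasFDerivAt
        rw [h1.fderiv, ContinuousLinearMap.comp_apply, meridian_apply 0 1, zero_smul, one_smul,
          zero_add]
        exact hd2
      · filter_upwards [h0] with a ha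
        rw [ha, h0.self_of_nhds]
    exact ⟨hFsm, deriv_deriv_ne_zero_of_curvature hΦp hFsm h0 hd2 hcurv⟩
  have hdiff : ∀ x ∈ Set.Ioo (-ρ) ρ, DifferentiableAt ℝ F x := fun x hx =>
    (key x hx).1.differentiableAt (by simp)
  refine ⟨hρ, fun x hx => (key x hx).1, fun x hx => ?_, ?_, fun x hx => ?_, fun p hp x hx => ?_⟩
  · refine lt_of_le_of_ne ?_ (key x hx).2
    have hanti := hconc'.antitoneOn_deriv hdiff
    have h1 := hanti.derivWithin_nonpos (x := x)
    rwa [derivWithin_of_isOpen isOpen_Ioo hx] at h1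
  · have h1 : deriv (fun x => F (-x)) 0 = -deriv F (-0) := deriv_comp_neg F 0
    have h2 : (fun x => F (-x)) = F := by
      funext x
      simp [hF]
    rw [h2, neg_zero] at h1
    linarith
  · exact h.top_mem (by rw [abs_of_nonneg hx.1]; exact hx.2.le)
  · obtain ⟨h1, -, h3⟩ := (h.mem_iff p).1 hp
    set y := √(p 0 ^ 2 + p 1 ^ 2) with hy
    have hy0 : 0 ≤ y := Real.sqrt_nonneg _
    refine ⟨y, Real.le_sqrt_of_sq_le (by nlinarith [sq_nonneg (p 1)]), ?_⟩
    have hx' : x ∈ Set.Ioo (-ρ) ρ := ⟨by linarith [hx.1], hx.2⟩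
    have hxI : x ∈ Set.Icc (-ρ) ρ := Set.Ioo_subset_Icc_self hx'
    have hyI : y ∈ Set.Icc (-ρ) ρ := ⟨by linarith, h1⟩
    have hFy : F y = f₁ y := by rw [hF]; simp only [abs_of_nonneg hy0]
    rw [← hFy] at h3
    refine h3.trans ?_
    rcases lt_trichotomy x y with hlt | heq | hgt
    · have := hconc.slope_le_deriv hxI hyI hlt (hdiff x hx')
      rw [slope_def_field, div_le_iff₀ (by linarith)] at this
      linarith
    · rw [heq]; simp
    · have := hconc.deriv_le_slope hyI hxI hgt (hdiff x hx')
      rw [slope_def_field, le_div_iff₀ (by linarith)] at this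
      linarith

end RevolutionBody

/-! ### The phase in terms of the profile -/

namespace RevolutionBody

open Filter Topology

/-- The inverse of `-F'`. -/
noncomputable def slopeInv (F : ℝ → ℝ) (ρ : ℝ) : ℝ → ℝ :=
  Function.invFunOn (fun x => -deriv F x) (Set.Ioo (-ρ) ρ)

/-- The derivative of the inverse of `-F'`. -/
noncomputable def slopeInv' (F : ℝ → ℝ) (ρ v : ℝ) : ℝ := (-deriv (deriv F) (slopeInv F ρ v))⁻¹

/-- The second derivative of the inverse of `-F'`. -/
noncomputable def slopeInv'' (F : ℝ → ℝ) (ρ v : ℝ) : ℝ :=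
  deriv (deriv (deriv F)) (slopeInv F ρ v) * slopeInv' F ρ v ^ 3

namespace IsProfile

variable {E : Set E3} {F : ℝ → ℝ} {ρ : ℝ}

theorem hasStrictDerivAt_neg_deriv (H : IsProfile E F ρ) {x : ℝ} (hx : x ∈ Set.Ioo (-ρ) ρ) :
    HasStrictDerivAt (fun x => -deriv F x) (-deriv (deriv F) x) x :=
  ((H.contDiffAt x hx).deriv_infty.hasStrictDerivAt (by simp)).neg

theorem strictMonoOn_neg_deriv (H : IsProfile E F ρ) :
    StrictMonoOn (fun x => -deriv F x) (Set.Ioo (-ρ) ρ) := by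
  refine strictMonoOn_of_deriv_pos (convex_Ioo _ _) (fun x hx =>
    (H.hasStrictDerivAt_neg_deriv hx).hasDerivAt.continuousAt.continuousWithinAt) fun x hx => ?_
  rw [interior_Ioo] at hx
  rw [(H.hasStrictDerivAt_neg_deriv hx).hasDerivAt.deriv]
  linarith [H.deriv_deriv_neg x hx]

theorem slopeInv_neg_deriv (H : IsProfile E F ρ) {x : ℝ} (hx : x ∈ Set.Ioo (-ρ) ρ) :
    slopeInv F ρ (-deriv F x) = x :=
  H.strictMonoOn_neg_deriv.injOn.leftInvOn_invFunOn hx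

theorem exists_neg_deriv_eq (H : IsProfile E F ρ) {a b v : ℝ} (ha : -ρ < a) (hb : b < ρ)
    (hab : a ≤ b) (hv : v ∈ Set.Icc (-deriv F a) (-deriv F b)) :
    ∃ x ∈ Set.Icc a b, -deriv F x = v := by
  refine intermediate_value_Icc (f := fun x => -deriv F x) hab (fun x hx => ?_) hv
  exact (H.hasStrictDerivAt_neg_deriv ⟨ha.trans_le hx.1, hx.2.trans_lt hb⟩).hasDerivAt.continuousAt
    |>.continuousWithinAt

theorem hasDerivAt_slopeInv (H : IsProfile E F ρ) {x : ℝ} (hx : x ∈ Set.Ioo (-ρ) ρ) :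
    HasDerivAt (slopeInv F ρ) (slopeInv' F ρ (-deriv F x)) (-deriv F x) := by
  have h1 := (H.hasStrictDerivAt_neg_deriv hx).to_local_left_inverse
    (g := slopeInv F ρ) (by linarith [H.deriv_deriv_neg x hx])
    (by filter_upwards [isOpen_Ioo.mem_nhds hx] with y hy using H.slopeInv_neg_deriv hy)
  unfold slopeInv'
  rw [H.slopeInv_neg_deriv hx]
  exact h1.hasDerivAt

theorem slopeInv'_pos (H : IsProfile E F ρ) {x : ℝ} (hx : x ∈ Set.Ioo (-ρ) ρ) :
    0 < slopeInv' F ρ (-deriv F x) := by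
  unfold slopeInv'
  rw [H.slopeInv_neg_deriv hx]
  exact inv_pos.2 (by linarith [H.deriv_deriv_neg x hx])

theorem hasDerivAt_slopeInv' (H : IsProfile E F ρ) {x : ℝ} (hx : x ∈ Set.Ioo (-ρ) ρ) :
    HasDerivAt (slopeInv' F ρ) (slopeInv'' F ρ (-deriv F x)) (-deriv F x) := by
  have h1 := H.hasDerivAt_slopeInv hx
  have hx' := H.slopeInv_neg_deriv hx
  have h2 : HasDerivAt (deriv (deriv F)) (deriv (deriv (deriv F)) x) x :=
    ((H.contDiffAt x hx).deriv_infty.deriv_infty.differentiableAt (by simp)).hasDerivAt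
  have h3 : HasDerivAt (fun v => -deriv (deriv F) (slopeInv F ρ v))
      (-(deriv (deriv (deriv F)) x * slopeInv' F ρ (-deriv F x))) (-deriv F x) := by
    rw [← hx'] at h2
    have h5 := (HasDerivAt.comp (-deriv F x) h2 h1).neg
    rw [hx'] at h5
    exact h5
  have hneg := H.deriv_deriv_neg x hx
  have h4 := h3.fun_inv (by rw [hx']; linarith)
  refine h4.congr_deriv ?_
  unfold slopeInv''
  rw [hx']
  unfold slopeInv'
  rw [hx']
  have : deriv (deriv F) x ≠ 0 := hneg.ne
  field_simp

/-- The supremum is attained at the meridian point with slope `-√n / m`; the tangent there bounds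
the body, since the first coordinate is at most the distance from the axis. -/
theorem phase_eq (H : IsProfile E F ρ) {x n m : ℝ} (hx : x ∈ Set.Ico 0 ρ) (hm : 0 ≤ m)
    (hn : √n = m * -deriv F x) : phase E n m = m * (-deriv F x * x + F x) := by
  have hG : 0 ≤ -deriv F x := by
    have h0 := H.strictMonoOn_neg_deriv.monotoneOn (a := 0) (b := x)
      ⟨by linarith [H.pos], H.pos⟩ ⟨by linarith [H.pos, hx.1], hx.2⟩ hx.1
    simpa [H.deriv_zero] using h0
  have hinner : ∀ p : E3, inner ℝ p (!₂[√n, 0, m] : E3) = p 0 * √n + p 2 * m := by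
    intro p
    simp [PiLp.inner_apply, Fin.sum_univ_three, mul_comm]
  refine IsGreatest.csSup_eq ⟨⟨meridian (x, F x), H.mem x hx, ?_⟩, ?_⟩
  · change inner ℝ _ _ = _
    rw [hinner, meridian_zero, meridian_two, hn]
    ring
  · rintro _ ⟨p, hp, rfl⟩
    obtain ⟨y, hy, hpy⟩ := H.le_tangent p hp x hx
    change inner ℝ _ _ ≤ _
    rw [hinner, hn]
    calc p 0 * (m * -deriv F x) + p 2 * m
        ≤ y * (m * -deriv F x) + (F x + deriv F x * (y - x)) * m := by gcongr
      _ = _ := by ring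

/-- For `K(v) = v r(v) + F(r(v))` the terms with `r'` cancel, because `F'(r(v)) = -v`. Requiring `x
> 0` leaves room on both sides for the formula to hold in a neighbourhood. -/
theorem hasDerivAt_phase (H : IsProfile E F ρ) {x y m : ℝ} (hx : x ∈ Set.Ioo 0 ρ) (hm : 0 < m)
    (hy : 0 < y) (hxy : √y / m = -deriv F x) :
    HasDerivAt (fun y => phase E y m) (slopeInv F ρ (√y / m) / (2 * √y)) y := by
  have hρ := H.pos
  have hx' : x ∈ Set.Ioo (-ρ) ρ := ⟨by linarith [hx.1], hx.2⟩
  have hinv := H.slopeInv_neg_deriv hx'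
  obtain ⟨a, ha0, hax⟩ := exists_between hx.1
  obtain ⟨b, hxb, hbρ⟩ := exists_between hx.2
  have hmono := H.strictMonoOn_neg_deriv
  have h1 : -deriv F a < √y / m := by
    rw [hxy]
    exact hmono ⟨by linarith, by linarith⟩ hx' hax
  have h2 : √y / m < -deriv F b := by
    rw [hxy]
    exact hmono hx' ⟨by linarith, hbρ⟩ hxb
  have hs : HasDerivAt (fun y => √y / m) (1 / (2 * √y) / m) y :=
    (Real.hasDerivAt_sqrt hy.ne').div_const m
  have hev : ∀ᶠ z in 𝓝 y, phase E z m =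
      m * (√z / m * slopeInv F ρ (√z / m) + F (slopeInv F ρ (√z / m))) := by
    filter_upwards [hs.continuousAt.eventually (Ioo_mem_nhds h1 h2)] with z hz
    obtain ⟨w, hw, hwz⟩ := H.exists_neg_deriv_eq (by linarith) hbρ (by linarith)
      (Set.Ioo_subset_Icc_self hz)
    have hw' : w ∈ Set.Ico 0 ρ := ⟨by linarith [hw.1], by linarith [hw.2]⟩
    rw [← hwz, H.slopeInv_neg_deriv ⟨by linarith [hw'.1], hw'.2⟩]
    refine H.phase_eq hw' hm.le ?_
    rw [hwz]
    field_simp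
  refine HasDerivAt.congr_of_eventuallyEq ?_ hev
  have hr : HasDerivAt (slopeInv F ρ) (slopeInv' F ρ (√y / m)) (√y / m) := by
    rw [hxy]
    exact H.hasDerivAt_slopeInv hx'
  have hF : HasDerivAt F (deriv F x) (slopeInv F ρ (√y / m)) := by
    rw [hxy, hinv]
    exact ((H.contDiffAt x hx').differentiableAt (by simp)).hasDerivAt
  have hK : HasDerivAt (fun v => v * slopeInv F ρ v + F (slopeInv F ρ v))
      (1 * slopeInv F ρ (√y / m) + √y / m * slopeInv' F ρ (√y / m) +
        deriv F x * slopeInv' F ρ (√y / m)) (√y / m) :=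
    ((hasDerivAt_id _).mul hr).add (hF.comp _ hr)
  have hfin := (HasDerivAt.comp y hK hs).const_mul m
  refine hfin.congr_deriv ?_
  rw [hxy]
  have hsy : √y ≠ 0 := (Real.sqrt_pos.2 hy).ne'
  field_simp
  ring

end IsProfile
end RevolutionBody

/-! ### Functions with a zero of finite order -/

namespace RevolutionBody

open Filter Topology

theorem tendsto_div_pow_of_iteratedDeriv {φ : ℝ → ℝ} {s : Set ℝ} {x₀ : ℝ} {n : ℕ} (hs : IsOpen s)
    (hc : Convex ℝ s) (hx₀ : x₀ ∈ s) (hφ : ContDiffOn ℝ n φ s)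
    (h0 : ∀ k < n, iteratedDeriv k φ x₀ = 0) :
    Tendsto (fun x => φ x / (x - x₀) ^ n) (𝓝[≠] x₀) (𝓝 (iteratedDeriv n φ x₀ / n.factorial)) := by
  have h1 := Real.taylor_tendsto hc hx₀ hφ
  rw [hs.nhdsWithin_eq hx₀] at h1
  have h2 : ∀ x, taylorWithinEval φ n s x₀ x =
      (x - x₀) ^ n * (iteratedDeriv n φ x₀ / n.factorial) := by
    intro x
    rw [taylor_within_apply, Finset.sum_range_succ, Finset.sum_eq_zero, zero_add,
      iteratedDerivWithin_of_isOpen hs hx₀, smul_eq_mul]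
    · ring
    · intro k hk
      rw [iteratedDerivWithin_of_isOpen hs hx₀, h0 k (Finset.mem_range.1 hk), smul_zero]
  have h3 := (h1.mono_left (nhdsWithin_le_nhds (s := {x₀}ᶜ))).add_const
    (iteratedDeriv n φ x₀ / n.factorial)
  rw [zero_add] at h3
  refine h3.congr' ?_
  filter_upwards [self_mem_nhdsWithin] with x hx
  have : (x - x₀) ^ n ≠ 0 := pow_ne_zero _ (sub_ne_zero.2 hx)
  rw [h2]
  field_simp
  ring

theorem exists_sign_mul_pos {g : ℝ → ℝ} {a b : ℝ} (hg : ContinuousOn g (Set.Icc a b))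
    (hne : ∀ x ∈ Set.Icc a b, g x ≠ 0) :
    ∃ σ : ℝ, (σ = 1 ∨ σ = -1) ∧ ∀ x ∈ Set.Icc a b, 0 < σ * g x := by
  by_cases h : ∀ x ∈ Set.Icc a b, 0 < g x
  · exact ⟨1, Or.inl rfl, fun x hx => by rw [one_mul]; exact h x hx⟩
  · push Not at h
    obtain ⟨y, hy, hy0⟩ := h
    refine ⟨-1, Or.inr rfl, fun x hx => ?_⟩
    by_contra hc
    have hx0 : 0 ≤ g x := by linarith
    obtain ⟨z, hz, hz0⟩ := isPreconnected_Icc.intermediate_value hy hx hg ⟨hy0, hx0⟩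
    exact hne z hz hz0

/-- A function without zeros on an interval except for one of finite order at an end point. -/
theorem exists_order_bounds {ψ : ℝ → ℝ} {a b x₀ c : ℝ} {n : ℕ} (hab : a < b)
    (hx₀ : x₀ = a ∨ x₀ = b) (hψ : ∀ x ∈ Set.Icc a b, ContinuousAt ψ x)
    (hne : ∀ x ∈ Set.Icc a b, x ≠ x₀ → ψ x ≠ 0)
    (hlim : Tendsto (fun x => ψ x / (x - x₀) ^ n) (𝓝[≠] x₀) (𝓝 c)) (hc : c ≠ 0) :
    ∃ σ c₁ C : ℝ, (σ = 1 ∨ σ = -1) ∧ 0 < c₁ ∧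
      ∀ x ∈ Set.Icc a b, c₁ * |x - x₀| ^ n ≤ σ * ψ x ∧ σ * ψ x ≤ C * |x - x₀| ^ n := by
  have hx₀I : x₀ ∈ Set.Icc a b := by
    rcases hx₀ with rfl | rfl
    · exact Set.left_mem_Icc.2 hab.le
    · exact Set.right_mem_Icc.2 hab.le
  -- The quotient, completed by its limit, is continuous without zeros on a compact interval: it has
  -- constant sign and is bounded away from `0` and `∞`.
  set g := Function.update (fun x => ψ x / (x - x₀) ^ n) x₀ c with hg
  have hgx : ∀ x, x ≠ x₀ → g x = ψ x / (x - x₀) ^ n := fun x hx => Function.update_of_ne hx _ _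
  have hgx₀ : g x₀ = c := Function.update_self _ _ _
  have hgc : ContinuousOn g (Set.Icc a b) := by
    intro x hx
    refine ContinuousAt.continuousWithinAt ?_
    by_cases h : x = x₀
    · rw [h, hg, continuousAt_update_same]
      exact hlim
    · rw [hg, continuousAt_update_of_ne h]
      exact (hψ x hx).div (by fun_prop) (pow_ne_zero _ (sub_ne_zero.2 h))
  have hgne : ∀ x ∈ Set.Icc a b, g x ≠ 0 := by
    intro x hx
    by_cases h : x = x₀
    · rw [h, hgx₀]
      exact hc
    · rw [hgx x h]
      exact div_ne_zero (hne x hx h) (pow_ne_zero _ (sub_ne_zero.2 h))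
  have hψg : ∀ x, ψ x = g x * (x - x₀) ^ n := by
    intro x
    by_cases h : x = x₀
    · have h1 : Tendsto ψ (𝓝[≠] x₀) (𝓝 (ψ x₀)) := (hψ x₀ hx₀I).mono_left nhdsWithin_le_nhds
      have h2 : Tendsto (fun x => (x - x₀) ^ n) (𝓝[≠] x₀) (𝓝 ((x₀ - x₀) ^ n)) :=
        (Continuous.tendsto (by fun_prop) x₀).mono_left nhdsWithin_le_nhds
      rw [h, hgx₀]
      refine tendsto_nhds_unique h1 ((hlim.mul h2).congr' ?_)
      filter_upwards [self_mem_nhdsWithin] with y hy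
      exact div_mul_cancel₀ _ (pow_ne_zero _ (sub_ne_zero.2 hy))
    · rw [hgx x h, div_mul_cancel₀ _ (pow_ne_zero _ (sub_ne_zero.2 h))]
  obtain ⟨σ, hσ, hσg⟩ := exists_sign_mul_pos hgc hgne
  have hcont : ContinuousOn (fun x => σ * g x) (Set.Icc a b) := continuousOn_const.mul hgc
  obtain ⟨y, hy, hymin⟩ := isCompact_Icc.exists_isMinOn ⟨x₀, hx₀I⟩ hcont
  obtain ⟨z, hz, hzmax⟩ := isCompact_Icc.exists_isMaxOn ⟨x₀, hx₀I⟩ hcont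
  -- As `x₀` is an end point, `(x - x₀) ^ n` has constant sign on the interval.
  obtain ⟨τ, hτ, hτ'⟩ : ∃ τ : ℝ, (τ = 1 ∨ τ = -1) ∧
      ∀ x ∈ Set.Icc a b, τ * (x - x₀) ^ n = |x - x₀| ^ n := by
    rcases hx₀ with rfl | rfl
    · exact ⟨1, Or.inl rfl, fun x hx => by rw [one_mul, abs_of_nonneg (by linarith [hx.1])]⟩
    · refine ⟨(-1) ^ n, neg_one_pow_eq_or ℝ n, fun x hx => ?_⟩
      rw [abs_of_nonpos (by linarith [hx.2]), ← mul_pow]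
      ring
  refine ⟨σ * τ, σ * g y, σ * g z, ?_, hσg y hy, fun x hx => ?_⟩
  · rcases hσ with rfl | rfl <;> rcases hτ with rfl | rfl <;> simp
  · have h1 : σ * τ * ψ x = σ * g x * |x - x₀| ^ n := by
      rw [hψg, ← hτ' x hx]
      ring
    rw [h1]
    have h2 : σ * g y ≤ σ * g x := hymin hx
    have h3 : σ * g x ≤ σ * g z := hzmax hx
    constructor <;> gcongr

end RevolutionBody

/-! ### Blocks near a zero of finite order -/

namespace RevolutionBody

/-- A phase on an interval `[a, b]` where `r''` vanishes to order `n` at `x₀` only. -/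
structure OrderedPhase (a b x₀ σ c C : ℝ) (n : ℕ) (h : ℝ → ℝ → ℝ) (r r' r'' : ℝ → ℝ) : Prop where
  lt : a < b
  mem : x₀ ∈ Set.Icc a b
  sign : σ = 1 ∨ σ = -1
  c_pos : 0 < c
  deriv_r : ∀ v ∈ Set.Icc a b, HasDerivAt r (r' v) v
  deriv_r' : ∀ v ∈ Set.Icc a b, HasDerivAt r' (r'' v) v
  pos : 0 < r' x₀
  bounds : ∀ v ∈ Set.Icc a b, c * |v - x₀| ^ n ≤ σ * r'' v ∧ σ * r'' v ≤ C * |v - x₀| ^ n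
  deriv_h : ∀ m : ℕ, 0 < m → ∀ x : ℝ, 0 < x → √x / m ∈ Set.Icc a b → 0 < √x / m →
    HasDerivAt (fun x => h x m) (r (√x / m) / (2 * √x)) x

namespace OrderedPhase

variable {a b x₀ σ c C : ℝ} {n : ℕ} {h : ℝ → ℝ → ℝ} {r r' r'' : ℝ → ℝ}

theorem C_pos (H : OrderedPhase a b x₀ σ c C n h r r' r'') : 0 < C := by
  obtain ⟨v, hv, hvx⟩ : ∃ v ∈ Set.Icc a b, v ≠ x₀ := by
    by_cases h : x₀ = a
    · exact ⟨b, Set.right_mem_Icc.2 H.lt.le, by rw [h]; exact H.lt.ne'⟩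
    · exact ⟨a, Set.left_mem_Icc.2 H.lt.le, Ne.symm h⟩
  have h1 := H.bounds v hv
  have h2 : 0 < |v - x₀| ^ n := pow_pos (abs_pos.2 (sub_ne_zero.2 hvx)) n
  have h3 : c * |v - x₀| ^ n ≤ C * |v - x₀| ^ n := h1.1.trans h1.2
  exact H.c_pos.trans_le (le_of_mul_le_mul_right h3 h2)

theorem abs_r'_sub_le (H : OrderedPhase a b x₀ σ c C n h r r' r'') {v : ℝ}
    (hv : v ∈ Set.Icc a b) : |r' v - r' x₀| ≤ C * |v - x₀| ^ (n + 1) := by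
  have hC := H.C_pos
  have hbound : ∀ w ∈ Set.uIcc x₀ v, ‖r'' w‖ ≤ C * |v - x₀| ^ n := by
    intro w hw
    have hwI : w ∈ Set.Icc a b := Set.uIcc_subset_Icc H.mem hv hw
    have h1 := H.bounds w hwI
    have h2 : |r'' w| = σ * r'' w := by
      have h0 : 0 ≤ σ * r'' w := le_trans (by have := H.c_pos; positivity) h1.1
      rw [← abs_of_nonneg h0, abs_mul]
      rcases H.sign with h | h <;> simp [h]
    rw [Real.norm_eq_abs, h2]
    refine h1.2.trans ?_
    exact mul_le_mul_of_nonneg_left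
      (pow_le_pow_left₀ (abs_nonneg _) (Set.abs_sub_left_of_mem_uIcc hw) n) hC.le
  have h1 := (convex_uIcc x₀ v).norm_image_sub_le_of_norm_hasDerivWithin_le
    (fun w hw => (H.deriv_r' w (Set.uIcc_subset_Icc H.mem hv hw)).hasDerivWithinAt) hbound
    Set.left_mem_uIcc Set.right_mem_uIcc
  rw [Real.norm_eq_abs, Real.norm_eq_abs] at h1
  rw [pow_succ, ← mul_assoc]
  exact h1

/-- Ranges at distance of order `τ` from the zero are blocks, with uniform constants. -/
theorem exists_phaseBlock (H : OrderedPhase a b x₀ σ c C n h r r' r'') {c₂ C₂ K₀ : ℝ}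
    (hc₂ : 0 < c₂) (hC₂ : 0 ≤ C₂) (hK₀ : 1 ≤ K₀) : ∃ K : ℝ, 1 ≤ K ∧ ∀ U₁ U W κ τ : ℝ,
      0 < U → 0 < W → 0 < κ → 0 < U₁ → 0 < τ → τ * W = U → κ * W = τ ^ n →
      Set.Icc √U₁ √(U₁ + U) ⊆ Set.Icc a b →
      (∀ v ∈ Set.Icc √U₁ √(U₁ + U), c₂ * τ ≤ |v - x₀| ∧ |v - x₀| ≤ C₂ * τ) →
      U ≤ K₀ → W ≤ K₀ → κ ≤ K₀ → W ≤ K₀ * √U₁ → √(U₁ + U) ≤ K₀ * W →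
      PhaseBlock K (r' x₀) σ U₁ U W κ h r r' r'' := by
  have hα := H.pos
  have hc := H.c_pos
  have hC := H.C_pos
  set A := 1 / r' x₀ with hA
  set B := 1 / (c * c₂ ^ n) with hB
  have hA0 : 0 < A := by positivity
  have hB0 : 0 < B := by positivity
  have hD0 : 0 ≤ C * C₂ ^ n := by positivity
  have hF0 : 0 ≤ C * C₂ ^ (n + 1) := by positivity
  -- `K` is the sum of all constants needed. At distance `τ` from the zero, `r''` has size `τ^n = κ
  -- W`, and `r'` differs from its value at the zero by at most a constant times `τ^(n+1) = κ U`.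
  refine ⟨K₀ + r' x₀ + A + B + C * C₂ ^ n + C * C₂ ^ (n + 1), by linarith, ?_⟩
  intro U₁ U W κ τ hU hW hκ hU1 hτ hτW hκW hsub hdist hUK hWK hκK hlow hup
  set K := K₀ + r' x₀ + A + B + C * C₂ ^ n + C * C₂ ^ (n + 1) with hK
  have hK₀K : K₀ ≤ K := by linarith
  have hK1 : 1 ≤ K := hK₀.trans hK₀K
  have hτn : 0 < τ ^ n := pow_pos hτ n
  refine
    { one_le := hK1
      U_pos := hU
      W_pos := hW
      κ_pos := hκ
      U_le := hUK.trans hK₀K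
      W_le := hWK.trans hK₀K
      κ_le := hκK.trans hK₀K
      α_ge := ?_
      α_le := by linarith
      sign := H.sign
      U₁_pos := hU1
      lower := hlow.trans (by gcongr)
      upper := hup.trans (by gcongr)
      deriv_r := fun v hv => H.deriv_r v (hsub hv)
      deriv_r' := fun v hv => H.deriv_r' v (hsub hv)
      r''_ge := fun v hv => ?_
      r''_le := fun v hv => ?_
      r'_sub := fun v hv => ?_
      deriv_h := fun m hm x hx hv =>
        H.deriv_h m hm x hx (hsub hv) ((Real.sqrt_pos.2 hU1).trans_le hv.1) }
  · calc 1 = A * r' x₀ := by rw [hA]; field_simp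
      _ ≤ K * r' x₀ := by
          gcongr
          linarith
  · have h1 := (H.bounds v (hsub hv)).1
    have h2 : (c₂ * τ) ^ n ≤ |v - x₀| ^ n := by
      gcongr
      exact (hdist v hv).1
    have h3 : c * (c₂ * τ) ^ n ≤ σ * r'' v := (mul_le_mul_of_nonneg_left h2 hc.le).trans h1
    have h4 : 0 ≤ c * (c₂ * τ) ^ n := by positivity
    calc κ * W = B * (c * (c₂ * τ) ^ n) := by rw [hκW, hB, mul_pow]; field_simp
      _ ≤ K * (c * (c₂ * τ) ^ n) := by
          gcongr
          linarith
      _ ≤ _ := by gcongr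
  · calc σ * r'' v ≤ C * |v - x₀| ^ n := (H.bounds v (hsub hv)).2
      _ ≤ C * (C₂ * τ) ^ n := by
          gcongr
          exact (hdist v hv).2
      _ = C * C₂ ^ n * τ ^ n := by ring
      _ ≤ K * τ ^ n := by
          gcongr
          linarith
      _ = _ := by rw [hκW]
  · calc |r' v - r' x₀| ≤ C * |v - x₀| ^ (n + 1) := H.abs_r'_sub_le (hsub hv)
      _ ≤ C * (C₂ * τ) ^ (n + 1) := by
          gcongr
          exact (hdist v hv).2
      _ = C * C₂ ^ (n + 1) * (τ ^ n * τ) := by ring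
      _ ≤ K * (τ ^ n * τ) := by
          gcongr
          linarith
      _ = _ := by rw [← hκW, ← hτW]; ring

/-- Blocks to the right of a positive zero. -/
theorem exists_phaseBlock_left (H : OrderedPhase a b a σ c C n h r r' r'') (ha : 0 < a) :
    ∃ K : ℝ, 1 ≤ K ∧ ∀ U : ℝ, 0 < U → a ^ 2 + 2 * U ≤ b ^ 2 →
      PhaseBlock K (r' a) σ (a ^ 2 + U) U 1 (U ^ n) h r r' r'' := by
  have hab := H.lt
  have hb : 0 < b := ha.trans hab
  -- Here `U ≤ v² - a² ≤ 2 U` is divided by `v + a`, which lies between `a` and `2 b`.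
  obtain ⟨K, hK, hKb⟩ := H.exists_phaseBlock (c₂ := 1 / (2 * b)) (C₂ := 2 / a)
    (K₀ := 1 + b + b ^ 2 + (b ^ 2) ^ n + 1 / a) (by positivity) (by positivity)
    (by have : 0 < b + b ^ 2 + (b ^ 2) ^ n + 1 / a := by positivity
        linarith)
  refine ⟨K, hK, fun U hU hUb => ?_⟩
  have hp1 : 0 < (b ^ 2) ^ n := by positivity
  have hp2 : 0 < 1 / a := by positivity
  have hp3 : 0 < b ^ 2 := by positivity
  have hUb' : U ≤ b ^ 2 := by nlinarith
  have hleft : a ≤ √(a ^ 2 + U) := Real.le_sqrt_of_sq_le (by linarith)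
  have hright : √(a ^ 2 + U + U) ≤ b := by
    rw [Real.sqrt_le_left hb.le]
    linarith
  have hsub : Set.Icc √(a ^ 2 + U) √(a ^ 2 + U + U) ⊆ Set.Icc a b := Set.Icc_subset_Icc hleft hright
  refine hKb _ _ _ _ U hU one_pos (by positivity) (by positivity) hU (mul_one U) (mul_one _) hsub
    (fun v hv => ?_) (by linarith) (by linarith) ?_ ?_ (by linarith)
  · have hvI := hsub hv
    have hv0 : 0 ≤ v := by linarith [hvI.1]
    have h1 : a ^ 2 + U ≤ v ^ 2 := (Real.sqrt_le_left hv0).1 hv.1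
    have h2 : v ^ 2 ≤ a ^ 2 + U + U := (Real.le_sqrt hv0 (by positivity)).1 hv.2
    rw [abs_of_nonneg (by linarith [hvI.1])]
    constructor
    · rw [one_div_mul_eq_div, div_le_iff₀ (by positivity)]
      nlinarith [hvI.1, hvI.2]
    · rw [div_mul_eq_mul_div, le_div_iff₀ ha]
      nlinarith [hvI.1, hvI.2]
  · have : U ^ n ≤ (b ^ 2) ^ n := by gcongr
    linarith
  · calc 1 = 1 / a * a := by field_simp
      _ ≤ _ := by
          gcongr
          linarith

/-- Blocks to the right of a zero at the origin. -/
theorem exists_phaseBlock_zero (H : OrderedPhase 0 b 0 σ c C (n + 1) h r r' r'') :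
    ∃ K : ℝ, 1 ≤ K ∧ ∀ U : ℝ, 0 < U → 2 * U ≤ b ^ 2 →
      PhaseBlock K (r' 0) σ U U √U (√U ^ n) h r r' r'' := by
  have hb := H.lt
  -- With `τ = W = √U` the relation `κ W = τ^(n+1)` gives `κ = √U^n`. A zero of positive order is
  -- needed to keep `κ` bounded as `U → 0`.
  obtain ⟨K, hK, hKb⟩ := H.exists_phaseBlock (c₂ := 1) (C₂ := 2)
    (K₀ := 2 + b + b ^ 2 + b ^ n) (by positivity) (by positivity)
    (by have : 0 < b + b ^ 2 + b ^ n := by positivity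
        linarith)
  refine ⟨K, hK, fun U hU hUb => ?_⟩
  have hp1 : 0 < b ^ n := by positivity
  have hp3 : 0 < b ^ 2 := by positivity
  have hs : 0 < √U := Real.sqrt_pos.2 hU
  have hsq : √U * √U = U := Real.mul_self_sqrt hU.le
  have hsb : √U ≤ b := by
    rw [Real.sqrt_le_left hb.le]
    linarith
  have hright : √(U + U) ≤ b := by
    rw [Real.sqrt_le_left hb.le]
    linarith
  have h2 : √(U + U) ≤ 2 * √U := by
    rw [Real.sqrt_le_left (by positivity)]
    nlinarith
  refine hKb _ _ _ _ √U hU hs (by positivity) hU hs hsq (pow_succ _ _).symm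
    (Set.Icc_subset_Icc hs.le hright) (fun v hv => ?_) (by nlinarith) (by linarith) ?_ ?_ ?_
  · rw [sub_zero, abs_of_nonneg (hs.le.trans hv.1), one_mul]
    exact ⟨hv.1, hv.2.trans h2⟩
  · have : √U ^ n ≤ b ^ n := by gcongr
    linarith
  · nlinarith
  · nlinarith

/-- Blocks to the left of a zero. -/
theorem exists_phaseBlock_right (H : OrderedPhase a b b σ c C n h r r' r'') (ha : 0 < a) :
    ∃ K : ℝ, 1 ≤ K ∧ ∀ U : ℝ, 0 < U → a ^ 2 + 2 * U ≤ b ^ 2 →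
      PhaseBlock K (r' b) σ (b ^ 2 - 2 * U) U 1 (U ^ n) h r r' r'' := by
  have hab := H.lt
  have hb : 0 < b := ha.trans hab
  obtain ⟨K, hK, hKb⟩ := H.exists_phaseBlock (c₂ := 1 / (2 * b)) (C₂ := 2 / b)
    (K₀ := 1 + b + b ^ 2 + (b ^ 2) ^ n + 1 / a) (by positivity) (by positivity)
    (by have : 0 < b + b ^ 2 + (b ^ 2) ^ n + 1 / a := by positivity
        linarith)
  refine ⟨K, hK, fun U hU hUb => ?_⟩
  have hp1 : 0 < (b ^ 2) ^ n := by positivity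
  have hp2 : 0 < 1 / a := by positivity
  have hp3 : 0 < b ^ 2 := by positivity
  have ha2 : 0 < a ^ 2 := by positivity
  have hUb' : U ≤ b ^ 2 := by nlinarith
  have hleft : a ≤ √(b ^ 2 - 2 * U) := Real.le_sqrt_of_sq_le (by linarith)
  have hright : √(b ^ 2 - 2 * U + U) ≤ b := by
    rw [Real.sqrt_le_left hb.le]
    linarith
  have hsub : Set.Icc √(b ^ 2 - 2 * U) √(b ^ 2 - 2 * U + U) ⊆ Set.Icc a b :=
    Set.Icc_subset_Icc hleft hright
  refine hKb _ _ _ _ U hU one_pos (by positivity) (by linarith) hU (mul_one U) (mul_one _) hsub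
    (fun v hv => ?_) (by linarith) (by linarith) ?_ ?_ (by linarith)
  · have hvI := hsub hv
    have hv0 : 0 ≤ v := by linarith [hvI.1]
    have h1 : b ^ 2 - 2 * U ≤ v ^ 2 := (Real.sqrt_le_left hv0).1 hv.1
    have h2 : v ^ 2 ≤ b ^ 2 - 2 * U + U := (Real.le_sqrt hv0 (by linarith)).1 hv.2
    rw [abs_of_nonpos (by linarith [hvI.2])]
    constructor
    · rw [one_div_mul_eq_div, div_le_iff₀ (by positivity)]
      nlinarith [hvI.1, hvI.2]
    · rw [div_mul_eq_mul_div, le_div_iff₀ hb]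
      nlinarith [hvI.1, hvI.2]
  · have : U ^ n ≤ (b ^ 2) ^ n := by gcongr
    linarith
  · calc 1 = 1 / a * a := by field_simp
      _ ≤ _ := by
          gcongr
          linarith

end OrderedPhase

end RevolutionBody

/-! ### The sums near the zeros of the third derivative -/

namespace RevolutionBody

open Filter Topology

namespace IsProfile

variable {E : Set E3} {F : ℝ → ℝ} {ρ : ℝ}

/-- In `r'' = F'''(r) r'³` the factor `r'` is positive, so `r` is a local change of variables and
`r''` vanishes to the same order as `F'''`. -/
theorem exists_tendsto_slopeInv'' (H : IsProfile E F ρ) {x : ℝ} (hx : x ∈ Set.Ioo (-ρ) ρ)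
    (hfin : ∃ k, iteratedDeriv k (deriv (deriv (deriv F))) x ≠ 0) :
    ∃ (n : ℕ) (c : ℝ), c ≠ 0 ∧ (deriv (deriv (deriv F)) x = 0 → n ≠ 0) ∧
      Tendsto (fun v => slopeInv'' F ρ v / (v - -deriv F x) ^ n) (𝓝[≠] (-deriv F x)) (𝓝 c) := by
  classical
  set φ := deriv (deriv (deriv F)) with hφ
  set n := Nat.find hfin with hn
  have hn0 : iteratedDeriv n φ x ≠ 0 := Nat.find_spec hfin
  have hlt : ∀ k < n, iteratedDeriv k φ x = 0 := fun k hk => by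
    simpa using Nat.find_min hfin hk
  have hφs : ContDiffOn ℝ n φ (Set.Ioo (-ρ) ρ) := fun y hy =>
    ((H.contDiffAt y hy).deriv_infty.deriv_infty.deriv_infty.of_le
      (by exact_mod_cast le_top)).contDiffWithinAt
  have h1 := tendsto_div_pow_of_iteratedDeriv isOpen_Ioo (convex_Ioo _ _) hx hφs hlt
  set v₀ := -deriv F x with hv₀
  have hinv : slopeInv F ρ v₀ = x := H.slopeInv_neg_deriv hx
  have hpos : 0 < slopeInv' F ρ v₀ := H.slopeInv'_pos hx
  have hd := H.hasDerivAt_slopeInv hx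
  have h2 : Tendsto (slopeInv F ρ) (𝓝[≠] v₀) (𝓝[≠] x) := by
    have := hd.tendsto_nhdsNE hpos.ne'
    rwa [hinv] at this
  have h3 := hasDerivAt_iff_tendsto_slope.1 hd
  have h4 : Tendsto (slopeInv' F ρ) (𝓝[≠] v₀) (𝓝 (slopeInv' F ρ v₀)) :=
    (H.hasDerivAt_slopeInv' hx).continuousAt.tendsto.mono_left nhdsWithin_le_nhds
  have h5 := ((h1.comp h2).mul (h3.pow n)).mul (h4.pow 3)
  refine ⟨n, _, ?_, ?_, h5.congr' ?_⟩
  · have := pow_ne_zero n hpos.ne'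
    have := pow_ne_zero 3 hpos.ne'
    positivity
  · intro h0 hn'
    rw [hn', iteratedDeriv_zero] at hn0
    exact hn0 h0
  · filter_upwards [self_mem_nhdsWithin, h2 self_mem_nhdsWithin] with v hv hv'
    have e1 : v - v₀ ≠ 0 := sub_ne_zero.2 hv
    have e2 : slopeInv F ρ v - x ≠ 0 := sub_ne_zero.2 hv'
    simp only [Function.comp_apply, slope_def_field, slopeInv'']
    rw [hinv, div_pow, ← hφ, ← hv₀]
    field_simp

/-- The phase is well behaved on one side of a point. -/
theorem exists_orderedPhase (H : IsProfile E F ρ) {x y z a b : ℝ} (hx : 0 ≤ x) (hxy : x ≤ y)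
    (hy : y < ρ) (hz : z ∈ Set.Icc x y) (ha : -deriv F x ≤ a) (hab : a < b) (hb : b ≤ -deriv F y)
    (hzab : -deriv F z = a ∨ -deriv F z = b)
    (hne : ∀ w ∈ Set.Icc x y, -deriv F w ∈ Set.Icc a b → w ≠ z → deriv (deriv (deriv F)) w ≠ 0)
    (hfin : ∃ k, iteratedDeriv k (deriv (deriv (deriv F))) z ≠ 0) :
    ∃ (σ c C : ℝ) (n : ℕ), (deriv (deriv (deriv F)) z = 0 → n ≠ 0) ∧
      OrderedPhase a b (-deriv F z) σ c C n (phase E) (slopeInv F ρ) (slopeInv' F ρ)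
        (slopeInv'' F ρ) := by
  have hρ := H.pos
  have hI : ∀ w ∈ Set.Icc x y, w ∈ Set.Ioo (-ρ) ρ := fun w hw =>
    ⟨by linarith [hw.1], by linarith [hw.2]⟩
  have hsurj : ∀ v ∈ Set.Icc a b, ∃ w ∈ Set.Icc x y, -deriv F w = v := fun v hv =>
    H.exists_neg_deriv_eq (by linarith) hy hxy ⟨ha.trans hv.1, hv.2.trans hb⟩
  obtain ⟨n, c, hc, hn, hlim⟩ := H.exists_tendsto_slopeInv'' (hI z hz) hfin
  have hcont : ∀ v ∈ Set.Icc a b, ContinuousAt (slopeInv'' F ρ) v := by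
    intro v hv
    obtain ⟨w, hw, rfl⟩ := hsurj v hv
    have hinv := H.slopeInv_neg_deriv (hI w hw)
    have h1 : ContinuousAt (deriv (deriv (deriv F))) (slopeInv F ρ (-deriv F w)) := by
      rw [hinv]
      exact (H.contDiffAt w (hI w hw)).deriv_infty.deriv_infty.deriv_infty.continuousAt
    exact (ContinuousAt.comp h1 (H.hasDerivAt_slopeInv (hI w hw)).continuousAt).mul
      ((H.hasDerivAt_slopeInv' (hI w hw)).continuousAt.pow 3)
  have hne' : ∀ v ∈ Set.Icc a b, v ≠ -deriv F z → slopeInv'' F ρ v ≠ 0 := by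
    intro v hv hvz
    obtain ⟨w, hw, rfl⟩ := hsurj v hv
    unfold slopeInv''
    rw [H.slopeInv_neg_deriv (hI w hw)]
    refine mul_ne_zero (hne w hw hv ?_) (pow_ne_zero 3 (H.slopeInv'_pos (hI w hw)).ne')
    rintro rfl
    exact hvz rfl
  obtain ⟨σ, c₁, C, hσ, hc₁, hbounds⟩ := exists_order_bounds hab hzab hcont hne' hlim hc
  refine ⟨σ, c₁, C, n, hn,
    { lt := hab
      mem := ?_
      sign := hσ
      c_pos := hc₁
      deriv_r := fun v hv => ?_
      deriv_r' := fun v hv => ?_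
      pos := H.slopeInv'_pos (hI z hz)
      bounds := hbounds
      deriv_h := fun m hm t ht htv hpos => ?_ }⟩
  · rcases hzab with h | h <;> rw [h]
    · exact Set.left_mem_Icc.2 hab.le
    · exact Set.right_mem_Icc.2 hab.le
  · obtain ⟨w, hw, rfl⟩ := hsurj v hv
    exact H.hasDerivAt_slopeInv (hI w hw)
  · obtain ⟨w, hw, rfl⟩ := hsurj v hv
    exact H.hasDerivAt_slopeInv' (hI w hw)
  · obtain ⟨w, hw, hwv⟩ := hsurj _ htv
    refine H.hasDerivAt_phase ⟨lt_of_le_of_ne (hx.trans hw.1) ?_, (hI w hw).2⟩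
      (by exact_mod_cast hm) ht hwv.symm
    rintro rfl
    rw [H.deriv_zero, neg_zero] at hwv
    exact hpos.ne hwv

/-- The ranges of summation on both sides of a zero-free interval of the third derivative are
blocks, with uniform constants. -/
theorem exists_phaseBlock (H : IsProfile E F ρ) {x y : ℝ} (hx : 0 ≤ x) (hxy : x < y) (hy : y < ρ)
    (hzero : deriv (deriv (deriv F)) x = 0)
    (hne : ∀ w ∈ Set.Ioo x y, deriv (deriv (deriv F)) w ≠ 0)
    (hfinx : ∃ k, iteratedDeriv k (deriv (deriv (deriv F))) x ≠ 0)
    (hfiny : ∃ k, iteratedDeriv k (deriv (deriv (deriv F))) y ≠ 0) :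
    ∃ K₁ K₂ : ℝ, 1 ≤ K₁ ∧ 1 ≤ K₂ ∧ ∀ U : ℝ, 0 < U →
      U ≤ (deriv F y ^ 2 - deriv F x ^ 2) / 4 →
      (∃ α σ W κ : ℝ, PhaseBlock K₁ α σ (deriv F x ^ 2 + U) U W κ (phase E) (slopeInv F ρ)
        (slopeInv' F ρ) (slopeInv'' F ρ)) ∧
      ∃ α σ W κ : ℝ, PhaseBlock K₂ α σ (deriv F y ^ 2 - 2 * U) U W κ (phase E) (slopeInv F ρ)
        (slopeInv' F ρ) (slopeInv'' F ρ) := by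
  have hρ := H.pos
  have hmono := H.strictMonoOn_neg_deriv
  have hx' : x ∈ Set.Ioo (-ρ) ρ := ⟨by linarith, by linarith⟩
  have hy' : y ∈ Set.Ioo (-ρ) ρ := ⟨by linarith, hy⟩
  have hI : ∀ w ∈ Set.Icc x y, w ∈ Set.Ioo (-ρ) ρ := fun w hw =>
    ⟨by linarith [hw.1], by linarith [hw.2]⟩
  rw [← neg_sq (deriv F x), ← neg_sq (deriv F y)]
  set a := -deriv F x with ha
  set b := -deriv F y with hb
  have hab : a < b := hmono hx' hy' hxy
  have ha0 : 0 ≤ a := by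
    have := hmono.monotoneOn (a := 0) (b := x) ⟨by linarith, hρ⟩ hx' hx
    simpa [ha, H.deriv_zero] using this
  -- The midpoint of the squared slopes: `U ≤ (b² - a²) / 4` amounts to `a² + 2 U ≤ c²`, and equally
  -- to `c² + 2 U ≤ b²`. Each half contains only one possible zero of `r''`, at its end.
  set c := √((a ^ 2 + b ^ 2) / 2) with hc
  have hcsq : c ^ 2 = (a ^ 2 + b ^ 2) / 2 := Real.sq_sqrt (by positivity)
  have hc0 : 0 ≤ c := Real.sqrt_nonneg _
  have hac : a < c := lt_of_pow_lt_pow_left₀ 2 hc0 (by nlinarith)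
  have hcb : c < b := lt_of_pow_lt_pow_left₀ 2 (by linarith) (by nlinarith)
  have hleft : ∃ K : ℝ, 1 ≤ K ∧ ∀ U : ℝ, 0 < U → a ^ 2 + 2 * U ≤ c ^ 2 →
      ∃ α σ W κ : ℝ, PhaseBlock K α σ (a ^ 2 + U) U W κ (phase E) (slopeInv F ρ)
        (slopeInv' F ρ) (slopeInv'' F ρ) := by
    obtain ⟨σ, c₁, C, n, hn, hO⟩ := H.exists_orderedPhase (z := x) (a := a) (b := c) hx hxy.le hy
      (Set.left_mem_Icc.2 hxy.le) le_rfl hac hcb.le (Or.inl rfl) (fun w hw hwc hwx => by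
        refine hne w ⟨lt_of_le_of_ne hw.1 hwx.symm, ?_⟩
        refine (hmono.lt_iff_lt (hI w hw) hy').1 ?_
        exact hwc.2.trans_lt hcb) hfinx
    rw [← ha] at hO
    -- Slope zero requires the block at the origin, where the order is positive because `F'''(x) =
    -- 0`.
    rcases ha0.eq_or_lt with h0 | h0
    · obtain ⟨k, rfl⟩ := Nat.exists_eq_succ_of_ne_zero (hn hzero)
      rw [← h0] at hO ⊢
      obtain ⟨K, hK, hKU⟩ := hO.exists_phaseBlock_zero
      refine ⟨K, hK, fun U hU hUc => ?_⟩
      rw [show (0 : ℝ) ^ 2 + U = U by ring]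
      exact ⟨_, _, _, _, hKU U hU (by linarith)⟩
    · obtain ⟨K, hK, hKU⟩ := hO.exists_phaseBlock_left h0
      exact ⟨K, hK, fun U hU hUc => ⟨_, _, _, _, hKU U hU hUc⟩⟩
  have hright : ∃ K : ℝ, 1 ≤ K ∧ ∀ U : ℝ, 0 < U → c ^ 2 + 2 * U ≤ b ^ 2 →
      ∃ α σ W κ : ℝ, PhaseBlock K α σ (b ^ 2 - 2 * U) U W κ (phase E) (slopeInv F ρ)
        (slopeInv' F ρ) (slopeInv'' F ρ) := by
    obtain ⟨σ, c₁, C, n, -, hO⟩ := H.exists_orderedPhase (z := y) (a := c) (b := b) hx hxy.le hy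
      (Set.right_mem_Icc.2 hxy.le) hac.le hcb le_rfl (Or.inr rfl) (fun w hw hwc hwy => by
        refine hne w ⟨?_, lt_of_le_of_ne hw.2 hwy⟩
        refine (hmono.lt_iff_lt hx' (hI w hw)).1 ?_
        exact hac.trans_le hwc.1) hfiny
    rw [← hb] at hO
    obtain ⟨K, hK, hKU⟩ := hO.exists_phaseBlock_right (ha0.trans_lt hac)
    exact ⟨K, hK, fun U hU hUc => ⟨_, _, _, _, hKU U hU hUc⟩⟩
  obtain ⟨K₁, hK₁, h₁⟩ := hleft
  obtain ⟨K₂, hK₂, h₂⟩ := hright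
  refine ⟨K₁, K₂, hK₁, hK₂, fun U hU hUb => ⟨h₁ U hU ?_, h₂ U hU ?_⟩⟩ <;> linarith

end IsProfile

section derivatives

variable {f : ℝ → ℝ} {ρ x : ℝ}

/-- One-sided derivatives at `0` agree with those of the even extension because the latter is smooth
across the axis. -/
theorem iteratedDerivWithin_Ico_eq (hF : ∀ x ∈ Set.Ioo (-ρ) ρ, ContDiffAt ℝ ∞ (fun x => f |x|) x)
    (n : ℕ) (hx : x ∈ Set.Ico 0 ρ) :
    iteratedDerivWithin n f (Set.Ico 0 ρ) x = iteratedDeriv n (fun x => f |x|) x := by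
  have h1 : Set.EqOn f (fun x => f |x|) (Set.Ico 0 ρ) := fun y hy => by
    simp only [abs_of_nonneg hy.1]
  have hρ : 0 < ρ := hx.1.trans_lt hx.2
  rw [iteratedDerivWithin_congr h1 hx]
  exact iteratedDerivWithin_eq_iteratedDeriv (uniqueDiffOn_Ico 0 ρ)
    ((hF x ⟨by linarith [hx.1], hx.2⟩).of_le (by exact_mod_cast le_top)) hx

theorem iteratedDeriv_deriv_three (F : ℝ → ℝ) (k : ℕ) :
    iteratedDeriv k (deriv (deriv (deriv F))) = iteratedDeriv (k + 3) F := by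
  simp only [iteratedDeriv_eq_iterate, Function.iterate_add_apply]
  rfl

end derivatives

end RevolutionBody

theorem theorem2 (E : Set E3) (f₁ f₂ : ℝ → ℝ) (rInf : ℝ)
    (hE : IsSmoothConvexBody E) (hrev : IsBodyOfRevolution E f₁ f₂ rInf)
    (hord : FiniteOrderZeros f₁ rInf)
    (j₀ : ℕ) (r : ℕ → ℝ) (hr : IsZeroSubdivision f₁ rInf j₀ r)
    (ε : ℝ) (hε : 0 < ε) (j : ℕ) (hj : j < j₀) :
    ∃ C : ℝ, ∀ R M U : ℝ, 1 < R → 0 < M → 2 * M ≤ R ^ (5 / 8 : ℝ) → 0 < U →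
      U ≤ (slopeSq f₁ rInf r (j + 1) - slopeSq f₁ rInf r j) / 4 →
      ‖expSum E R (slopeSq f₁ rInf r (j + 1) - 2 * U) (slopeSq f₁ rInf r (j + 1) - U) M‖ +
        ‖expSum E R (slopeSq f₁ rInf r j + U) (slopeSq f₁ rInf r j + 2 * U) M‖ ≤
      C * (M ^ 2 * R ^ (3 / 8 + ε)) := by
  have H := isProfile_of_isBodyOfRevolution hE hrev
  set F : ℝ → ℝ := fun x => f₁ |x| with hF
  have hmemI : ∀ i ≤ j₀, r i ∈ Set.Ico 0 rInf := by
    intro i hi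
    have h0 := hr.strictMonoOn.monotoneOn (a := 0) (b := i) (Nat.zero_le _) hi (Nat.zero_le _)
    have h1 := hr.strictMonoOn.monotoneOn (a := i) (b := j₀) hi (Set.mem_Iic.2 le_rfl) hi
    rw [hr.zero] at h0
    exact ⟨h0, h1.trans_lt hr.last_lt⟩
  have hiter : ∀ (n : ℕ), ∀ x ∈ Set.Ico 0 rInf,
      iteratedDerivWithin n f₁ (Set.Ico 0 rInf) x = iteratedDeriv n F x :=
    fun n x hx => iteratedDerivWithin_Ico_eq H.contDiffAt n hx
  have hthree : ∀ x, deriv (deriv (deriv F)) x = iteratedDeriv 3 F x := fun x => by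
    rw [← iteratedDeriv_deriv_three F 0, iteratedDeriv_zero]
  have hslope : ∀ i ≤ j₀, slopeSq f₁ rInf r i = deriv F (r i) ^ 2 := by
    intro i hi
    rw [slopeSq, ← iteratedDerivWithin_one, hiter 1 _ (hmemI i hi), iteratedDeriv_one]
  have hzero : ∀ x ∈ Set.Ico 0 rInf,
      (deriv (deriv (deriv F)) x = 0 ↔ x ∈ thirdDerivZeros f₁ rInf) := by
    intro x hx
    rw [hthree, ← hiter 3 x hx]
    exact ⟨fun h => ⟨hx, h⟩, fun h => h.2⟩
  -- Points that are not zeros have order `0`; this covers the arbitrary end point `r j₀`.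
  have hfin : ∀ x ∈ Set.Ico 0 rInf, ∃ k, iteratedDeriv k (deriv (deriv (deriv F))) x ≠ 0 := by
    intro x hx
    by_cases h : x ∈ thirdDerivZeros f₁ rInf
    · obtain ⟨n, hn, hn0⟩ := hord x h
      refine ⟨n - 3, ?_⟩
      rw [iteratedDeriv_deriv_three, Nat.sub_add_cancel hn.le, ← hiter n x hx]
      exact hn0
    · refine ⟨0, ?_⟩
      rw [iteratedDeriv_zero]
      exact fun h0 => h ((hzero x hx).1 h0)
  have hj' : r j < r (j + 1) := hr.strictMonoOn (Set.mem_Iic.2 hj.le) hj (Nat.lt_succ_self j)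
  have hIj := hmemI j hj.le
  have hIj' := hmemI (j + 1) hj
  obtain ⟨K₁, K₂, hK₁, hK₂, hK⟩ := H.exists_phaseBlock hIj.1 hj' hIj'.2
    ((hzero _ hIj).2 (by rw [hr.zeros]; exact ⟨j, hj, rfl⟩)) (fun w hw h0 => by
      rw [hzero w ⟨hIj.1.trans hw.1.le, hw.2.trans hIj'.2⟩, hr.zeros] at h0
      obtain ⟨k, hk, rfl⟩ := h0
      have h1 := (hr.strictMonoOn.lt_iff_lt (Set.mem_Iic.2 hj.le) (Set.mem_Iic.2 (le_of_lt hk))).1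
        hw.1
      have h2 := (hr.strictMonoOn.lt_iff_lt (Set.mem_Iic.2 (le_of_lt hk)) (Set.mem_Iic.2 hj)).1 hw.2
      omega) (hfin _ hIj) (hfin _ hIj')
  obtain ⟨C₁, -, hC₁⟩ := exists_norm_phaseSum_le hK₁ hε
  obtain ⟨C₂, -, hC₂⟩ := exists_norm_phaseSum_le hK₂ hε
  refine ⟨C₂ + C₁, fun R M U hR hM hMR hU hUu => ?_⟩
  rw [hslope _ hj.le, hslope _ hj] at hUu ⊢
  obtain ⟨⟨α₁, σ₁, W₁, κ₁, h₁⟩, α₂, σ₂, W₂, κ₂, h₂⟩ := hK U hU hUu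
  have e₁ := hC₁ _ _ _ _ _ _ _ _ _ _ h₁ R M hR hM hMR
  have e₂ := hC₂ _ _ _ _ _ _ _ _ _ _ h₂ R M hR hM hMR
  have s₁ : phaseSum (phase E) R (deriv F (r j) ^ 2 + U) U M =
      expSum E R (deriv F (r j) ^ 2 + U) (deriv F (r j) ^ 2 + 2 * U) M := by
    rw [show deriv F (r j) ^ 2 + 2 * U = deriv F (r j) ^ 2 + U + U by ring]
    rfl
  have s₂ : phaseSum (phase E) R (deriv F (r (j + 1)) ^ 2 - 2 * U) U M =
      expSum E R (deriv F (r (j + 1)) ^ 2 - 2 * U) (deriv F (r (j + 1)) ^ 2 - U) M := by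
    rw [show deriv F (r (j + 1)) ^ 2 - U = deriv F (r (j + 1)) ^ 2 - 2 * U + U by ring]
    rfl
  rw [s₁] at e₁
  rw [s₂] at e₂
  rw [add_mul]
  exact add_le_add e₂ e₁
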